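/- Let $m\ge 1$ be an integer and $\alpha\ge 0$ real. The Wishart–Laguerre ensemble is the probability law on $(0,\infty)^m$ with density proportional to $$\prod_{1\le i<j\le m}(x_i-x_j)^2\prod_{i=1}^m x_i^{\alpha}e^{-x_i}$$ (the same formula defines it for all $\alpha>-1$). For integers $k\ge 0$ put $T_k=\sum_{i=1}^m x_i^k\ln x_i$, $R_k=\sum_{i=1}^m x_i^k$, $T=T_1$, $R=R_1$. All moments of these statistics are finite. For linear statistics ${\bf X}=(X_1,\dots,X_l)$, $X_j=\sum_{i=1}^m f_j(x_i)$, let $$\kappa_l({\bf X})=\sum_{\{P_1,\dots,P_q\}}(-1)^{q-1}(q-1)!\prod_{i=1}^q\mathbb E\Big[\prod_{j\in P_i}X_j\Big]$$ be the joint cumulant (the sum is over the partitions of $\{1,\dots,l\}$), let $\kappa^{\pm}$ be the same cumulant with $m$ replaced by $m\pm1$ (for $m=1$, $\kappa^-=0$), let ${\bf X}_p=(X_j)_{j\in p}$, and put $$H_l({\bf X})=\sum_{\{p_1,\dots,p_i\}}\prod_{j=1}^i\big(\kappa^+({\bf X}_{p_j})-\kappa({\bf X}_{p_j})\big),\qquad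 h_l({\bf X})=-\sum_{\{p_1,\dots,p_i\}}\prod_{j=1}^i\big(\kappa^-({\bf X}_{p_j})-\kappa({\bf X}_{p_j})\big),$$ $$D_l({\bf X})=\sum_{j=1}^l\kappa_l(X_1,\dots,X_j',\dots,X_l),\qquad X_j'=\sum_{i=1}^m x_i f_j'(x_i).$$ For $1\le s\le l-1$ and $k\ge0$ let $$H_{l,s}(k)=\sum_{r=0}^{k-1}H_s(T_r,T,\dots,T)\,h_{l-s}(T_{k-r-1},T,\dots,T),\quad D_{l,s}(k)=\sum_{r=0}^{k-1}D_s(T_r,T,\dots,T)\,D_{l-s}(T_{k-r-1},T,\dots,T).$$ Then for all integers $l\ge 2$ and $k\ge 0$ the function $\alpha\mapsto\kappa_{l-1}(T_{k+1},T,\dots,T)$ is differentiable and $$\kappa_l(T_k,T,\dots,T)-\frac{\mathrm d}{\mathrm d\alpha}\kappa_{l-1}(T_{k+1},T,\dots,T)=\delta_l(k),$$ $$\delta_l(k)=\sum_{s=1}^{l-1}\frac{(l-2)!}{(s-1)!\,(l-s-1)!}\big(\kappa(R)\,H_{l,s}(k)-D_{l,s}(k)\big),$$ so that $\delta_l(k)$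 is composed of joint cumulants of order at most $l-1$. Moreover, for $s\ge1$ and $r\ge0$, $$D_s(T_r,T,\dots,T)=\sum_{i=0}^{s-1}\frac{(s-1)!}{(s-1-i)!}\Big((r+s-1-i)\,\kappa_{s-i}(T_r,T,\dots,T)+\kappa_{s-i}(R_r,T,\dots,T)\Big).$$ -/

import Mathlib

open MeasureTheory

noncomputable section

namespace WishartLaguerre

/-- The unnormalised joint density
`∏_{i<j} (x_i - x_j)^2 ∏_i x_i^α e^{-x_i}` of the Wishart-Laguerre ensemble. -/
def density (m : ℕ) (α : ℝ) (x : Fin m → ℝ) : ℝ :=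
  (∏ i, ∏ j ∈ Finset.Ioi i, (x i - x j) ^ 2) * ∏ i, (x i ^ α * Real.exp (-x i))

/-- The measure with the above density on `(0, ∞)^m`. -/
def weightMeasure (m : ℕ) (α : ℝ) : Measure (Fin m → ℝ) :=
  (volume.restrict (Set.univ.pi fun _ => Set.Ioi 0)).withDensity
    fun x => ENNReal.ofReal (density m α x)

/-- The Wishart-Laguerre ensemble: the law of the `m` eigenvalues. -/
def ensemble (m : ℕ) (α : ℝ) : Measure (Fin m → ℝ) :=
  (weightMeasure m α Set.univ)⁻¹ • weightMeasure m α

/-- The linear statistic `∑ i, f (x_i)`. -/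
def linStat (m : ℕ) (f : ℝ → ℝ) (x : Fin m → ℝ) : ℝ := ∑ i, f (x i)

/-- The function `x ^ k * log x`, whose linear statistic is `T_k`. -/
def tFun (k : ℕ) (x : ℝ) : ℝ := x ^ k * Real.log x

/-- The function `x ^ k`, whose linear statistic is `R_k`. -/
def rFun (k : ℕ) (x : ℝ) : ℝ := x ^ k

/-- The joint cumulant `κ(X_j : j ∈ s)`, over the ensemble with `m` eigenvalues and parameter `α`,
of the linear statistics `X_j = ∑ i, f_j (x_i)`:
`∑_{P_1, …, P_q} (-1)^(q-1) (q-1)! ∏_i E[∏_{j ∈ P_i} X_j]`, over the partitions of `s`. -/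
def cumulant {ι : Type*} [DecidableEq ι] (m : ℕ) (α : ℝ) (f : ι → ℝ → ℝ) (s : Finset ι) : ℝ :=
  ∑ π : Finpartition s, (-1) ^ (π.parts.card - 1) * ((π.parts.card - 1).factorial : ℝ) *
    ∏ P ∈ π.parts, ∫ x, ∏ j ∈ P, linStat m (f j) x ∂(ensemble m α)

/-- The joint cumulant `κ_l(X_1, …, X_l)` of the whole family. -/
def kappa {l : ℕ} (m : ℕ) (α : ℝ) (f : Fin l → ℝ → ℝ) : ℝ :=
  cumulant m α f Finset.univ

/-- The tuple of length `l` of functions `(g, x log x, …, x log x)`, whose linear statistics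
are `(X, T, …, T)`. -/
def withT (g : ℝ → ℝ) (l : ℕ) (i : Fin l) : ℝ → ℝ :=
  if (i : ℕ) = 0 then g else tFun 1

/-- `H_l(X) = ∑_{p_1, …, p_i} ∏_j (κ⁺(X_{p_j}) - κ(X_{p_j}))`, with `κ⁺` the cumulant for `m + 1`
eigenvalues and the sum over the partitions of `{1, …, l}`. -/
def bigH {l : ℕ} (m : ℕ) (α : ℝ) (f : Fin l → ℝ → ℝ) : ℝ :=
  ∑ π : Finpartition (Finset.univ : Finset (Fin l)),
    ∏ p ∈ π.parts, (cumulant (m + 1) α f p - cumulant m α f p)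

/-- `h_l(X) = -∑_{p_1, …, p_i} ∏_j (κ⁻(X_{p_j}) - κ(X_{p_j}))`, with `κ⁻` the cumulant for `m - 1`
eigenvalues. (For `m = 1`, `κ⁻` refers to no eigenvalue at all and vanishes.) -/
def smallH {l : ℕ} (m : ℕ) (α : ℝ) (f : Fin l → ℝ → ℝ) : ℝ :=
  -∑ π : Finpartition (Finset.univ : Finset (Fin l)),
    ∏ p ∈ π.parts, (cumulant (m - 1) α f p - cumulant m α f p)

/-- `D_l(X) = κ'_l(X) = ∑_j κ(X_1, …, X_j', …, X_l)`, where `X_j' = ∑ i, x_i f_j'(x_i)`. -/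
def bigD {l : ℕ} (m : ℕ) (α : ℝ) (f : Fin l → ℝ → ℝ) : ℝ :=
  ∑ j, kappa m α (Function.update f j fun x => x * deriv (f j) x)

/-- `H_{l,s}(k) = ∑_{r<k} H_s(T_r, T, …, T) h_{l-s}(T_{k-r-1}, T, …, T)`. -/
def prodH (m : ℕ) (α : ℝ) (l s k : ℕ) : ℝ :=
  ∑ r ∈ Finset.range k,
    bigH m α (withT (tFun r) s) * smallH m α (withT (tFun (k - r - 1)) (l - s))

/-- `D_{l,s}(k) = ∑_{r<k} D_s(T_r, T, …, T) D_{l-s}(T_{k-r-1}, T, …, T)`. -/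
def prodD (m : ℕ) (α : ℝ) (l s k : ℕ) : ℝ :=
  ∑ r ∈ Finset.range k,
    bigD m α (withT (tFun r) s) * bigD m α (withT (tFun (k - r - 1)) (l - s))

/-- The decoupled term `δ_l(k)`; `κ(R)` is the mean of `R = R_1`. -/
def decoupled (m : ℕ) (α : ℝ) (l k : ℕ) : ℝ :=
  ∑ s ∈ Finset.Icc 1 (l - 1),
    ((l - 2).factorial : ℝ) / ((s - 1).factorial * (l - s - 1).factorial) *
      (kappa m α (withT (rFun 1) 1) * prodH m α l s k - prodD m α l s k)

end WishartLaguerre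

end

open WishartLaguerre

noncomputable section

namespace WishartLaguerre

/-! ### Set partitions, joint cumulants and exponential generating series -/

section Combinatorics

open Finset

variable {ι : Type*} [DecidableEq ι]

/-! Tilt the ensemble by `exp(zT)`. The cumulants of `(X, T, …, T)` are the exponential Taylor
coefficients in `z` of the tilted mean `⟨X⟩ = E[X exp(zT)] / E[exp(zT)]`, and those of `(X, Y, T, …,
T)` are the coefficients of the tilted covariance. Since `exp(z x log x)` is not integrable against
the weight for `z > 0`, `z` is kept formal: the one-particle functional `tilted` takes values in
`ℝ⟦X⟧`. The theory of orthogonal polynomials is therefore developed over a commutative ring, asking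
only that the squared norms `h_n` of the monic orthogonal polynomials `p_n` be units. The unitary
ensemble is determinantal with kernel `K(x, y) = ∑_{j<m} p_j(x) p_j(y) / h_j`, which expresses means
and covariances (`opMean`, `opCov`) through the functional.

Differentiation in `α` inserts `T_0 = ∑ log x_i`, so the left side of the theorem is a coefficient
of `Cov(T_k, T_1) - Cov(T_{k+1}, T_0)`. Only the `K²` integrals survive, and symmetrisation turns
them into `(1/2) ∑_r` of the double integrals of `x^r y^(k-r-1) log x log y (x - y)² K(x, y)²`. By
Christoffel-Darboux, `(x - y) K(x, y)` is `(p_m(x) p_{m-1}(y) - p_{m-1}(x) p_m(y)) / h_{m-1}`, so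
every double integral splits into products of single ones (`opCov_sub_opCov`). This is the
decoupling.

The single integrals are then identified. Those of `p_m² f` and `p_{m-1}² f` are, up to norms, the
changes of `⟨f⟩` on adding or removing a particle. The partition sums `H` and `h` multiply such a
change by the normalised ratio of the `E[exp(zT)]` for the two numbers of particles (exponential
formula), and this ratio is a tilted norm over its value at `z = 0`, or the inverse. What remains is
`h_m / h_{m-1}` at `z = 0`, which is `κ(R)`. The integral of `p_m p_{m-1} f` is `h_{m-1} Cov(f, x)`,
and integration by parts with `x d/dx` (the loop equation `tMean_eulerDerivation`) shows that
`Cov(f, x)` generates the `D_s`. Applied to `T_r`, the same equation is a linear recurrence for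
`D_s`, whose solution is the last formula. -/

theorem sum_finpartition_sum_parts (s : Finset ι) (F : Finset ι → Finset (Finset ι) → ℝ) :
    ∑ π : Finpartition s, ∑ B ∈ π.parts, F B (π.parts.erase B)
      = ∑ B ∈ s.powerset.erase ∅, ∑ ρ : Finpartition (s \ B), F B ρ.parts := by
  have avoid_parts : ∀ (π : Finpartition s) (B : Finset ι), B ∈ π.parts →
      (π.avoid B).parts = π.parts.erase B := by
    intro π B hB
    ext C
    rw [Finpartition.mem_avoid, mem_erase]
    constructor
    · rintro ⟨D, hD, hDB, rfl⟩
      have hne : D ≠ B := fun h => hDB h.le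
      have : D \ B = D := sdiff_eq_self_of_disjoint (π.disjoint hD hB hne)
      rw [this]
      exact ⟨hne, hD⟩
    · rintro ⟨hne, hC⟩
      have hd : Disjoint C B := π.disjoint hC hB hne
      refine ⟨C, hC, fun hle => π.ne_bot hC (hd.eq_bot_of_le hle), sdiff_eq_self_of_disjoint hd⟩
  have notMem_parts : ∀ (B : Finset ι) (ρ : Finpartition (s \ B)), B ≠ ∅ → B ∉ ρ.parts := by
    intro B ρ hB h
    have h1 : B ≤ s \ B := ρ.le h
    exact hB (disjoint_self.1 (disjoint_sdiff.mono_right h1))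
  rw [sum_sigma', sum_sigma']
  -- Marking a block `B` of a partition of `s` amounts to choosing a nonempty `B ⊆ s` and a
  -- partition of `s \ B`.
  refine sum_bij' (fun x _ => ⟨x.2, x.1.avoid x.2⟩)
    (fun x hx => ⟨x.2.extend (b := x.1) (c := s)
        (by simp only [mem_sigma, mem_erase] at hx; exact hx.1.1) sdiff_disjoint
        (by simp only [mem_sigma, mem_erase, mem_powerset] at hx
            exact sdiff_union_of_subset hx.1.2), x.1⟩) ?_ ?_ ?_ ?_ ?_
  · rintro ⟨π, B⟩ h
    simp only [mem_sigma, mem_univ, true_and] at h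
    simp only [mem_sigma, mem_erase, mem_powerset, mem_univ, and_true]
    exact ⟨π.ne_bot h, π.le h⟩
  · rintro ⟨B, ρ⟩ h
    simp [Finpartition.extend]
  · rintro ⟨π, B⟩ h
    simp only [mem_sigma, mem_univ, true_and] at h
    refine Sigma.ext (Finpartition.ext ?_) HEq.rfl
    simp only [Finpartition.extend_parts]
    rw [avoid_parts π B h, insert_erase h]
  · rintro ⟨B, ρ⟩ h
    simp only [mem_sigma, mem_erase, mem_powerset, mem_univ, and_true] at h
    refine Sigma.ext rfl (heq_of_eq (Finpartition.ext ?_))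
    rw [avoid_parts _ _ (by simp [Finpartition.extend])]
    simp only [Finpartition.extend_parts]
    exact erase_insert (notMem_parts B ρ h.1)
  · rintro ⟨π, B⟩ h
    simp only [mem_sigma, mem_univ, true_and] at h
    simp only
    rw [avoid_parts π B h]

/-- The sum over the partitions of `s` of the product of the values of `K` at the blocks. -/
def partitionSum (K : Finset ι → ℝ) (s : Finset ι) : ℝ :=
  ∑ π : Finpartition s, ∏ p ∈ π.parts, K p

/-- The joint cumulant attached to a family `M` of joint moments. -/
def setCumulant (M : Finset ι → ℝ) (s : Finset ι) : ℝ :=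
  ∑ π : Finpartition s, (-1) ^ (π.parts.card - 1) * ((π.parts.card - 1).factorial : ℝ) *
    ∏ P ∈ π.parts, M P

theorem partitionSum_empty (K : Finset ι → ℝ) : partitionSum K ∅ = 1 := by
  unfold partitionSum
  have h : ∀ π : Finpartition (∅ : Finset ι), π.parts = ∅ := fun π =>
    eq_empty_of_forall_notMem fun B hB => π.ne_bot hB (le_bot_iff.1 (π.le hB))
  let π₀ : Finpartition (∅ : Finset ι) := Finpartition.empty (Finset ι)
  have hs : (univ : Finset (Finpartition (∅ : Finset ι))) = {π₀} :=
    eq_singleton_iff_unique_mem.2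
      ⟨mem_univ _, fun π _ => Finpartition.ext ((h _).trans (h _).symm)⟩
  rw [hs, sum_singleton, h, prod_empty]

theorem sum_parts_ite_mem {s : Finset ι} (π : Finpartition s) {a : ι} (ha : a ∈ s) (c : ℝ) :
    ∑ B ∈ π.parts, (if a ∈ B then c else 0) = c := by
  rw [sum_eq_single (π.part a)]
  · rw [if_pos (π.mem_part ha)]
  · intro B hB hne
    rw [if_neg]
    intro haB
    exact hne (π.part_eq_of_mem hB haB).symm
  · intro h
    exact (h (π.part_mem.2 ha)).elim

theorem sum_powerset_insert_erase_empty {s : Finset ι} {a : ι} (ha : a ∉ s)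
    (G : Finset ι → ℝ) :
    ∑ B ∈ (insert a s).powerset.erase ∅, (if a ∈ B then G B else 0)
      = ∑ A ∈ s.powerset, G (insert a A) := by
  rw [sum_erase _ (by simp), sum_powerset_insert ha]
  have h1 : ∑ t ∈ s.powerset, (if a ∈ t then G t else 0) = 0 :=
    sum_eq_zero fun t ht => if_neg fun h => ha (mem_powerset.1 ht h)
  rw [h1, zero_add]
  simp

/-- Partitions are classified by the block `insert a A` that contains `a`. -/
theorem partitionSum_insert (K : Finset ι → ℝ) {s : Finset ι} {a : ι} (ha : a ∉ s) :
    partitionSum K (insert a s)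
      = ∑ A ∈ s.powerset, K (insert a A) * partitionSum K (s \ A) := by
  have key := sum_finpartition_sum_parts (insert a s)
    (fun B Q => if a ∈ B then K B * ∏ p ∈ Q, K p else 0)
  have hl : ∀ π : Finpartition (insert a s), ∑ B ∈ π.parts,
      (if a ∈ B then K B * ∏ p ∈ π.parts.erase B, K p else 0) = ∏ p ∈ π.parts, K p := by
    intro π
    rw [← sum_parts_ite_mem π (mem_insert_self a s) (∏ p ∈ π.parts, K p)]
    refine sum_congr rfl fun B hB => ?_
    rw [mul_prod_erase _ _ hB]
  rw [Fintype.sum_congr _ _ hl] at key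
  unfold partitionSum
  rw [key, show (∑ A ∈ s.powerset, K (insert a A) * ∑ π : Finpartition (s \ A), ∏ p ∈ π.parts, K p)
    = ∑ A ∈ s.powerset, K (insert a A) *
      ∑ ρ : Finpartition (insert a s \ insert a A), ∏ p ∈ ρ.parts, K p from ?_]
  · rw [← sum_powerset_insert_erase_empty ha
      (fun B => K B * ∑ ρ : Finpartition (insert a s \ B), ∏ p ∈ ρ.parts, K p)]
    refine sum_congr rfl fun B _ => ?_
    split_ifs
    · rw [mul_sum]
    · simp
  · refine sum_congr rfl fun A hA => ?_
    rw [show insert a s \ insert a A = s \ A from ?_]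
    rw [insert_sdiff_insert, sdiff_insert_of_notMem ha]

/-- Expanding the cumulants on the right gives a sum over partitions of `insert a s` with a possible
marked block avoiding `a`. A partition with `n` blocks gets the coefficient `c n + (n - 1) c (n -
1)`, which vanishes for `n ≥ 2`; only the one-block partition remains. -/
theorem moment_insert_eq_sum_setCumulant (M : Finset ι → ℝ) (hM : M ∅ = 1)
    {s : Finset ι} {a : ι} (ha : a ∉ s) :
    M (insert a s) = ∑ A ∈ s.powerset, setCumulant M (insert a A) * M (s \ A) := by
  set S := insert a s with hS
  set c : ℕ → ℝ := fun n => (-1) ^ (n - 1) * ((n - 1).factorial : ℝ) with hc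
  have key := sum_finpartition_sum_parts S
    (fun B Q => if a ∈ B then 0 else c Q.card * (M B * ∏ p ∈ Q, M p))
  have hl : ∀ π : Finpartition S, ∑ B ∈ π.parts,
      (if a ∈ B then 0 else c (π.parts.erase B).card * (M B * ∏ p ∈ π.parts.erase B, M p))
      = ((π.parts.card : ℝ) - 1) * c (π.parts.card - 1) * ∏ p ∈ π.parts, M p := by
    intro π
    set d := c (π.parts.card - 1) * ∏ p ∈ π.parts, M p with hd
    have h1 : ∀ B ∈ π.parts,
        (if a ∈ B then 0 else c (π.parts.erase B).card * (M B * ∏ p ∈ π.parts.erase B, M p))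
        = d - (if a ∈ B then d else 0) := by
      intro B hB
      rw [mul_prod_erase _ _ hB, card_erase_of_mem hB]
      split_ifs <;> simp [hd]
    rw [sum_congr rfl h1, sum_sub_distrib, sum_parts_ite_mem π (mem_insert_self a s), sum_const,
      nsmul_eq_mul, hd]
    ring
  rw [Fintype.sum_congr _ _ hl] at key
  have hr : ∑ A ∈ s.powerset, setCumulant M (insert a A) * M (s \ A)
      = ∑ B ∈ s.powerset, setCumulant M (S \ B) * M B := by
    refine sum_nbij' (fun A => s \ A) (fun A => s \ A) ?_ ?_ ?_ ?_ ?_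
    · intro A _; simp
    · intro A _; simp
    · intro A hA; simpa using mem_powerset.1 hA
    · intro A hA; simpa using mem_powerset.1 hA
    · intro A hA
      congr 2
      have hA := mem_powerset.1 hA
      ext x
      simp only [hS, mem_insert, mem_sdiff]
      constructor
      · rintro (rfl | hx)
        · exact ⟨Or.inl rfl, fun h => ha h.1⟩
        · exact ⟨Or.inr (hA hx), fun h => h.2 hx⟩
      · rintro ⟨rfl | hx, h⟩
        · exact Or.inl rfl
        · exact Or.inr (by_contra fun h' => h ⟨hx, h'⟩)
  have hsplit : ∑ B ∈ s.powerset, setCumulant M (S \ B) * M B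
      = setCumulant M S + ∑ B ∈ S.powerset.erase ∅,
        ∑ ρ : Finpartition (S \ B),
          (if a ∈ B then 0 else c ρ.parts.card * (M B * ∏ p ∈ ρ.parts, M p)) := by
    have h0 : ∀ B : Finset ι, ∑ ρ : Finpartition (S \ B),
          (if a ∈ B then 0 else c ρ.parts.card * (M B * ∏ p ∈ ρ.parts, M p))
        = if a ∈ B then 0 else setCumulant M (S \ B) * M B := by
      intro B
      split_ifs
      · simp
      · unfold setCumulant
        rw [sum_mul]
        refine sum_congr rfl fun ρ _ => ?_
        rw [hc]; ring
    rw [sum_congr rfl fun B _ => h0 B]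
    -- The case of no marked block is the term `B = ∅`, thanks to `M ∅ = 1`.
    have h2 : setCumulant M S = (fun B => if a ∈ B then 0 else setCumulant M (S \ B) * M B) ∅ := by
      simp [hM]
    rw [h2, add_sum_erase _ (fun B => if a ∈ B then 0 else setCumulant M (S \ B) * M B)
      (empty_mem_powerset S)]
    nth_rw 2 [hS]
    rw [sum_powerset_insert ha]
    rw [sum_congr rfl (g := fun _ => (0 : ℝ)) (s₁ := s.powerset)
      (f := fun t => if a ∈ insert a t then 0 else _) (by intro x _; simp)]
    rw [sum_const_zero, add_zero]
    refine sum_congr rfl fun B hB => ?_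
    rw [if_neg fun h => ha (mem_powerset.1 hB h)]
  rw [hr, hsplit, ← key]
  unfold setCumulant
  rw [← sum_add_distrib]
  have hSne : S ≠ ⊥ := (insert_nonempty a s).ne_empty
  rw [Fintype.sum_eq_single (Finpartition.indiscrete hSne)]
  · simp [hc]
  · intro π hπ
    have hcard : 2 ≤ π.parts.card := by
      have h1 : π.parts.Nonempty := π.parts_nonempty hSne
      have h2 : 1 ≤ π.parts.card := h1.card_pos
      rcases h2.lt_or_eq with h | h
      · exact h
      · exfalso
        obtain ⟨B, hB⟩ := card_eq_one.1 h.symm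
        apply hπ
        apply Finpartition.ext
        have : π.parts.sup id = S := π.sup_parts
        rw [hB, sup_singleton] at this
        rw [hB, Finpartition.indiscrete_parts]
        simpa using this
    obtain ⟨n, hn⟩ := Nat.exists_eq_add_of_le hcard
    rw [hn]
    simp only [hc]
    rw [show 2 + n - 1 = n + 1 by omega, show n + 1 - 1 = n by omega, Nat.factorial_succ]
    push_cast
    ring

/-- The `n`-th coefficient of `U` as an exponential generating series. -/
def ecoeff (n : ℕ) (U : PowerSeries ℝ) : ℝ := n.factorial * PowerSeries.coeff n U

/-- The exponential generating series of a sequence. -/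
def egf (a : ℕ → ℝ) : PowerSeries ℝ := PowerSeries.mk fun n => a n / n.factorial

theorem ecoeff_egf (a : ℕ → ℝ) (n : ℕ) : ecoeff n (egf a) = a n := by
  have : (n.factorial : ℝ) ≠ 0 := by positivity
  simp only [ecoeff, egf, PowerSeries.coeff_mk]
  field_simp

theorem ecoeff_mul (n : ℕ) (U V : PowerSeries ℝ) :
    ecoeff n (U * V) = ∑ j ∈ range (n + 1), (n.choose j : ℝ) * (ecoeff j U * ecoeff (n - j) V) := by
  unfold ecoeff
  rw [PowerSeries.coeff_mul, Nat.sum_antidiagonal_eq_sum_range_succ_mk, mul_sum]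
  refine sum_congr rfl fun j hj => ?_
  have hj' : j ≤ n := by simpa [Nat.lt_succ_iff] using hj
  rw [← Nat.choose_mul_factorial_mul_factorial hj']
  push_cast
  ring

theorem sum_powerset_ecoeff_mul (s : Finset ι) (U V : PowerSeries ℝ) :
    ∑ A ∈ s.powerset, ecoeff A.card U * ecoeff (s \ A).card V = ecoeff s.card (U * V) := by
  rw [ecoeff_mul]
  simp_rw [← nsmul_eq_mul]
  rw [← sum_powerset_apply_card (fun j => ecoeff j U * ecoeff (s.card - j) V)]
  refine sum_congr rfl fun A hA => ?_
  rw [card_sdiff_of_subset (mem_powerset.1 hA)]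

/-- Division by an exponential generating series with constant term `1`, at the level of sets. -/
theorem eq_ecoeff_of_sum_powerset (φ : Finset ι → ℝ) (U V W : PowerSeries ℝ)
    (hV : ecoeff 0 V = 1) (hW : W = U * V) (s : Finset ι)
    (h : ∀ B ⊆ s, ecoeff B.card W = ∑ A ∈ B.powerset, φ A * ecoeff (B \ A).card V) :
    φ s = ecoeff s.card U := by
  induction s using Finset.strongInduction with
  | H s ih =>
    have h1 := h s (Finset.Subset.refl s)
    rw [hW, ← sum_powerset_ecoeff_mul] at h1
    have hs : s ∈ s.powerset := mem_powerset_self s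
    rw [← sum_erase_add _ _ hs, ← sum_erase_add _ _ hs] at h1
    have h2 : ∑ A ∈ s.powerset.erase s, φ A * ecoeff (s \ A).card V
        = ∑ A ∈ s.powerset.erase s, ecoeff A.card U * ecoeff (s \ A).card V := by
      refine sum_congr rfl fun A hA => ?_
      simp only [mem_erase, mem_powerset] at hA
      rw [ih A (hA.2.ssubset_of_ne hA.1) fun B hB => h B (hB.trans hA.2)]
    rw [h2] at h1
    rw [Finset.sdiff_self, card_empty, hV, mul_one, mul_one] at h1
    linarith

/-- When all the variables but one are exchangeable, moments depend on cardinalities only, and the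
moment-cumulant recursion becomes the product `EX = U * ET` of exponential series. -/
theorem setCumulant_insert_eq_ecoeff (M : Finset ι → ℝ) {s : Finset ι} {a : ι} (ha : a ∉ s)
    {ET EX U : PowerSeries ℝ} (h0 : ecoeff 0 ET = 1) (hT : ∀ B ⊆ s, M B = ecoeff B.card ET)
    (hX : ∀ B ⊆ s, M (insert a B) = ecoeff B.card EX) (hU : EX = U * ET) :
    setCumulant M (insert a s) = ecoeff s.card U := by
  have hM : M ∅ = 1 := by rw [hT ∅ (empty_subset s), card_empty, h0]
  refine eq_ecoeff_of_sum_powerset (fun B => setCumulant M (insert a B)) U ET EX h0 hU s ?_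
  intro B hB
  rw [← hX B hB, moment_insert_eq_sum_setCumulant M hM fun h => ha (hB h)]
  refine sum_congr rfl fun A hA => ?_
  rw [hT _ (sdiff_subset.trans hB)]

theorem setCumulant_insert_insert_eq_ecoeff (M : Finset ι → ℝ) {s : Finset ι} {a b : ι}
    (hab : a ≠ b) (ha : a ∉ s) (hb : b ∉ s)
    {ET EX EY EXY U V : PowerSeries ℝ} (h0 : ecoeff 0 ET = 1)
    (hT : ∀ B ⊆ s, M B = ecoeff B.card ET)
    (hX : ∀ B ⊆ s, M (insert a B) = ecoeff B.card EX)
    (hY : ∀ B ⊆ s, M (insert b B) = ecoeff B.card EY)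
    (hXY : ∀ B ⊆ s, M (insert a (insert b B)) = ecoeff B.card EXY)
    (hU : EX = U * ET) (hV : EXY = U * EY + V * ET) :
    setCumulant M (insert a (insert b s)) = ecoeff s.card V := by
  have hM : M ∅ = 1 := by rw [hT ∅ (empty_subset s), card_empty, h0]
  refine eq_ecoeff_of_sum_powerset (fun B => setCumulant M (insert a (insert b B))) V ET
    (V * ET) h0 rfl s ?_
  intro B hB
  have hbB : b ∉ B := fun h => hb (hB h)
  have h1 := moment_insert_eq_sum_setCumulant M hM (s := insert b B) (a := a)
    (by simpa [hab] using fun h => ha (hB h))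
  rw [sum_powerset_insert hbB, hXY B hB, hV] at h1
  have h2 : ∑ A ∈ B.powerset, setCumulant M (insert a A) * M (insert b B \ A)
      = ecoeff B.card (U * EY) := by
    rw [← sum_powerset_ecoeff_mul]
    refine sum_congr rfl fun A hA => ?_
    have hA := mem_powerset.1 hA
    rw [insert_sdiff_of_notMem _ fun h => hbB (hA h), hY _ (sdiff_subset.trans hB),
      setCumulant_insert_eq_ecoeff M (fun h => ha (hB (hA h))) h0
        (fun C hC => hT C (hC.trans (hA.trans hB))) (fun C hC => hX C (hC.trans (hA.trans hB))) hU]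
  have h3 : ecoeff B.card (U * EY + V * ET) = ecoeff B.card (U * EY) + ecoeff B.card (V * ET) := by
    simp [ecoeff, mul_add]
  rw [h2, h3] at h1
  rw [add_left_cancel h1]
  refine sum_congr rfl fun A hA => ?_
  rw [insert_sdiff_insert, sdiff_insert_of_notMem hbB, hT _ (sdiff_subset.trans hB)]

theorem ecoeff_succ (n : ℕ) (U : PowerSeries ℝ) :
    ecoeff (n + 1) U = ecoeff n (PowerSeries.derivative ℝ U) := by
  simp only [ecoeff, PowerSeries.coeff_derivative, Nat.factorial_succ]
  push_cast
  ring

/-- The exponential formula in differential form: removing the block of a chosen element is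
differentiation of the generating series, so `G` is the exponential of a primitive of `U`. -/
theorem partitionSum_eq_ecoeff (K : Finset ι → ℝ) {U G : PowerSeries ℝ} (h0 : ecoeff 0 G = 1)
    (hG : PowerSeries.derivative ℝ G = U * G) (s : Finset ι)
    (hK : ∀ a A, a ∉ A → insert a A ⊆ s → K (insert a A) = ecoeff A.card U) :
    partitionSum K s = ecoeff s.card G := by
  induction s using Finset.strongInduction with
  | H s ih =>
    rcases s.eq_empty_or_nonempty with rfl | ⟨a, ha⟩
    · rw [partitionSum_empty, card_empty, h0]
    · obtain ⟨t, hat, rfl⟩ : ∃ t, a ∉ t ∧ insert a t = s :=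
        ⟨s.erase a, notMem_erase a s, insert_erase ha⟩
      rw [partitionSum_insert K hat, card_insert_of_notMem hat, ecoeff_succ, hG,
        ← sum_powerset_ecoeff_mul]
      refine sum_congr rfl fun A hA => ?_
      have hA := mem_powerset.1 hA
      rw [hK a A (fun h => hat (hA h)) (insert_subset_insert a hA),
        ih (t \ A) (Finset.ssubset_of_subset_of_ssubset sdiff_subset (ssubset_insert hat))]
      intro b B hb hB
      exact hK b B hb (hB.trans (sdiff_subset.trans (subset_insert a t)))

theorem partitionSum_insert_eq_ecoeff (K : Finset ι → ℝ) {U V G : PowerSeries ℝ}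
    (h0 : ecoeff 0 G = 1) (hG : PowerSeries.derivative ℝ G = U * G) {s : Finset ι} {a : ι}
    (ha : a ∉ s) (hK : ∀ b A, b ∉ A → insert b A ⊆ s → K (insert b A) = ecoeff A.card U)
    (hV : ∀ A ⊆ s, K (insert a A) = ecoeff A.card V) :
    partitionSum K (insert a s) = ecoeff s.card (V * G) := by
  rw [partitionSum_insert K ha, ← sum_powerset_ecoeff_mul]
  refine sum_congr rfl fun A hA => ?_
  rw [hV A (mem_powerset.1 hA), partitionSum_eq_ecoeff K h0 hG]
  intro b B hb hB
  exact hK b B hb (hB.trans sdiff_subset)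

end Combinatorics

/-! ### Andréief's identity and the one- and two-point formulas for product functionals -/

section ProductFunctional

open Matrix PowerSeries

variable {R A B : Type*} [CommRing R] [CommRing A] [CommRing B] {m : ℕ}

/-- `Λ` is the `m`-fold product of the functional `L`, with respect to the coordinate embeddings
`ι i`. -/
def IsProductFunctional (ι : Fin m → A →+* B) (L : A →+ R) (Λ : B →+ R) : Prop :=
  ∀ f : Fin m → A, Λ (∏ i, ι i (f i)) = ∏ i, L (f i)

/-- The coefficientwise extension of an additive map to power series. -/
def mapCoeff (L : A →+ R) : PowerSeries A →+ PowerSeries R where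
  toFun f := PowerSeries.mk fun n => L (PowerSeries.coeff n f)
  map_zero' := by ext n; simp
  map_add' f g := by ext n; simp

@[simp]
theorem coeff_mapCoeff (L : A →+ R) (f : PowerSeries A) (n : ℕ) :
    PowerSeries.coeff n (mapCoeff L f) = L (PowerSeries.coeff n f) := by
  simp [mapCoeff]

/-- Together with `twist`, this permits first-order perturbation of the functional: the coefficient
of `X` after multiplication of the weight by `1 + X f` inserts the linear statistic of `f`. -/
theorem IsProductFunctional.powerSeries {ι : Fin m → A →+* B} {L : A →+ R} {Λ : B →+ R}
    (h : IsProductFunctional ι L Λ) :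
    IsProductFunctional (fun i => PowerSeries.map (ι i)) (mapCoeff L) (mapCoeff Λ) := by
  intro f
  ext n
  simp only [coeff_mapCoeff, PowerSeries.coeff_prod, map_sum, PowerSeries.coeff_map]
  exact Finset.sum_congr rfl fun l _ => h _

theorem IsProductFunctional.twist {ι : Fin m → A →+* B} {L : A →+ R} {Λ : B →+ R}
    (h : IsProductFunctional ι L Λ) (w : A) :
    IsProductFunctional ι (L.comp (AddMonoidHom.mulLeft w))
      (Λ.comp (AddMonoidHom.mulLeft (∏ i, ι i w))) := by
  intro f
  simp only [AddMonoidHom.coe_comp, Function.comp_apply, AddMonoidHom.coe_mulLeft]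
  rw [← Finset.prod_mul_distrib, ← h]
  simp

/-- **Andréief's identity**. -/
theorem IsProductFunctional.det_mul_det {ι : Fin m → A →+* B} {L : A →+ R} {Λ : B →+ R}
    (h : IsProductFunctional ι L Λ) (φ ψ : Fin m → A) :
    Λ ((of fun i j => ι i (φ j)).det * (of fun i j => ι i (ψ j)).det)
      = m.factorial * (of fun i j => L (φ i * ψ j)).det := by
  have h1 : ∀ σ ρ : Equiv.Perm (Fin m),
      Λ ((Equiv.Perm.sign σ • ∏ i, ι i (φ (σ i))) * (Equiv.Perm.sign ρ • ∏ i, ι i (ψ (ρ i))))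
      = Equiv.Perm.sign (ρ * σ⁻¹) • ∏ i, L (φ i * ψ ((ρ * σ⁻¹) i)) := by
    intro σ ρ
    rw [smul_mul_smul_comm, ← Finset.prod_mul_distrib]
    simp_rw [← map_mul]
    rw [Units.smul_def, map_zsmul, h, Units.smul_def]
    rw [← Equiv.prod_comp σ (fun i => L (φ i * ψ ((ρ * σ⁻¹) i)))]
    -- Reindexing by `σ` leaves a term depending on `ρ * σ⁻¹` only, so each `σ` contributes the same
    -- determinant; hence the factor `m!`.
    simp [mul_comm]
  rw [← det_transpose, det_apply, ← det_transpose (of fun i j => ι i (ψ j)), det_apply,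
    Finset.sum_mul_sum, map_sum]
  simp only [transpose_apply, of_apply, map_sum]
  rw [Finset.sum_congr rfl fun σ _ => Finset.sum_congr rfl fun ρ _ => h1 σ ρ]
  have h2 : ∀ σ : Equiv.Perm (Fin m), ∑ ρ : Equiv.Perm (Fin m),
      Equiv.Perm.sign (ρ * σ⁻¹) • ∏ i, L (φ i * ψ ((ρ * σ⁻¹) i))
      = (of fun i j => L (φ i * ψ j)).det := by
    intro σ
    rw [← det_transpose, det_apply]
    exact Fintype.sum_equiv (Equiv.mulRight σ⁻¹) _ _ fun ρ => by simp
  rw [Finset.sum_congr rfl fun σ _ => h2 σ, Finset.sum_const, Finset.card_univ, Fintype.card_perm,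
    Fintype.card_fin, nsmul_eq_mul]

theorem coeff_zero_prod_one_add {ι' : Type*} (s : Finset ι') (a : ι' → A) :
    PowerSeries.coeff 0 (∏ i ∈ s, (1 + X * PowerSeries.C (a i)) : PowerSeries A) = 1 := by
  rw [PowerSeries.coeff_zero_eq_constantCoeff_apply, map_prod]
  simp

theorem coeff_one_mul' (f g : PowerSeries A) :
    PowerSeries.coeff 1 (f * g) = PowerSeries.coeff 1 f * PowerSeries.coeff 0 g
      + PowerSeries.coeff 0 f * PowerSeries.coeff 1 g := by
  rw [PowerSeries.coeff_mul, Finset.Nat.antidiagonal_succ]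
  simp [add_comm]

theorem coeff_one_prod_one_add {ι' : Type*} (s : Finset ι') (a : ι' → A) :
    PowerSeries.coeff 1 (∏ i ∈ s, (1 + X * PowerSeries.C (a i)) : PowerSeries A)
      = ∑ i ∈ s, a i := by
  classical
  induction s using Finset.induction_on with
  | empty => simp [PowerSeries.coeff_one]
  | insert i s hi ih =>
    rw [Finset.prod_insert hi, coeff_one_mul', ih, coeff_zero_prod_one_add, Finset.sum_insert hi]
    have h1 : PowerSeries.coeff 1 (1 + X * PowerSeries.C (a i)) = a i := by
      rw [map_add, PowerSeries.coeff_one, if_neg one_ne_zero, zero_add]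
      exact (PowerSeries.coeff_succ_X_mul 0 (PowerSeries.C (a i))).trans (by simp)
    rw [h1]
    simp

/-- Jacobi's formula: the logarithmic derivative of the determinant is `tr (g⁻¹ F)`. -/
theorem coeff_one_det_add_smul {n : Type*} [Fintype n] [DecidableEq n] (g F : Matrix n n R)
    (hg : IsUnit g.det) :
    PowerSeries.coeff 1 (g.map PowerSeries.C + (X : PowerSeries R) • F.map PowerSeries.C).det
      = g.det * (g⁻¹ * F).trace := by
  have h1 : g.map PowerSeries.C + (X : PowerSeries R) • F.map PowerSeries.C
      = g.map PowerSeries.C * (1 + (X : PowerSeries R) • (g⁻¹ * F).map PowerSeries.C) := by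
    rw [Matrix.mul_add, Matrix.mul_one, Matrix.mul_smul, ← Matrix.map_mul,
      Matrix.mul_nonsing_inv_cancel_left _ _ hg]
  have h2 : (g.map PowerSeries.C : Matrix n n (PowerSeries R)).det = PowerSeries.C g.det :=
    ((PowerSeries.C (R := R)).map_det g).symm
  have h3 : ((g⁻¹ * F).map PowerSeries.C : Matrix n n (PowerSeries R)).trace
      = PowerSeries.C (g⁻¹ * F).trace := by
    simp only [Matrix.trace, diag_apply, Matrix.map_apply, map_sum]
  rw [h1, det_mul, h2, Matrix.det_one_add_smul, h3, PowerSeries.coeff_C_mul, map_add, map_add,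
    PowerSeries.coeff_one, if_neg one_ne_zero, zero_add]
  have h4 : PowerSeries.coeff 1 (PowerSeries.C (g⁻¹ * F).trace * X) = (g⁻¹ * F).trace := by
    rw [PowerSeries.coeff_C_mul, PowerSeries.coeff_one_X, mul_one]
  have h5 : ∀ f : PowerSeries R, PowerSeries.coeff 1 (f * X ^ 2) = 0 := by
    intro f
    rw [PowerSeries.coeff_mul_X_pow', if_neg (by norm_num)]
  rw [h4, h5, add_zero]

/-- The Gram matrix of the family `P` for the bilinear form `(a, b) ↦ L (a b f)`. -/
def gram (L : A →+ R) (P : Fin m → A) (f : A) : Matrix (Fin m) (Fin m) R :=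
  of fun i j => L (P i * P j * f)

/-- The alternant `det (P_j(x_i))`. -/
def alternant (ι : Fin m → A →+* B) (P : Fin m → A) : B := (of fun i j => ι i (P j)).det

theorem IsProductFunctional.alternant_sq {ι : Fin m → A →+* B} {L : A →+ R} {Λ : B →+ R}
    (h : IsProductFunctional ι L Λ) (P : Fin m → A) :
    Λ (alternant ι P ^ 2) = m.factorial * (gram L P 1).det := by
  rw [pow_two, alternant, h.det_mul_det]
  simp [gram]

theorem alternant_C (ι : Fin m → A →+* B) (P : Fin m → A) :
    alternant (fun i => PowerSeries.map (ι i)) (fun j => PowerSeries.C (P j))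
      = PowerSeries.C (alternant ι P) := by
  unfold alternant
  rw [RingHom.map_det]
  congr 1
  ext i j : 2
  simp

theorem gram_twist (L : A →+ R) (P : Fin m → A) (f f' : A) :
    gram ((mapCoeff L).comp (AddMonoidHom.mulLeft (1 + X * PowerSeries.C f)))
      (fun j => PowerSeries.C (P j)) (PowerSeries.C f')
      = (gram L P f').map PowerSeries.C
        + (X : PowerSeries R) • (gram L P (f' * f)).map PowerSeries.C := by
  ext i j n
  simp only [gram, of_apply, AddMonoidHom.coe_comp, Function.comp_apply, AddMonoidHom.coe_mulLeft,
    coeff_mapCoeff, Matrix.add_apply, Matrix.smul_apply, Matrix.map_apply, smul_eq_mul, map_add]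
  rw [← map_mul, ← map_mul, add_mul, one_mul, mul_assoc X, ← map_mul, map_add, map_add]
  congr 1
  · rw [PowerSeries.coeff_C, PowerSeries.coeff_C]; split_ifs <;> simp
  · cases n with
    | zero => simp
    | succ n =>
      rw [PowerSeries.coeff_succ_X_mul, PowerSeries.coeff_succ_X_mul, PowerSeries.coeff_C,
        PowerSeries.coeff_C, mul_comm, mul_assoc (P i * P j)]
      split_ifs <;> simp

theorem gram_twist_one (L : A →+ R) (P : Fin m → A) (f : A) :
    gram ((mapCoeff L).comp (AddMonoidHom.mulLeft (1 + X * PowerSeries.C f)))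
      (fun j => PowerSeries.C (P j)) 1
      = (gram L P 1).map PowerSeries.C
        + (X : PowerSeries R) • (gram L P f).map PowerSeries.C := by
  have h := gram_twist L P f 1
  rwa [map_one, one_mul] at h

/-- Andréief's identity for the weight perturbed by `1 + X f`, read at first order in `X`. -/
theorem IsProductFunctional.alternant_sq_mul_sum {ι : Fin m → A →+* B} {L : A →+ R} {Λ : B →+ R}
    (h : IsProductFunctional ι L Λ) (P : Fin m → A) (hg : IsUnit (gram L P 1).det) (f : A) :
    Λ (alternant ι P ^ 2 * ∑ i, ι i f)
      = m.factorial * ((gram L P 1).det * ((gram L P 1)⁻¹ * gram L P f).trace) := by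
  have key := (h.powerSeries.twist (1 + X * PowerSeries.C f)).alternant_sq
    (fun j => PowerSeries.C (P j))
  rw [gram_twist_one, alternant_C] at key
  have k1 := congrArg (PowerSeries.coeff 1) key
  rw [show ((m.factorial : ℕ) : PowerSeries R) = PowerSeries.C ((m.factorial : ℕ) : R) by simp,
    PowerSeries.coeff_C_mul, coeff_one_det_add_smul _ _ hg] at k1
  rw [← k1]
  simp only [AddMonoidHom.coe_comp, Function.comp_apply, AddMonoidHom.coe_mulLeft, coeff_mapCoeff]
  rw [← map_pow, mul_comm (∏ i, _), PowerSeries.coeff_C_mul]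
  congr 2
  rw [← coeff_one_prod_one_add]
  simp

theorem map_coeff_one_mul {n : Type*} [Fintype n] (M N : Matrix n n (PowerSeries R)) :
    (M * N).map (PowerSeries.coeff 1)
      = M.map (PowerSeries.coeff 1) * N.map (PowerSeries.coeff 0)
        + M.map (PowerSeries.coeff 0) * N.map (PowerSeries.coeff 1) := by
  ext i j
  simp only [Matrix.map_apply, Matrix.mul_apply, Matrix.add_apply, map_sum, coeff_one_mul',
    Finset.sum_add_distrib]

theorem map_coeff_zero_mul {n : Type*} [Fintype n] (M N : Matrix n n (PowerSeries R)) :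
    (M * N).map (PowerSeries.coeff 0)
      = M.map (PowerSeries.coeff 0) * N.map (PowerSeries.coeff 0) := by
  ext i j
  simp [Matrix.mul_apply]

theorem map_coeff_zero_add_smul {n : Type*} (g F : Matrix n n R) :
    (g.map PowerSeries.C + (X : PowerSeries R) • F.map PowerSeries.C).map (PowerSeries.coeff 0)
      = g := by
  ext i j
  simp

theorem map_coeff_one_add_smul {n : Type*} (g F : Matrix n n R) :
    (g.map PowerSeries.C + (X : PowerSeries R) • F.map PowerSeries.C).map (PowerSeries.coeff 1)
      = F := by
  ext i j
  simp only [Matrix.map_apply, Matrix.add_apply, Matrix.smul_apply, smul_eq_mul, map_add]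
  rw [PowerSeries.coeff_C, if_neg one_ne_zero, zero_add]
  exact (PowerSeries.coeff_succ_X_mul 0 _).trans (by simp)

theorem coeff_zero_det_add_smul {n : Type*} [Fintype n] [DecidableEq n] (g F : Matrix n n R) :
    PowerSeries.coeff 0 (g.map PowerSeries.C + (X : PowerSeries R) • F.map PowerSeries.C).det
      = g.det := by
  rw [PowerSeries.coeff_zero_eq_constantCoeff_apply, RingHom.map_det]
  congr 1
  ext i j
  simp

theorem coeff_one_trace_inv_mul {n : Type*} [Fintype n] [DecidableEq n] (g G F K : Matrix n n R)
    (hg : IsUnit g.det) :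
    PowerSeries.coeff 1 ((g.map PowerSeries.C + (X : PowerSeries R) • G.map PowerSeries.C)⁻¹ *
        (F.map PowerSeries.C + (X : PowerSeries R) • K.map PowerSeries.C)).trace
      = (g⁻¹ * K).trace - (g⁻¹ * G * (g⁻¹ * F)).trace
    ∧ PowerSeries.coeff 0 ((g.map PowerSeries.C + (X : PowerSeries R) • G.map PowerSeries.C)⁻¹ *
        (F.map PowerSeries.C + (X : PowerSeries R) • K.map PowerSeries.C)).trace
      = (g⁻¹ * F).trace := by
  set M := g.map PowerSeries.C + (X : PowerSeries R) • G.map PowerSeries.C with hM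
  set N := F.map PowerSeries.C + (X : PowerSeries R) • K.map PowerSeries.C with hN
  have hM0 : M.map (PowerSeries.coeff 0) = g := map_coeff_zero_add_smul g G
  have hM1 : M.map (PowerSeries.coeff 1) = G := map_coeff_one_add_smul g G
  have hN0 : N.map (PowerSeries.coeff 0) = F := map_coeff_zero_add_smul F K
  have hN1 : N.map (PowerSeries.coeff 1) = K := map_coeff_one_add_smul F K
  have hdet : IsUnit M.det := by
    rw [PowerSeries.isUnit_iff_constantCoeff, ← PowerSeries.coeff_zero_eq_constantCoeff_apply,
      coeff_zero_det_add_smul]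
    exact hg
  have hinv : M⁻¹ * M = 1 := Matrix.nonsing_inv_mul M hdet
  have h0 : (M⁻¹).map (PowerSeries.coeff 0) = g⁻¹ := by
    have := congrArg (fun Q => Q.map (PowerSeries.coeff 0)) hinv
    simp only [map_coeff_zero_mul, hM0] at this
    rw [show (1 : Matrix n n (PowerSeries R)).map (PowerSeries.coeff 0) = 1 by
      ext i j; by_cases hij : i = j <;> simp [Matrix.one_apply, hij]] at this
    exact (Matrix.inv_eq_left_inv this).symm
  -- The derivative of an inverse matrix, obtained from the coefficient of `X` in `M⁻¹ * M = 1`.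
  have h1 : (M⁻¹).map (PowerSeries.coeff 1) = -(g⁻¹ * G * g⁻¹) := by
    have := congrArg (fun Q => Q.map (PowerSeries.coeff 1)) hinv
    simp only [map_coeff_one_mul, hM0, hM1, h0] at this
    rw [show (1 : Matrix n n (PowerSeries R)).map (PowerSeries.coeff 1) = 0 by
      ext i j; by_cases hij : i = j <;> simp [hij, PowerSeries.coeff_one]] at this
    have h2 := eq_neg_of_add_eq_zero_left this
    have h3 := congrArg (fun Q => Q * g⁻¹) h2
    simp only [Matrix.mul_nonsing_inv_cancel_right _ _ hg, Matrix.neg_mul] at h3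
    exact h3
  have htr : ∀ (k : ℕ) (Q : Matrix n n (PowerSeries R)),
      PowerSeries.coeff k Q.trace = (Q.map (PowerSeries.coeff k)).trace := by
    intro k Q
    simp [Matrix.trace]
  constructor
  · rw [htr, map_coeff_one_mul, h0, h1, hN0, hN1, Matrix.trace_add, Matrix.neg_mul,
      Matrix.trace_neg, Matrix.mul_assoc (g⁻¹ * G)]
    ring
  · rw [htr, map_coeff_zero_mul, h0, hN0]

/-- The one-statistic formula for `f`, applied over `R⟦X⟧` to the functional twisted by `1 + X f'`
and read at first order: the product rule differentiates both the determinant and the trace. -/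
theorem IsProductFunctional.alternant_sq_mul_sum_mul_sum {ι : Fin m → A →+* B} {L : A →+ R}
    {Λ : B →+ R} (h : IsProductFunctional ι L Λ) (P : Fin m → A)
    (hg : IsUnit (gram L P 1).det) (f f' : A) :
    Λ (alternant ι P ^ 2 * ((∑ i, ι i f) * ∑ i, ι i f'))
      = m.factorial * ((gram L P 1).det *
        (((gram L P 1)⁻¹ * gram L P f).trace * ((gram L P 1)⁻¹ * gram L P f').trace
          + ((gram L P 1)⁻¹ * gram L P (f * f')).trace
          - ((gram L P 1)⁻¹ * gram L P f' * ((gram L P 1)⁻¹ * gram L P f)).trace)) := by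
  have htw := h.powerSeries.twist (1 + X * PowerSeries.C f')
  have key := htw.alternant_sq_mul_sum (fun j => PowerSeries.C (P j)) ?_ (PowerSeries.C f)
  · rw [gram_twist, alternant_C, gram_twist_one] at key
    have k1 := congrArg (PowerSeries.coeff 1) key
    rw [show ((m.factorial : ℕ) : PowerSeries R) = PowerSeries.C ((m.factorial : ℕ) : R) by simp,
      PowerSeries.coeff_C_mul, coeff_one_mul', coeff_one_det_add_smul _ _ hg,
      coeff_zero_det_add_smul, (coeff_one_trace_inv_mul _ _ _ _ hg).1,
      (coeff_one_trace_inv_mul _ _ _ _ hg).2] at k1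
    have k2 : Λ (alternant ι P ^ 2 * ((∑ i, ι i f) * ∑ i, ι i f'))
        = PowerSeries.coeff 1 (((mapCoeff Λ).comp (AddMonoidHom.mulLeft
          (∏ i, PowerSeries.map (ι i) (1 + X * PowerSeries.C f'))))
            (PowerSeries.C (alternant ι P) ^ 2 * ∑ i, PowerSeries.map (ι i) (PowerSeries.C f))) := by
      simp only [AddMonoidHom.coe_comp, Function.comp_apply, AddMonoidHom.coe_mulLeft,
        coeff_mapCoeff]
      rw [← map_pow, mul_comm (∏ i, _), mul_assoc, PowerSeries.coeff_C_mul]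
      congr 2
      simp only [PowerSeries.map_C]
      rw [← map_sum, PowerSeries.coeff_C_mul, ← coeff_one_prod_one_add _ (fun i => ι i f')]
      simp
    rw [k2, k1]
    ring
  · rw [gram_twist_one, PowerSeries.isUnit_iff_constantCoeff,
      ← PowerSeries.coeff_zero_eq_constantCoeff_apply, coeff_zero_det_add_smul]
    exact hg

end ProductFunctional

/-! ### Orthogonal polynomials over a commutative ring and Christoffel-Darboux -/

section OrthogonalPolynomials

open Polynomial

variable {R A : Type*} [CommRing R] [CommRing A] [Algebra R A]

/-- Monic polynomials `p n` of degree `n`, orthogonal for the functional `L`, with invertible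
squared norms. -/
structure IsOrthogonalFamily (L : A →ₗ[R] R) (x : A) (p : ℕ → R[X]) : Prop where
  monic : ∀ n, (p n).Monic
  natDegree : ∀ n, (p n).natDegree = n
  orthogonal : ∀ i j, i ≠ j → L (aeval x (p i) * aeval x (p j)) = 0
  isUnit : ∀ n, IsUnit (L (aeval x (p n) * aeval x (p n)))

/-- The Gram-Schmidt process applied to the powers of `x`. -/
def orthoPoly (L : A →ₗ[R] R) (x : A) (n : ℕ) : R[X] :=
  X ^ n - ∑ j : Fin n, C (L (x ^ n * aeval x (orthoPoly L x j)) *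
    Ring.inverse (L (aeval x (orthoPoly L x j) * aeval x (orthoPoly L x j)))) * orthoPoly L x j
termination_by n
decreasing_by all_goals exact j.2

theorem orthoPoly_monic_natDegree [Nontrivial R] (L : A →ₗ[R] R) (x : A) (n : ℕ) :
    (orthoPoly L x n).Monic ∧ (orthoPoly L x n).natDegree = n := by
  induction n using Nat.strong_induction_on with
  | _ n ih =>
    have hdeg : (∑ j : Fin n, C (L (x ^ n * aeval x (orthoPoly L x j)) *
        Ring.inverse (L (aeval x (orthoPoly L x j) * aeval x (orthoPoly L x j)))) *
        orthoPoly L x j).degree < n := by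
      rw [← mem_degreeLT]
      refine Submodule.sum_mem _ fun j _ => mem_degreeLT.2 ?_
      refine lt_of_le_of_lt (degree_le_natDegree.trans (Nat.cast_le.2 (natDegree_C_mul_le _ _))) ?_
      rw [(ih j j.2).2]
      exact_mod_cast j.2
    rw [orthoPoly]
    have hd : (X ^ n - ∑ j : Fin n, C (L (x ^ n * aeval x (orthoPoly L x j)) *
        Ring.inverse (L (aeval x (orthoPoly L x j) * aeval x (orthoPoly L x j)))) *
        orthoPoly L x j : R[X]).degree = n := by
      rw [degree_sub_eq_left_of_degree_lt (by rwa [degree_X_pow]), degree_X_pow]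
    refine ⟨?_, natDegree_eq_of_degree_eq_some hd⟩
    rw [Monic, leadingCoeff_sub_of_degree_lt (by rwa [degree_X_pow]), leadingCoeff_X_pow]

/-- Gram-Schmidt divides only by the squared norms of monic polynomials, so invertibility of these
replaces positivity of an inner product. -/
theorem isOrthogonalFamily_orthoPoly [Nontrivial R] (L : A →ₗ[R] R) (x : A)
    (hL : ∀ q : R[X], q.Monic → IsUnit (L (aeval x q * aeval x q))) :
    IsOrthogonalFamily L x (orthoPoly L x) := by
  have hunit : ∀ n, IsUnit (L (aeval x (orthoPoly L x n) * aeval x (orthoPoly L x n))) :=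
    fun n => hL _ (orthoPoly_monic_natDegree L x n).1
  have hlt : ∀ n i, i < n → L (aeval x (orthoPoly L x n) * aeval x (orthoPoly L x i)) = 0 := by
    intro n
    induction n using Nat.strong_induction_on with
    | _ n ih =>
      intro i hi
      conv_lhs => rw [orthoPoly]
      simp only [map_sub, map_sum, map_mul, aeval_C, map_pow, aeval_X, sub_mul, Finset.sum_mul]
      rw [Finset.sum_eq_single (⟨i, hi⟩ : Fin n)]
      · rw [← map_mul, ← Algebra.smul_def, smul_mul_assoc, map_smul, smul_eq_mul, mul_assoc,
          Ring.inverse_mul_cancel _ (hunit i), mul_one, sub_self]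
      · intro j _ hj
        rw [← map_mul, ← Algebra.smul_def, smul_mul_assoc, map_smul]
        have hji : (j : ℕ) ≠ i := fun h => hj (Fin.ext h)
        rcases hji.lt_or_gt with h | h
        · rw [mul_comm (aeval x (orthoPoly L x j)) (aeval x (orthoPoly L x i)), ih i hi j h, smul_zero]
        · rw [ih j j.2 i h, smul_zero]
      · simp
  refine ⟨fun n => (orthoPoly_monic_natDegree L x n).1,
    fun n => (orthoPoly_monic_natDegree L x n).2, ?_, hunit⟩
  intro i j hij
  rcases hij.lt_or_gt with h | h
  · rw [mul_comm, hlt j i h]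
  · exact hlt i j h

namespace IsOrthogonalFamily

variable {L : A →ₗ[R] R} {x : A} {p : ℕ → R[X]}

theorem exists_coeffs [Nontrivial R] (hp : IsOrthogonalFamily L x p) (n : ℕ) (q : R[X])
    (hq : q.degree < n) : ∃ c : ℕ → R, q = ∑ i ∈ Finset.range n, C (c i) * p i := by
  induction n generalizing q with
  | zero => exact ⟨0, by simpa [Nat.WithBot.lt_zero_iff] using hq⟩
  | succ n ih =>
    have hpd : (p n).degree = n := by rw [degree_eq_natDegree (hp.monic n).ne_zero, hp.natDegree]
    obtain ⟨c, hc⟩ := ih (q - C (q.coeff n) * p n) (by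
      rw [degree_lt_iff_coeff_zero]
      intro k hk
      rw [coeff_sub, coeff_C_mul]
      rcases hk.lt_or_eq with h | rfl
      · have h1 : q.coeff k = 0 := coeff_eq_zero_of_degree_lt (hq.trans_le (by exact_mod_cast h))
        have h2 : (p n).coeff k = 0 :=
          coeff_eq_zero_of_degree_lt (by rw [hpd]; exact_mod_cast h)
        rw [h1, h2, mul_zero, sub_zero]
      · have : (p n).coeff n = 1 := by
          have := hp.monic n
          rwa [Monic, leadingCoeff, hp.natDegree] at this
        rw [this, mul_one, sub_self])
    refine ⟨Function.update c n (q.coeff n), ?_⟩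
    rw [Finset.sum_range_succ, Function.update_self, ← sub_eq_iff_eq_add, hc]
    refine Finset.sum_congr rfl fun i hi => ?_
    rw [Function.update_of_ne (Finset.mem_range.1 hi).ne]

theorem aeval_sum (c : ℕ → R) (n : ℕ) :
    aeval x (∑ i ∈ Finset.range n, C (c i) * p i)
      = ∑ i ∈ Finset.range n, c i • aeval x (p i) := by
  simp [map_sum, Algebra.smul_def]

theorem apply_mul_eq_zero [Nontrivial R] (hp : IsOrthogonalFamily L x p) {n : ℕ} {q : R[X]}
    (hq : q.degree < n) : L (aeval x q * aeval x (p n)) = 0 := by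
  obtain ⟨c, hc⟩ := hp.exists_coeffs n q hq
  rw [hc, aeval_sum, Finset.sum_mul, map_sum]
  refine Finset.sum_eq_zero fun i hi => ?_
  rw [smul_mul_assoc, map_smul, hp.orthogonal i n (Finset.mem_range.1 hi).ne, smul_zero]

theorem degree_X_mul_sub [Nontrivial R] (hp : IsOrthogonalFamily L x p) (n : ℕ) :
    (X * p n - p (n + 1)).degree < ((n + 1 : ℕ) : WithBot ℕ) := by
  rw [degree_lt_iff_coeff_zero]
  intro k hk
  obtain ⟨j, rfl⟩ : ∃ j, k = j + 1 := ⟨k - 1, by omega⟩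
  rw [coeff_sub, coeff_X_mul]
  have hlead : ∀ i, (p i).coeff i = 1 := fun i => by
    have := hp.monic i
    rwa [Monic, leadingCoeff, hp.natDegree] at this
  rcases (Nat.le_of_succ_le_succ hk).lt_or_eq with h | rfl
  · rw [coeff_eq_zero_of_natDegree_lt (by rw [hp.natDegree]; omega),
      coeff_eq_zero_of_natDegree_lt (by rw [hp.natDegree]; omega), sub_zero]
  · rw [hlead, hlead, sub_self]

theorem apply_mul_succ [Nontrivial R] (hp : IsOrthogonalFamily L x p) (n : ℕ) :
    L (x * aeval x (p n) * aeval x (p (n + 1)))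
      = L (aeval x (p (n + 1)) * aeval x (p (n + 1))) := by
  have h := hp.apply_mul_eq_zero (hp.degree_X_mul_sub n)
  rw [map_sub (aeval (R := R) x), map_mul (aeval (R := R) x), aeval_X, sub_mul, map_sub, sub_eq_zero] at h
  exact h

theorem apply_mul_of_lt [Nontrivial R] (hp : IsOrthogonalFamily L x p) {i n : ℕ} (h : i + 1 < n) :
    L (x * aeval x (p i) * aeval x (p n)) = 0 := by
  have := hp.apply_mul_eq_zero (n := n) (q := X * p i) (by
    refine lt_of_le_of_lt degree_le_natDegree ?_
    rw [natDegree_X_mul (hp.monic i).ne_zero, hp.natDegree]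
    exact_mod_cast h)
  simpa using this

/-- Three-term recurrence: multiplication by `x` is symmetric for the pairing, so `x p_n` has no
component on `p_i` for `i + 1 < n`, and its component on `p_{n-1}` is `h_n / h_{n-1}`. -/
theorem mul_aeval_succ [Nontrivial R] (hp : IsOrthogonalFamily L x p) :
    ∃ a : ℕ → R, x * aeval x (p 0) = aeval x (p 1) + a 0 • aeval x (p 0) ∧
      ∀ n, x * aeval x (p (n + 1)) = aeval x (p (n + 2)) + a (n + 1) • aeval x (p (n + 1))
        + (L (aeval x (p (n + 1)) * aeval x (p (n + 1))) *
            Ring.inverse (L (aeval x (p n) * aeval x (p n)))) • aeval x (p n) := by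
  choose c hc using fun n => hp.exists_coeffs (n + 1) (X * p n - p (n + 1)) (hp.degree_X_mul_sub n)
  have hx : ∀ n, x * aeval x (p n)
      = aeval x (p (n + 1)) + ∑ i ∈ Finset.range (n + 1), c n i • aeval x (p i) := by
    intro n
    have := congrArg (aeval x) (hc n)
    rw [aeval_sum, map_sub, map_mul, aeval_X] at this
    rw [← this]; ring
  have hcoef : ∀ n i, i < n + 1 → L (x * aeval x (p n) * aeval x (p i))
      = c n i * L (aeval x (p i) * aeval x (p i)) := by
    intro n i hi
    rw [hx, add_mul, map_add, hp.orthogonal _ _ hi.ne', zero_add, Finset.sum_mul, map_sum,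
      Finset.sum_eq_single i]
    · rw [smul_mul_assoc, map_smul, smul_eq_mul]
    · intro j _ hj
      rw [smul_mul_assoc, map_smul, hp.orthogonal j i hj, smul_zero]
    · intro h
      exact (h (Finset.mem_range.2 hi)).elim
  have hcz : ∀ n i, i + 1 < n → c n i = 0 := by
    intro n i hi
    have h1 := hcoef n i (by omega)
    rw [mul_right_comm, hp.apply_mul_of_lt hi] at h1
    exact ((hp.isUnit i).mul_left_eq_zero).1 h1.symm
  have hcs : ∀ n, c (n + 1) n = L (aeval x (p (n + 1)) * aeval x (p (n + 1))) *
            Ring.inverse (L (aeval x (p n) * aeval x (p n))) := by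
    intro n
    have h1 := hcoef (n + 1) n (by omega)
    rw [mul_right_comm, hp.apply_mul_succ] at h1
    rw [h1, mul_assoc, Ring.mul_inverse_cancel _ (hp.isUnit n), mul_one]
  refine ⟨fun n => c n n, ?_, fun n => ?_⟩
  · rw [hx 0]; simp
  · rw [hx (n + 1), Finset.sum_range_succ, Finset.sum_range_succ, hcs, Finset.sum_eq_zero]
    · ring
    · intro i hi
      rw [hcz _ _ (by simpa using hi), zero_smul]

end IsOrthogonalFamily

/-- The Christoffel-Darboux formula, for two sequences satisfying the same three-term
recurrence. -/
theorem christoffel_darboux {S : Type*} [CommRing S] [Algebra R S] (u v : S) (p q : ℕ → S)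
    (a h hi : ℕ → R) (hh : ∀ n, h n * hi n = 1)
    (hp0 : u * p 0 = p 1 + a 0 • p 0) (hq0 : v * q 0 = q 1 + a 0 • q 0)
    (hp : ∀ n, u * p (n + 1) = p (n + 2) + a (n + 1) • p (n + 1) + (h (n + 1) * hi n) • p n)
    (hq : ∀ n, v * q (n + 1) = q (n + 2) + a (n + 1) • q (n + 1) + (h (n + 1) * hi n) • q n)
    (n : ℕ) :
    (u - v) * ∑ j ∈ Finset.range (n + 1), hi j • (p j * q j)
      = hi n • (p (n + 1) * q n - p n * q (n + 1)) := by
  simp only [Algebra.smul_def, map_mul] at *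
  induction n with
  | zero =>
    simp only [zero_add, Finset.sum_range_one]
    linear_combination algebraMap R S (hi 0) * (q 0 * hp0 - p 0 * hq0)
  | succ n ih =>
    rw [Finset.sum_range_succ, mul_add, ih]
    have h1 : algebraMap R S (h (n + 1)) * algebraMap R S (hi (n + 1)) = 1 := by
      rw [← map_mul, hh, map_one]
    linear_combination algebraMap R S (hi (n + 1)) * (q (n + 1) * hp n - p (n + 1) * hq n)
      + algebraMap R S (hi n) * (p n * q (n + 1) - p (n + 1) * q n) * h1

open TensorProduct in
-- `A ⊗ A` plays the role of functions of two variables, and `Φ` that of the double integral against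
-- `f(x) g(y)`.
theorem exists_tensor_functional (L : A →ₗ[R] R) (f g : A) :
    ∃ Φ : A ⊗[R] A →ₗ[R] R, ∀ a b, Φ (a ⊗ₜ[R] b) = L (f * a) * L (g * b) :=
  ⟨LinearMap.mul' R R ∘ₗ TensorProduct.map (L ∘ₗ LinearMap.mulLeft R f)
    (L ∘ₗ LinearMap.mulLeft R g), fun a b => by simp⟩

namespace IsOrthogonalFamily

variable {L : A →ₗ[R] R} {x : A} {p : ℕ → R[X]}

open TensorProduct in
theorem christoffel_darboux_tensor [Nontrivial R] (hp : IsOrthogonalFamily L x p) (n : ℕ) :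
    (x ⊗ₜ[R] (1 : A) - (1 : A) ⊗ₜ[R] x) * ∑ j ∈ Finset.range (n + 1),
        Ring.inverse (L (aeval x (p j) * aeval x (p j))) • (aeval x (p j) ⊗ₜ[R] aeval x (p j))
      = Ring.inverse (L (aeval x (p n) * aeval x (p n))) •
        (aeval x (p (n + 1)) ⊗ₜ[R] aeval x (p n) - aeval x (p n) ⊗ₜ[R] aeval x (p (n + 1))) := by
  obtain ⟨a, h0, h1⟩ := hp.mul_aeval_succ
  have := christoffel_darboux (R := R) (x ⊗ₜ[R] (1 : A)) ((1 : A) ⊗ₜ[R] x)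
    (fun j => aeval x (p j) ⊗ₜ[R] (1 : A)) (fun j => (1 : A) ⊗ₜ[R] aeval x (p j)) a
    (fun j => L (aeval x (p j) * aeval x (p j)))
    (fun j => Ring.inverse (L (aeval x (p j) * aeval x (p j))))
    (fun j => Ring.mul_inverse_cancel _ (hp.isUnit j))
    (by rw [Algebra.TensorProduct.tmul_mul_tmul, h0, mul_one, TensorProduct.add_tmul,
          TensorProduct.smul_tmul'])
    (by rw [Algebra.TensorProduct.tmul_mul_tmul, h0, mul_one, TensorProduct.tmul_add,
          TensorProduct.tmul_smul])
    (fun j => by rw [Algebra.TensorProduct.tmul_mul_tmul, h1, mul_one, TensorProduct.add_tmul,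
          TensorProduct.add_tmul, TensorProduct.smul_tmul', TensorProduct.smul_tmul'])
    (fun j => by rw [Algebra.TensorProduct.tmul_mul_tmul, h1, mul_one, TensorProduct.tmul_add,
          TensorProduct.tmul_add, TensorProduct.tmul_smul, TensorProduct.tmul_smul]) n
  simpa only [Algebra.TensorProduct.tmul_mul_tmul, mul_one, one_mul] using this

/-- The bilinear functional with kernel `(x - y)^2 K(x, y)^2`. -/
theorem sum_sub_sq_kernel_sq [Nontrivial R] (hp : IsOrthogonalFamily L x p) (n : ℕ) (f g : A) :
    ∑ i ∈ Finset.range (n + 1), ∑ j ∈ Finset.range (n + 1),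
      Ring.inverse (L (aeval x (p i) * aeval x (p i))) *
      Ring.inverse (L (aeval x (p j) * aeval x (p j))) *
        (L (aeval x (p i) * aeval x (p j) * (f * x ^ 2)) * L (aeval x (p i) * aeval x (p j) * g)
          - 2 * (L (aeval x (p i) * aeval x (p j) * (f * x)) *
            L (aeval x (p i) * aeval x (p j) * (g * x)))
          + L (aeval x (p i) * aeval x (p j) * f) *
            L (aeval x (p i) * aeval x (p j) * (g * x ^ 2)))
      = Ring.inverse (L (aeval x (p n) * aeval x (p n))) ^ 2 *
        (L (aeval x (p (n + 1)) ^ 2 * f) * L (aeval x (p n) ^ 2 * g)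
          - 2 * (L (aeval x (p (n + 1)) * aeval x (p n) * f) *
            L (aeval x (p (n + 1)) * aeval x (p n) * g))
          + L (aeval x (p n) ^ 2 * f) * L (aeval x (p (n + 1)) ^ 2 * g)) := by
  obtain ⟨Φ, hΦ⟩ := exists_tensor_functional L f g
  have h := hp.christoffel_darboux_tensor n
  set P : ℕ → A := fun j => aeval x (p j) with hP
  set k : ℕ → R := fun j => Ring.inverse (L (P j * P j)) with hk
  change _ * ∑ j ∈ Finset.range (n + 1), k j • (P j ⊗ₜ[R] P j)
    = k n • (P (n + 1) ⊗ₜ[R] P n - P n ⊗ₜ[R] P (n + 1)) at h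
  change ∑ i ∈ Finset.range (n + 1), ∑ j ∈ Finset.range (n + 1), k i * k j *
      (L (P i * P j * (f * x ^ 2)) * L (P i * P j * g)
        - 2 * (L (P i * P j * (f * x)) * L (P i * P j * (g * x)))
        + L (P i * P j * f) * L (P i * P j * (g * x ^ 2)))
      = k n ^ 2 * (L (P (n + 1) ^ 2 * f) * L (P n ^ 2 * g)
        - 2 * (L (P (n + 1) * P n * f) * L (P (n + 1) * P n * g))
        + L (P n ^ 2 * f) * L (P (n + 1) ^ 2 * g))
  -- The Christoffel-Darboux identity is squared and then integrated against `f(x) g(y)`.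
  have h2 := congrArg (fun z => Φ (z * z)) h
  have hsq : (x ⊗ₜ[R] (1 : A) - (1 : A) ⊗ₜ[R] x) * (x ⊗ₜ[R] (1 : A) - (1 : A) ⊗ₜ[R] x)
      = (x ^ 2) ⊗ₜ[R] (1 : A) - (2 : R) • (x ⊗ₜ[R] x) + (1 : A) ⊗ₜ[R] (x ^ 2) := by
    rw [sub_mul, mul_sub, mul_sub]
    simp only [Algebra.TensorProduct.tmul_mul_tmul, mul_one, one_mul, pow_two, two_smul]
    ring
  rw [mul_mul_mul_comm, hsq, Finset.sum_mul_sum, Finset.mul_sum, map_sum] at h2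
  simp only [Finset.mul_sum, map_sum, mul_smul_comm, map_smul, smul_eq_mul,
    sub_mul, add_mul, mul_sub, Algebra.TensorProduct.tmul_mul_tmul, smul_mul_assoc, map_sub,
    map_add, hΦ] at h2
  calc _ = _ := ?_
    _ = _ := h2
    _ = _ := ?_
  · refine Finset.sum_congr rfl fun i _ => Finset.sum_congr rfl fun j _ => ?_
    rw [show f * (x ^ 2 * (P i * P j)) = P i * P j * (f * x ^ 2) by ring,
      show g * (1 * (P i * P j)) = P i * P j * g by ring,
      show f * (x * (P i * P j)) = P i * P j * (f * x) by ring,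
      show g * (x * (P i * P j)) = P i * P j * (g * x) by ring,
      show f * (1 * (P i * P j)) = P i * P j * f by ring,
      show g * (x ^ 2 * (P i * P j)) = P i * P j * (g * x ^ 2) by ring]
    ring
  · rw [show f * (P (n + 1) * P (n + 1)) = P (n + 1) ^ 2 * f by ring,
      show g * (P n * P n) = P n ^ 2 * g by ring,
      show f * (P (n + 1) * P n) = P (n + 1) * P n * f by ring,
      show g * (P n * P (n + 1)) = P (n + 1) * P n * g by ring,
      show f * (P n * P (n + 1)) = P (n + 1) * P n * f by ring,
      show g * (P (n + 1) * P n) = P (n + 1) * P n * g by ring,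
      show f * (P n * P n) = P n ^ 2 * f by ring,
      show g * (P (n + 1) * P (n + 1)) = P (n + 1) ^ 2 * g by ring]
    ring

/-- The bilinear functional with kernel `(x - y) K(x, y)^2`. -/
theorem sum_sub_kernel_sq [Nontrivial R] (hp : IsOrthogonalFamily L x p) (n : ℕ) (f : A) :
    ∑ i ∈ Finset.range (n + 1),
        Ring.inverse (L (aeval x (p i) * aeval x (p i))) *
          L (aeval x (p i) * aeval x (p i) * (f * x))
      - ∑ i ∈ Finset.range (n + 1), ∑ j ∈ Finset.range (n + 1),
      Ring.inverse (L (aeval x (p i) * aeval x (p i))) *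
      Ring.inverse (L (aeval x (p j) * aeval x (p j))) *
        (L (aeval x (p i) * aeval x (p j) * f) * L (aeval x (p i) * aeval x (p j) * x))
      = Ring.inverse (L (aeval x (p n) * aeval x (p n))) *
        L (aeval x (p (n + 1)) * aeval x (p n) * f) := by
  obtain ⟨Φ, hΦ⟩ := exists_tensor_functional L f 1
  have h := hp.christoffel_darboux_tensor n
  have horth := hp.orthogonal
  have hunit := hp.isUnit
  set P : ℕ → A := fun j => aeval x (p j) with hP
  set k : ℕ → R := fun j => Ring.inverse (L (P j * P j)) with hk
  change _ * ∑ j ∈ Finset.range (n + 1), k j • (P j ⊗ₜ[R] P j)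
    = k n • (P (n + 1) ⊗ₜ[R] P n - P n ⊗ₜ[R] P (n + 1)) at h
  change ∀ i j, i ≠ j → L (P i * P j) = 0 at horth
  have hkk : ∀ j, k j * L (P j * P j) = 1 := fun j => Ring.inverse_mul_cancel _ (hunit j)
  change ∑ i ∈ Finset.range (n + 1), k i * L (P i * P i * (f * x))
      - ∑ i ∈ Finset.range (n + 1), ∑ j ∈ Finset.range (n + 1), k i * k j *
      (L (P i * P j * f) * L (P i * P j * x))
      = k n * L (P (n + 1) * P n * f)
  -- Here Christoffel-Darboux is multiplied by one more copy of the kernel and integrated against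
  -- `f(x)`. Integration in `y` makes the kernel reproducing: `x K²` collapses to the diagonal, and
  -- on the right only `j = n` survives, since `p_{n+1}` is orthogonal to the whole kernel.
  have h2 := congrArg (fun z => Φ (z * ∑ j ∈ Finset.range (n + 1), k j • (P j ⊗ₜ[R] P j))) h
  rw [mul_assoc, Finset.sum_mul_sum] at h2
  simp only [Finset.mul_sum, map_sum, mul_smul_comm, map_smul, smul_eq_mul,
    sub_mul, Algebra.TensorProduct.tmul_mul_tmul, smul_mul_assoc, map_sub, hΦ] at h2
  calc _ = _ := ?_
    _ = _ := h2
    _ = _ := ?_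
  · simp only [mul_sub, Finset.sum_sub_distrib]
    congr 1
    · refine Finset.sum_congr rfl fun i hi => ?_
      rw [Finset.sum_eq_single i]
      · rw [show f * (x * (P i * P i)) = P i * P i * (f * x) by ring, one_mul, one_mul]
        linear_combination (-(k i * L (P i * P i * (f * x)))) * hkk i
      · intro j _ hj
        rw [one_mul, one_mul, horth i j hj.symm, mul_zero, mul_zero, mul_zero]
      · exact fun hni => (hni hi).elim
    · refine Finset.sum_congr rfl fun i _ => Finset.sum_congr rfl fun j _ => ?_
      rw [show f * (1 * (P i * P j)) = P i * P j * f by ring,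
        show 1 * (x * (P i * P j)) = P i * P j * x by ring]
      ring
  · rw [Finset.sum_eq_single n]
    · rw [one_mul, one_mul, horth (n + 1) n (by omega),
        show f * (P (n + 1) * P n) = P (n + 1) * P n * f by ring]
      linear_combination (k n * L (P (n + 1) * P n * f)) * hkk n
    · intro j hj hjn
      have : j ≠ n + 1 := by have := Finset.mem_range.1 hj; omega
      rw [one_mul, one_mul, horth n j hjn.symm, horth (n + 1) j this.symm]
      ring
    · intro hn
      exact (hn (by simp)).elim

end IsOrthogonalFamily

end OrthogonalPolynomials

/-! ### Means and covariances of linear statistics; decoupling and loop equation -/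

section MeanCovariance

open Polynomial

variable {R A : Type*} [CommRing R] [CommRing A] [Algebra R A]

/-- The mean of the linear statistic of `f` for the determinantal ensemble with `m` points. -/
def opMean (L : A →ₗ[R] R) (P : ℕ → A) (m : ℕ) (f : A) : R :=
  ∑ i ∈ Finset.range m, Ring.inverse (L (P i * P i)) * L (P i * P i * f)

/-- The covariance of the linear statistics of `f` and `g` for the determinantal ensemble with `m`
points. -/
def opCov (L : A →ₗ[R] R) (P : ℕ → A) (m : ℕ) (f g : A) : R :=
  ∑ i ∈ Finset.range m, Ring.inverse (L (P i * P i)) * L (P i * P i * (f * g))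
    - ∑ i ∈ Finset.range m, ∑ j ∈ Finset.range m,
      Ring.inverse (L (P i * P i)) * Ring.inverse (L (P j * P j)) *
        (L (P i * P j * f) * L (P i * P j * g))

theorem opMean_succ_sub (L : A →ₗ[R] R) (P : ℕ → A) (m : ℕ) (f : A) :
    opMean L P (m + 1) f - opMean L P m f = Ring.inverse (L (P m * P m)) * L (P m * P m * f) := by
  rw [opMean, opMean, Finset.sum_range_succ]
  ring

theorem opMean_add (L : A →ₗ[R] R) (P : ℕ → A) (m : ℕ) (f g : A) :
    opMean L P m (f + g) = opMean L P m f + opMean L P m g := by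
  simp only [opMean, mul_add, map_add, Finset.sum_add_distrib]

theorem opMean_smul (L : A →ₗ[R] R) (P : ℕ → A) (m : ℕ) (c : R) (f : A) :
    opMean L P m (c • f) = c * opMean L P m f := by
  simp only [opMean, mul_smul_comm, map_smul, smul_eq_mul, Finset.mul_sum]
  exact Finset.sum_congr rfl fun i _ => by ring

theorem opCov_add_right (L : A →ₗ[R] R) (P : ℕ → A) (m : ℕ) (f g g' : A) :
    opCov L P m f (g + g') = opCov L P m f g + opCov L P m f g' := by
  simp only [opCov, mul_add, map_add, Finset.sum_add_distrib]
  ring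

theorem opCov_smul_right (L : A →ₗ[R] R) (P : ℕ → A) (m : ℕ) (c : R) (f g : A) :
    opCov L P m f (c • g) = c * opCov L P m f g := by
  simp only [opCov, mul_smul_comm, map_smul, smul_eq_mul, mul_sub, Finset.mul_sum]
  congr 1
  · exact Finset.sum_congr rfl fun i _ => by ring
  · exact Finset.sum_congr rfl fun i _ => Finset.sum_congr rfl fun j _ => by ring

namespace IsOrthogonalFamily

variable {L : A →ₗ[R] R} {x : A} {p : ℕ → R[X]}

theorem aeval_eq_sum [Nontrivial R] (hp : IsOrthogonalFamily L x p) {m : ℕ} {q : R[X]}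
    (hq : q.degree < m) :
    aeval x q = ∑ j ∈ Finset.range m, (Ring.inverse (L (aeval x (p j) * aeval x (p j))) *
      L (aeval x (p j) * aeval x q)) • aeval x (p j) := by
  obtain ⟨c, hc⟩ := hp.exists_coeffs m q hq
  rw [hc, aeval_sum]
  refine Finset.sum_congr rfl fun j hj => ?_
  congr 1
  rw [Finset.mul_sum, map_sum, Finset.sum_eq_single j]
  · rw [mul_smul_comm, map_smul, smul_eq_mul]
    linear_combination (-c j) * Ring.inverse_mul_cancel _ (hp.isUnit j)
  · intro i _ hij
    rw [mul_smul_comm, map_smul, hp.orthogonal j i hij.symm, smul_zero]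
  · exact fun h => (h hj).elim

/-- The statistic of `1` is the number of points, which is constant. Algebraically, the kernel
reproduces itself. -/
theorem opCov_one_right [Nontrivial R] (hp : IsOrthogonalFamily L x p) (m : ℕ) (f : A) :
    opCov L (fun j => aeval x (p j)) m f 1 = 0 := by
  simp only [opCov, mul_one]
  rw [sub_eq_zero]
  refine Finset.sum_congr rfl fun i hi => ?_
  rw [Finset.sum_eq_single i]
  · linear_combination (-Ring.inverse (L (aeval x (p i) * aeval x (p i))) *
      L (aeval x (p i) * aeval x (p i) * f)) * Ring.inverse_mul_cancel _ (hp.isUnit i)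
  · intro j _ hj
    rw [hp.orthogonal i j hj.symm, mul_zero, mul_zero]
  · exact fun h => (h hi).elim

theorem opCov_x [Nontrivial R] (hp : IsOrthogonalFamily L x p) (n : ℕ) (f : A) :
    opCov L (fun j => aeval x (p j)) (n + 1) f x
      = Ring.inverse (L (aeval x (p n) * aeval x (p n))) *
        L (aeval x (p (n + 1)) * aeval x (p n) * f) :=
  hp.sum_sub_kernel_sq n f

/-- The covariances of the statistics `x ^ k * y`, by the Christoffel-Darboux formula. -/
theorem opCov_sub_opCov [IsDomain R] [CharZero R]
    (hp : IsOrthogonalFamily L x p) (n k : ℕ) (y : A) :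
    opCov L (fun j => aeval x (p j)) (n + 1) (x ^ k * y) (x * y)
      - opCov L (fun j => aeval x (p j)) (n + 1) (x ^ (k + 1) * y) y
      = Ring.inverse (L (aeval x (p n) * aeval x (p n))) ^ 2 * ∑ r ∈ Finset.range k,
        (L (aeval x (p (n + 1)) ^ 2 * (x ^ r * y)) * L (aeval x (p n) ^ 2 * (x ^ (k - r - 1) * y))
          - L (aeval x (p (n + 1)) * aeval x (p n) * (x ^ r * y)) *
            L (aeval x (p (n + 1)) * aeval x (p n) * (x ^ (k - r - 1) * y))) := by
  have hcd := fun r => hp.sum_sub_sq_kernel_sq n (x ^ r * y) (x ^ (k - r - 1) * y)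
  set P : ℕ → A := fun j => aeval x (p j) with hP
  set c : ℕ → R := fun j => Ring.inverse (L (P j * P j)) with hc
  set S : ℕ → ℕ → R := fun a b => ∑ i ∈ Finset.range (n + 1), ∑ j ∈ Finset.range (n + 1),
    c i * c j * (L (P i * P j * (x ^ a * y)) * L (P i * P j * (x ^ b * y))) with hS
  have hsymm : ∀ a b, S a b = S b a := by
    intro a b
    simp only [hS]
    exact Finset.sum_congr rfl fun i _ => Finset.sum_congr rfl fun j _ => by ring
  -- Both covariances have the same diagonal part, since the products of their two functions agree;
  -- the difference retains only the `K²` integrals `S`.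
  have hleft : opCov L P (n + 1) (x ^ k * y) (x * y) - opCov L P (n + 1) (x ^ (k + 1) * y) y
      = S (k + 1) 0 - S k 1 := by
    simp only [opCov, hS, pow_zero, pow_one, one_mul]
    rw [show x ^ k * y * (x * y) = x ^ (k + 1) * y * y by ring]
    ring
  have hr : ∀ r ∈ Finset.range k, S (r + 2) (k - r - 1) - 2 * S (r + 1) (k - r) + S r (k - r + 1)
      = c n ^ 2 *
        (L (P (n + 1) ^ 2 * (x ^ r * y)) * L (P n ^ 2 * (x ^ (k - r - 1) * y))
          - 2 * (L (P (n + 1) * P n * (x ^ r * y)) *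
            L (P (n + 1) * P n * (x ^ (k - r - 1) * y)))
          + L (P n ^ 2 * (x ^ r * y)) * L (P (n + 1) ^ 2 * (x ^ (k - r - 1) * y))) := by
    intro r hrk
    have hrk := Finset.mem_range.1 hrk
    rw [← hcd r]
    simp only [hS, Finset.mul_sum]
    rw [← Finset.sum_sub_distrib, ← Finset.sum_add_distrib]
    refine Finset.sum_congr rfl fun i _ => ?_
    rw [← Finset.sum_sub_distrib, ← Finset.sum_add_distrib]
    refine Finset.sum_congr rfl fun j _ => ?_
    obtain ⟨q, rfl⟩ := Nat.exists_eq_add_of_lt hrk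
    rw [show r + q + 1 - r - 1 = q by omega, show r + q + 1 - r = q + 1 by omega,
      show x ^ r * y * x ^ 2 = x ^ (r + 2) * y by ring,
      show x ^ r * y * x = x ^ (r + 1) * y by ring,
      show x ^ q * y * x = x ^ (q + 1) * y by ring,
      show x ^ q * y * x ^ 2 = x ^ (q + 2) * y by ring]
    ring
  -- The factor `(x - y)²` produces second differences of `r ↦ S r (k + 1 - r)`. They telescope to
  -- two boundary differences, equal by the symmetry of `S`; hence the factor `2`.
  have htel : ∑ r ∈ Finset.range k,
      (S (r + 2) (k - r - 1) - 2 * S (r + 1) (k - r) + S r (k - r + 1))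
      = 2 * (S (k + 1) 0 - S k 1) := by
    set s : ℕ → R := fun r => S r (k + 1 - r) with hs
    have h1 : ∀ r ∈ Finset.range k,
        S (r + 2) (k - r - 1) - 2 * S (r + 1) (k - r) + S r (k - r + 1)
        = (s (r + 1 + 1) - s (r + 1)) - (s (r + 1) - s r) := by
      intro r hrk
      have hrk := Finset.mem_range.1 hrk
      simp only [hs]
      rw [show k + 1 - (r + 1 + 1) = k - r - 1 by omega, show k + 1 - (r + 1) = k - r by omega,
        show k + 1 - r = k - r + 1 by omega]
      ring
    rw [Finset.sum_congr rfl h1, Finset.sum_range_sub (fun r => s (r + 1) - s r)]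
    have e1 : s (k + 1) = S (k + 1) 0 := by simp [hs]
    have e2 : s k = S k 1 := by simp [hs]
    have e3 : s 1 = S k 1 := by simp only [hs]; rw [hsymm, show k + 1 - 1 = k by omega]
    have e4 : s 0 = S (k + 1) 0 := by simp only [hs]; rw [hsymm, Nat.sub_zero]
    rw [e1, e2, zero_add, e3, e4]
    ring
  have hrefl : ∑ r ∈ Finset.range k,
      L (P n ^ 2 * (x ^ r * y)) * L (P (n + 1) ^ 2 * (x ^ (k - r - 1) * y))
      = ∑ r ∈ Finset.range k,
        L (P (n + 1) ^ 2 * (x ^ r * y)) * L (P n ^ 2 * (x ^ (k - r - 1) * y)) := by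
    rw [← Finset.sum_range_reflect]
    refine Finset.sum_congr rfl fun r hrk => ?_
    have hrk := Finset.mem_range.1 hrk
    rw [show k - (k - 1 - r) - 1 = r by omega, show k - 1 - r = k - r - 1 by omega, mul_comm]
  rw [hleft]
  have h2 : (2 : R) ≠ 0 := two_ne_zero
  apply mul_left_cancel₀ h2
  rw [← htel, Finset.sum_congr rfl hr, ← Finset.mul_sum]
  simp only [Finset.sum_add_distrib, Finset.sum_sub_distrib, ← Finset.mul_sum]
  rw [hrefl]
  ring

/-- The loop equation attached to a derivation `D` with `L ∘ D = L (y * ·)`. -/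
theorem opMean_derivation [Nontrivial R] (hp : IsOrthogonalFamily L x p) (m : ℕ)
    (D : Derivation R A A) (hDx : D x = x) {y : A} (hy : ∀ f, L (D f) = L (y * f)) (f : A) :
    opMean L (fun j => aeval x (p j)) m (D f) = opCov L (fun j => aeval x (p j)) m f y := by
  -- As `D` acts on polynomials as `x d/dx`, it does not raise degrees, so `D p_i` lies in the span
  -- of `p_0, …, p_{m-1}`.
  have hrep : ∀ i ∈ Finset.range m, D (aeval x (p i)) = ∑ j ∈ Finset.range m,
      (Ring.inverse (L (aeval x (p j) * aeval x (p j))) *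
        L (aeval x (p j) * D (aeval x (p i)))) • aeval x (p j) := by
    intro i hi
    have h1 : D (aeval x (p i)) = aeval x (X * derivative (p i)) := by
      rw [Derivation.map_aeval, hDx, map_mul, aeval_X, smul_eq_mul, mul_comm]
    rw [h1]
    apply hp.aeval_eq_sum
    refine lt_of_le_of_lt degree_le_natDegree ?_
    have h2 : (X * derivative (p i)).natDegree ≤ i := by
      by_cases h0 : derivative (p i) = 0
      · simp [h0]
      · rw [natDegree_X_mul h0]
        have h3 := natDegree_derivative_lt (p := p i) (fun h => h0 (by
          rw [natDegree_eq_zero.1 h |>.choose_spec.symm]; simp))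
        rw [hp.natDegree] at h3
        omega
    exact_mod_cast h2.trans_lt (Finset.mem_range.1 hi)
  set P : ℕ → A := fun j => aeval x (p j) with hP
  set c : ℕ → R := fun j => Ring.inverse (L (P j * P j)) with hc
  change ∀ i ∈ Finset.range m, D (P i) = ∑ j ∈ Finset.range m, (c j * L (P j * D (P i))) • P j
    at hrep
  have h1 : ∀ i, L (P i * P i * (f * y)) = 2 * L (P i * f * D (P i)) + L (P i * P i * D f) := by
    intro i
    rw [show P i * P i * (f * y) = y * (P i * P i * f) by ring, ← hy]
    simp only [Derivation.leibniz, smul_eq_mul]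
    rw [show P i * P i * D f + f * (P i * D (P i) + P i * D (P i))
      = P i * f * D (P i) + P i * f * D (P i) + P i * P i * D f by ring, map_add, map_add]
    ring
  have h2 : ∀ i j, L (P i * P j * y) = L (P i * D (P j)) + L (P j * D (P i)) := by
    intro i j
    rw [mul_comm (P i * P j), ← hy, Derivation.leibniz, map_add, smul_eq_mul, smul_eq_mul]
  -- This is the reproducing property applied to `D p_i`; it makes the double sums cancel the terms
  -- `2 L (P_i f D P_i)` produced by the Leibniz rule.
  have h3 : ∀ i ∈ Finset.range m, ∑ j ∈ Finset.range m,
      c i * c j * (L (P i * P j * f) * L (P j * D (P i))) = c i * L (P i * f * D (P i)) := by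
    intro i hi
    conv_rhs => rw [hrep i hi]
    rw [Finset.mul_sum, map_sum, Finset.mul_sum]
    refine Finset.sum_congr rfl fun j _ => ?_
    rw [mul_smul_comm, map_smul, smul_eq_mul, mul_right_comm (P i) f]
    ring
  have h4 : ∑ i ∈ Finset.range m, ∑ j ∈ Finset.range m,
      c i * c j * (L (P i * P j * f) * L (P i * D (P j)))
      = ∑ i ∈ Finset.range m, c i * L (P i * f * D (P i)) := by
    rw [Finset.sum_comm, ← Finset.sum_congr rfl h3]
    refine Finset.sum_congr rfl fun i _ => Finset.sum_congr rfl fun j _ => ?_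
    rw [mul_comm (P j) (P i)]
    ring
  change ∑ i ∈ Finset.range m, c i * L (P i * P i * D f)
    = ∑ i ∈ Finset.range m, c i * L (P i * P i * (f * y)) - ∑ i ∈ Finset.range m,
      ∑ j ∈ Finset.range m, c i * c j * (L (P i * P j * f) * L (P i * P j * y))
  simp only [h1, h2, mul_add, Finset.sum_add_distrib]
  rw [h4, Finset.sum_congr rfl h3]
  simp only [mul_left_comm (c _) 2, ← Finset.mul_sum]
  ring

end IsOrthogonalFamily

/-! ### From Vandermonde integrals to `opMean` and `opCov` -/

section Bridge

open Matrix

variable {B : Type*} [CommRing B] [Algebra R B] {L : A →ₗ[R] R} {x : A} {p : ℕ → R[X]}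

/-- Replacing the powers of `x` by monic polynomials of the same degrees is a unitriangular column
operation. -/
theorem alternant_aeval_eq_vandermonde {m : ℕ} [Nontrivial R] [Nontrivial B] (hp : IsOrthogonalFamily L x p)
    (ι : Fin m → A →ₐ[R] B) :
    alternant (fun i => (ι i : A →+* B)) (fun j => aeval x (p j))
      = (vandermonde fun i => ι i x).det := by
  have h := det_eval_matrixOfPolynomials_eq_det_vandermonde (fun i => ι i x)
    (fun j : Fin m => (p j).map (algebraMap R B))
    (fun j => by rw [(hp.monic j).natDegree_map, hp.natDegree])
    (fun j => (hp.monic j).map _)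
  rw [h, alternant]
  congr 1
  ext i j
  simp [Polynomial.aeval_algHom_apply, Polynomial.eval_map_algebraMap]

theorem gram_one_eq_diagonal {m : ℕ} (hp : IsOrthogonalFamily L x p) :
    gram (m := m) L.toAddMonoidHom (fun j => aeval x (p j)) 1
      = diagonal fun j : Fin m => L (aeval x (p j) * aeval x (p j)) := by
  ext i j
  rcases eq_or_ne i j with rfl | h
  · simp [gram]
  · rw [diagonal_apply_ne _ h]
    simp [gram, hp.orthogonal i j (fun h' => h (Fin.ext h'))]

theorem inv_gram_one {m : ℕ} (hp : IsOrthogonalFamily L x p) :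
    (gram (m := m) L.toAddMonoidHom (fun j => aeval x (p j)) 1)⁻¹
      = diagonal fun j : Fin m => Ring.inverse (L (aeval x (p j) * aeval x (p j))) := by
  rw [gram_one_eq_diagonal hp]
  apply inv_eq_left_inv
  rw [diagonal_mul_diagonal, ← diagonal_one]
  congr 1
  ext j
  exact Ring.inverse_mul_cancel _ (hp.isUnit j)

theorem isUnit_det_gram_one {m : ℕ} (hp : IsOrthogonalFamily L x p) :
    IsUnit (gram (m := m) L.toAddMonoidHom (fun j => aeval x (p j)) 1).det := by
  rw [gram_one_eq_diagonal hp, det_diagonal]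
  exact IsUnit.prod_univ_iff.2 fun j => hp.isUnit j

theorem trace_inv_gram_mul {m : ℕ} (hp : IsOrthogonalFamily L x p) (f : A) :
    ((gram (m := m) L.toAddMonoidHom (fun j => aeval x (p j)) 1)⁻¹ *
      gram L.toAddMonoidHom (fun j => aeval x (p j)) f).trace
      = opMean L (fun j => aeval x (p j)) m f := by
  rw [inv_gram_one hp, opMean, Finset.sum_range]
  simp [Matrix.trace, diagonal_mul, gram]

theorem trace_inv_gram_mul_mul {m : ℕ} (hp : IsOrthogonalFamily L x p) (f g : A) :
    ((gram (m := m) L.toAddMonoidHom (fun j => aeval x (p j)) 1)⁻¹ *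
        gram L.toAddMonoidHom (fun j => aeval x (p j)) (f * g)).trace
      - ((gram (m := m) L.toAddMonoidHom (fun j => aeval x (p j)) 1)⁻¹ *
        gram L.toAddMonoidHom (fun j => aeval x (p j)) g *
        ((gram (m := m) L.toAddMonoidHom (fun j => aeval x (p j)) 1)⁻¹ *
        gram L.toAddMonoidHom (fun j => aeval x (p j)) f)).trace
      = opCov L (fun j => aeval x (p j)) m f g := by
  rw [trace_inv_gram_mul hp, opCov, ← opMean, inv_gram_one hp]
  congr 1
  rw [Finset.sum_range]
  simp only [Finset.sum_range]
  simp only [Matrix.trace, diag_apply]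
  refine Finset.sum_congr rfl fun i _ => ?_
  rw [Matrix.mul_apply]
  refine Finset.sum_congr rfl fun j _ => ?_
  rw [diagonal_mul, diagonal_mul]
  simp only [gram, of_apply, LinearMap.toAddMonoidHom_coe]
  rw [mul_comm (aeval x (p j)) (aeval x (p i))]
  ring

variable [Nontrivial B] {m : ℕ} {ι : Fin m → A →ₐ[R] B} {Λ : B →+ R}

theorem vandermonde_sq [Nontrivial R] (hp : IsOrthogonalFamily L x p)
    (h : IsProductFunctional (fun i => (ι i : A →+* B)) L.toAddMonoidHom Λ) :
    Λ ((vandermonde fun i => ι i x).det ^ 2)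
      = m.factorial * ∏ j ∈ Finset.range m, L (aeval x (p j) * aeval x (p j)) := by
  rw [← alternant_aeval_eq_vandermonde hp, h.alternant_sq, gram_one_eq_diagonal hp, det_diagonal,
    Finset.prod_range]

theorem vandermonde_sq_mul_sum [Nontrivial R] (hp : IsOrthogonalFamily L x p)
    (h : IsProductFunctional (fun i => (ι i : A →+* B)) L.toAddMonoidHom Λ) (f : A) :
    Λ ((vandermonde fun i => ι i x).det ^ 2 * ∑ i, ι i f)
      = opMean L (fun j => aeval x (p j)) m f * Λ ((vandermonde fun i => ι i x).det ^ 2) := by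
  have h1 := h.alternant_sq_mul_sum (fun j => aeval x (p j)) (isUnit_det_gram_one hp) f
  have h2 := h.alternant_sq (fun j => aeval x (p j))
  rw [alternant_aeval_eq_vandermonde hp] at h1 h2
  rw [trace_inv_gram_mul hp] at h1
  rw [h2]
  refine h1.trans ?_
  ring

theorem vandermonde_sq_mul_sum_mul_sum [Nontrivial R] (hp : IsOrthogonalFamily L x p)
    (h : IsProductFunctional (fun i => (ι i : A →+* B)) L.toAddMonoidHom Λ) (f g : A) :
    Λ ((vandermonde fun i => ι i x).det ^ 2 * ((∑ i, ι i f) * ∑ i, ι i g))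
      = (opMean L (fun j => aeval x (p j)) m f * opMean L (fun j => aeval x (p j)) m g
        + opCov L (fun j => aeval x (p j)) m f g) * Λ ((vandermonde fun i => ι i x).det ^ 2) := by
  have h1 := h.alternant_sq_mul_sum_mul_sum (fun j => aeval x (p j)) (isUnit_det_gram_one hp) f g
  have h2 := h.alternant_sq (fun j => aeval x (p j))
  rw [alternant_aeval_eq_vandermonde hp] at h1 h2
  rw [← trace_inv_gram_mul_mul hp, ← trace_inv_gram_mul hp, ← trace_inv_gram_mul hp, h2]
  refine h1.trans ?_
  ring

end Bridge

end MeanCovariance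

/-! ### Integration of polynomials in `x` and `log x` against the Laguerre weight -/

section Analysis

open Set Filter Topology

/-- The point `(x, log x)`. -/
def logPoint (x : ℝ) : Bool → ℝ := fun b => if b then Real.log x else x

/-- The points `(x i, log (x i))`. -/
def logPoints {m : ℕ} (x : Fin m → ℝ) : Fin m × Bool → ℝ := fun q => logPoint (x q.1) q.2

/-- Lebesgue measure on the positive half-line. -/
def halfLine : Measure ℝ := volume.restrict (Ioi 0)

instance : SigmaFinite halfLine := by unfold halfLine; infer_instance

/-- The Laguerre weight. -/
def lagWeight (α x : ℝ) : ℝ := x ^ α * Real.exp (-x)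

theorem ae_pos_halfLine : ∀ᵐ x ∂halfLine, 0 < x :=
  ae_restrict_mem measurableSet_Ioi

theorem abs_log_le_rpow {x η : ℝ} (hx : 0 < x) (hη : 0 < η) :
    |Real.log x| ≤ (x ^ η + x ^ (-η)) / η := by
  have h1 := Real.log_le_rpow_div hx.le hη
  have h2 := Real.log_le_rpow_div (inv_pos.2 hx).le hη
  rw [Real.log_inv, Real.inv_rpow hx.le, ← Real.rpow_neg hx.le] at h2
  have h3 : 0 < x ^ η / η := by positivity
  have h4 : 0 < x ^ (-η) / η := by positivity
  rw [add_div, abs_le]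
  constructor <;> linarith

theorem integrable_abs_log_pow (b : ℕ) {s : ℝ} (hs : 0 < s) :
    Integrable (fun x => |Real.log x| ^ b * (x ^ (s - 1) * Real.exp (-x))) halfLine := by
  induction b generalizing s with
  | zero =>
    have h := Real.GammaIntegral_convergent hs
    simpa [mul_comm, halfLine, IntegrableOn] using h
  | succ b ih =>
    -- Each logarithm costs a power `x ^ (± s / 2)`; half of the margin `s` is spent, so the
    -- exponent `s - s / 2` stays positive for the induction.
    have hη : 0 < s / 2 := by positivity
    have h1 := ((ih (s := s + s / 2) (by positivity)).add (ih (s := s - s / 2) (by linarith))).const_mul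
      (s / 2)⁻¹
    refine h1.mono' (by fun_prop) ?_
    filter_upwards [ae_pos_halfLine] with x hx
    have hl := abs_log_le_rpow hx hη
    have e1 : x ^ (s + s / 2 - 1) = x ^ (s - 1) * x ^ (s / 2) := by
      rw [← Real.rpow_add hx]; ring_nf
    have e2 : x ^ (s - s / 2 - 1) = x ^ (s - 1) * x ^ (-(s / 2)) := by
      rw [← Real.rpow_add hx]; ring_nf
    have hnn : 0 ≤ |Real.log x| ^ b * (x ^ (s - 1) * Real.exp (-x)) := by positivity
    rw [Real.norm_of_nonneg (by positivity), pow_succ]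
    calc |Real.log x| ^ b * |Real.log x| * (x ^ (s - 1) * Real.exp (-x))
        = |Real.log x| ^ b * (x ^ (s - 1) * Real.exp (-x)) * |Real.log x| := by ring
      _ ≤ |Real.log x| ^ b * (x ^ (s - 1) * Real.exp (-x)) * ((x ^ (s / 2) + x ^ (-(s / 2))) / (s / 2)) :=
          mul_le_mul_of_nonneg_left hl hnn
      _ = _ := by
          simp only [Pi.add_apply]
          rw [e1, e2]
          ring

theorem measurable_lagWeight (α : ℝ) : Measurable (lagWeight α) := by
  unfold lagWeight; fun_prop

theorem integrable_pow_mul_log_pow {α : ℝ} (hα : -1 < α) (a b : ℕ) :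
    Integrable (fun x => x ^ a * Real.log x ^ b * lagWeight α x) halfLine := by
  have h := integrable_abs_log_pow b (s := a + α + 1) (by have : (0 : ℝ) ≤ a := a.cast_nonneg; linarith)
  refine h.mono' ?_ ?_
  · exact (((measurable_id.pow_const a).mul (Real.measurable_log.pow_const b)).mul
      (measurable_lagWeight α)).aestronglyMeasurable
  · filter_upwards [ae_pos_halfLine] with x hx
    rw [norm_mul, norm_mul, norm_pow, norm_pow, Real.norm_of_nonneg hx.le, Real.norm_eq_abs, lagWeight,
      Real.norm_of_nonneg (by positivity), show (a : ℝ) + α + 1 - 1 = a + α by ring, Real.rpow_add hx,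
      Real.rpow_natCast]
    exact le_of_eq (by ring)

variable {m : ℕ}

/-- The product of the Laguerre weights. -/
def lagWeights (α : ℝ) (x : Fin m → ℝ) : ℝ := ∏ i, lagWeight α (x i)

/-- Product Lebesgue measure on the positive orthant. -/
def orthant (m : ℕ) : Measure (Fin m → ℝ) := Measure.pi fun _ => halfLine

theorem measurable_eval_logPoints (F : MvPolynomial (Fin m × Bool) ℝ) :
    Measurable fun x : Fin m → ℝ => MvPolynomial.eval (logPoints x) F := by
  have hl : ∀ q : Fin m × Bool, Measurable fun x : Fin m → ℝ => logPoints x q := by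
    rintro ⟨i, b⟩
    cases b
    · simpa [logPoints, logPoint] using measurable_pi_apply i
    · simpa [logPoints, logPoint] using (measurable_pi_apply i).log
  induction F using MvPolynomial.induction_on with
  | C a => simp
  | add p q hp hq => simp only [map_add]; exact hp.add hq
  | mul_X p q hp => simp only [map_mul, MvPolynomial.eval_X]; exact hp.mul (hl q)

theorem measurable_lagWeights (α : ℝ) : Measurable (lagWeights (m := m) α) := by
  unfold lagWeights
  exact Finset.measurable_fun_prod _ fun i _ => (measurable_lagWeight α).comp (measurable_pi_apply i)

theorem integrable_eval_logPoints {α : ℝ} (hα : -1 < α) (F : MvPolynomial (Fin m × Bool) ℝ) :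
    Integrable (fun x => MvPolynomial.eval (logPoints x) F * lagWeights α x) (orthant m) := by
  induction F using MvPolynomial.induction_on' with
  | monomial d c =>
    have h : Integrable (fun x : Fin m → ℝ => ∏ i,
        (x i ^ d (i, false) * Real.log (x i) ^ d (i, true) * lagWeight α (x i))) (orthant m) :=
      Integrable.fintype_prod (f := fun i y => y ^ d (i, false) * Real.log y ^ d (i, true) *
        lagWeight α y) fun i => integrable_pow_mul_log_pow hα _ _
    refine (h.const_mul c).congr (Eventually.of_forall fun x => ?_)
    simp only [MvPolynomial.eval_monomial, lagWeights, Finset.prod_mul_distrib]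
    rw [Finsupp.prod_fintype _ _ (fun q => pow_zero _), Fintype.prod_prod_type]
    simp only [Fintype.prod_bool, logPoints, logPoint, Finset.prod_mul_distrib]
    simp
    ring
  | add p q hp hq =>
    refine (hp.add hq).congr (Eventually.of_forall fun x => ?_)
    simp [add_mul]

/-- Integration of polynomials in `x i`, `log (x i)` against the product of Laguerre weights. -/
def orthantIntegral (m : ℕ) {α : ℝ} (hα : -1 < α) : MvPolynomial (Fin m × Bool) ℝ →ₗ[ℝ] ℝ where
  toFun F := ∫ x, MvPolynomial.eval (logPoints x) F * lagWeights α x ∂(orthant m)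
  map_add' F G := by
    simp only [map_add, add_mul]
    exact integral_add (integrable_eval_logPoints hα F) (integrable_eval_logPoints hα G)
  map_smul' c F := by
    simp only [MvPolynomial.smul_eval, mul_assoc, integral_const_mul, RingHom.id_apply, smul_eq_mul]

theorem integrable_eval_logPoint {α : ℝ} (hα : -1 < α) (f : MvPolynomial Bool ℝ) :
    Integrable (fun x => MvPolynomial.eval (logPoint x) f * lagWeight α x) halfLine := by
  induction f using MvPolynomial.induction_on' with
  | monomial d c =>
    refine ((integrable_pow_mul_log_pow hα (d false) (d true)).const_mul c).congr
      (Eventually.of_forall fun x => ?_)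
    simp only [MvPolynomial.eval_monomial]
    rw [Finsupp.prod_fintype _ _ (fun q => pow_zero _)]
    simp [logPoint]
    ring
  | add p q hp hq =>
    refine (hp.add hq).congr (Eventually.of_forall fun x => ?_)
    simp [add_mul]

/-- Integration of polynomials in `x`, `log x` against the Laguerre weight. -/
def halfLineIntegral {α : ℝ} (hα : -1 < α) : MvPolynomial Bool ℝ →ₗ[ℝ] ℝ where
  toFun f := ∫ x, MvPolynomial.eval (logPoint x) f * lagWeight α x ∂halfLine
  map_add' f g := by
    simp only [map_add, add_mul]
    exact integral_add (integrable_eval_logPoint hα f) (integrable_eval_logPoint hα g)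
  map_smul' c f := by
    simp only [MvPolynomial.smul_eval, mul_assoc, integral_const_mul, RingHom.id_apply, smul_eq_mul]

/-- The embedding of the polynomials in `x, log x` as polynomials in `x i`, `log (x i)`. -/
def coordEmb (i : Fin m) : MvPolynomial Bool ℝ →ₐ[ℝ] MvPolynomial (Fin m × Bool) ℝ :=
  MvPolynomial.rename fun b => (i, b)

theorem eval_coordEmb (i : Fin m) (f : MvPolynomial Bool ℝ) (x : Fin m → ℝ) :
    MvPolynomial.eval (logPoints x) (coordEmb i f) = MvPolynomial.eval (logPoint (x i)) f := by
  rw [coordEmb, MvPolynomial.eval_rename]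
  rfl

theorem isProductFunctional_orthantIntegral (m : ℕ) {α : ℝ} (hα : -1 < α) :
    IsProductFunctional (fun i : Fin m => (coordEmb i : _ →+* _))
      (halfLineIntegral hα).toAddMonoidHom (orthantIntegral m hα).toAddMonoidHom := by
  intro f
  change ∫ x, MvPolynomial.eval (logPoints x) (∏ i, coordEmb i (f i)) * lagWeights α x ∂(orthant m)
    = ∏ i, ∫ x, MvPolynomial.eval (logPoint x) (f i) * lagWeight α x ∂halfLine
  rw [← integral_fintype_prod_eq_prod
    (fun i y => MvPolynomial.eval (logPoint y) (f i) * lagWeight α y)]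
  simp only [map_prod, eval_coordEmb, lagWeights, Finset.prod_mul_distrib]
  rfl

/-- The derivation `x d/dx` on polynomials in `x` and `log x`. -/
def eulerDerivation : Derivation ℝ (MvPolynomial Bool ℝ) (MvPolynomial Bool ℝ) :=
  MvPolynomial.mkDerivation ℝ fun b => if b then 1 else MvPolynomial.X false

theorem hasDerivAt_eval_logPoint (f : MvPolynomial Bool ℝ) {x : ℝ} (hx : 0 < x) :
    HasDerivAt (fun y => MvPolynomial.eval (logPoint y) f)
      (MvPolynomial.eval (logPoint x) (eulerDerivation f) / x) x := by
  induction f using MvPolynomial.induction_on with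
  | C a =>
    simpa [eulerDerivation] using hasDerivAt_const x a
  | add p q hp hq =>
    have := hp.add hq
    simp only [map_add, add_div]
    exact this
  | mul_X p b hp =>
    have hb : HasDerivAt (fun y => logPoint y b)
        (MvPolynomial.eval (logPoint x) (eulerDerivation (MvPolynomial.X b)) / x) x := by
      cases b
      · simpa [logPoint, eulerDerivation, MvPolynomial.mkDerivation_X, hx.ne'] using hasDerivAt_id' x
      · simpa [logPoint, eulerDerivation, MvPolynomial.mkDerivation_X] using Real.hasDerivAt_log hx.ne'
    have := hp.mul hb
    simp only [map_mul, MvPolynomial.eval_X, Derivation.leibniz, map_add, smul_eq_mul]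
    refine this.congr_deriv ?_
    ring

/-- The boundary term at `0` of the integration by parts: the positive power `x ^ (α + 1)` dominates
all powers of the logarithm. -/
theorem tendsto_eval_logPoint_zero {α : ℝ} (hα : -1 < α) (f : MvPolynomial Bool ℝ) :
    Tendsto (fun x => MvPolynomial.eval (logPoint x) f * (x * lagWeight α x)) (𝓝[>] 0) (𝓝 0) := by
  induction f using MvPolynomial.induction_on' with
  | monomial d c =>
    have h1 := (isLittleO_abs_log_rpow_rpow_nhdsGT_zero (s := -(α + 1)) (d true)
      (by linarith)).tendsto_div_nhds_zero
    have h2 : Tendsto (fun x : ℝ => |c| * (|x| ^ d false * Real.exp (-x))) (𝓝[>] 0)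
        (𝓝 (|c| * (|0| ^ d false * Real.exp (-0)))) :=
      (Continuous.tendsto (by fun_prop) 0).mono_left nhdsWithin_le_nhds
    have h3 := h1.mul h2
    rw [zero_mul] at h3
    refine squeeze_zero_norm' ?_ h3
    filter_upwards [self_mem_nhdsWithin] with x hx
    have hx : 0 < x := hx
    simp only [MvPolynomial.eval_monomial]
    rw [Finsupp.prod_fintype _ _ (fun q => pow_zero _)]
    simp only [Fintype.prod_bool, logPoint, lagWeight, if_true, Bool.false_eq_true, if_false,
      norm_mul, norm_pow, Real.norm_eq_abs, Real.rpow_natCast]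
    rw [Real.rpow_neg hx.le, Real.rpow_add hx, Real.rpow_one, abs_of_pos (Real.rpow_pos_of_pos hx α),
      abs_of_pos (Real.exp_pos _), abs_of_pos hx, div_inv_eq_mul]
    exact le_of_eq (by ring)
  | add p q hp hq =>
    have := hp.add hq
    rw [add_zero] at this
    refine this.congr fun x => ?_
    simp [add_mul]

/-- The fundamental theorem of calculus for `f x^(α+1) e^{-x}`, whose derivative is `(x f' - (x - α
- 1) f) x^α e^{-x}`. -/
theorem halfLineIntegral_eulerDerivation {α : ℝ} (hα : -1 < α) (f : MvPolynomial Bool ℝ) :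
    halfLineIntegral hα (eulerDerivation f)
      = halfLineIntegral hα ((MvPolynomial.X false - MvPolynomial.C (α + 1)) * f) := by
  set G : ℝ → ℝ := fun x => MvPolynomial.eval (logPoint x) f * (x ^ (α + 1) * Real.exp (-x)) with hG
  set g : MvPolynomial Bool ℝ :=
    eulerDerivation f - (MvPolynomial.X false - MvPolynomial.C (α + 1)) * f with hg
  have hGx : ∀ x, 0 < x → G x = MvPolynomial.eval (logPoint x) f * (x * lagWeight α x) := by
    intro x hx
    simp only [hG, lagWeight]
    rw [Real.rpow_add hx, Real.rpow_one]
    ring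
  have hderiv : ∀ x ∈ Ioi (0 : ℝ),
      HasDerivAt G (MvPolynomial.eval (logPoint x) g * lagWeight α x) x := by
    intro x hx
    have hx : 0 < x := hx
    have h1 := (hasDerivAt_eval_logPoint f hx).mul
      ((Real.hasDerivAt_rpow_const (p := α + 1) (Or.inl hx.ne')).mul
        ((hasDerivAt_neg x).exp))
    refine h1.congr_deriv ?_
    simp only [hg, map_sub, map_mul, MvPolynomial.eval_X, MvPolynomial.eval_C, logPoint, lagWeight,
      Pi.mul_apply]
    rw [Real.rpow_add hx, Real.rpow_one, add_sub_cancel_right]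
    simp only [Bool.false_eq_true, if_false]
    field_simp
    ring
  have hint : IntegrableOn (fun x => MvPolynomial.eval (logPoint x) g * lagWeight α x) (Ioi 0) :=
    integrable_eval_logPoint hα g
  have hGint : IntegrableOn G (Ioi 0) := by
    refine (integrable_eval_logPoint (by linarith : -1 < α + 1) f).congr
      (Eventually.of_forall fun x => ?_)
    simp [hG, lagWeight]
  have hcont : ContinuousWithinAt G (Ici 0) 0 := by
    rw [← continuousWithinAt_Ioi_iff_Ici]
    have hG0 : G 0 = 0 := by
      simp only [hG]
      rw [Real.zero_rpow (by linarith)]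
      simp
    rw [ContinuousWithinAt, hG0]
    refine (tendsto_eval_logPoint_zero hα f).congr' ?_
    filter_upwards [self_mem_nhdsWithin] with x hx
    exact (hGx x hx).symm
  -- The boundary term at infinity vanishes because `G` and its derivative are both integrable.
  have key := integral_Ioi_of_hasDerivAt_of_tendsto hcont hderiv hint
    (tendsto_zero_of_hasDerivAt_of_integrableOn_Ioi hderiv hint hGint)
  have hG0 : G 0 = 0 := by
    simp only [hG]
    rw [Real.zero_rpow (by linarith)]
    simp
  rw [hG0, sub_zero] at key
  have : halfLineIntegral hα g = 0 := key
  rwa [hg, map_sub, sub_eq_zero] at this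

end Analysis

/-! ### The ensemble: normalisation, moments and differentiation in `α` -/

section Ensemble

open Set Filter Topology

variable {m : ℕ}

theorem orthant_eq_restrict (m : ℕ) :
    orthant m = (volume : Measure (Fin m → ℝ)).restrict (Set.univ.pi fun _ => Set.Ioi 0) := by
  rw [volume_pi, Measure.restrict_pi_pi]
  rfl

theorem ae_pos_orthant (m : ℕ) : ∀ᵐ x ∂(orthant m), ∀ i, 0 < x i := by
  rw [orthant_eq_restrict]
  filter_upwards [ae_restrict_mem (MeasurableSet.univ_pi fun _ => measurableSet_Ioi)] with x hx i
  exact hx i (mem_univ i)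

theorem lagWeights_eq_exp (a : ℝ) {x : Fin m → ℝ} (hx : ∀ i, 0 < x i) :
    lagWeights a x = Real.exp (a * ∑ i, Real.log (x i)) * Real.exp (-∑ i, x i) := by
  rw [lagWeights, Finset.mul_sum, Real.exp_sum, ← Finset.sum_neg_distrib, Real.exp_sum,
    ← Finset.prod_mul_distrib]
  refine Finset.prod_congr rfl fun i _ => ?_
  rw [lagWeight, Real.rpow_def_of_pos (hx i), mul_comm a]

/-- The polynomial `∑ i, log (x i)`. -/
def sumLog (m : ℕ) : MvPolynomial (Fin m × Bool) ℝ := ∑ i, MvPolynomial.X (i, true)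

theorem eval_sumLog (x : Fin m → ℝ) :
    MvPolynomial.eval (logPoints x) (sumLog m) = ∑ i, Real.log (x i) := by
  simp [sumLog, logPoints, logPoint]

theorem hasDerivAt_orthantIntegral {α : ℝ} (hα : -1 < α) (F : MvPolynomial (Fin m × Bool) ℝ) :
    HasDerivAt
      (fun a => ∫ x, MvPolynomial.eval (logPoints x) F * lagWeights a x ∂(orthant m))
      (orthantIntegral m hα (F * sumLog m)) α := by
  -- Half the distance from `α` to `-1`, so that both endpoints `α ± δ` remain admissible
  -- parameters.
  set δ := (α + 1) / 2 with hδ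
  have hδ0 : 0 < δ := by rw [hδ]; linarith
  have h1 : -1 < α - δ := by rw [hδ]; linarith
  have h2 : -1 < α + δ := by linarith
  refine (hasDerivAt_integral_of_dominated_loc_of_deriv_le
    (F' := fun a x => MvPolynomial.eval (logPoints x) (F * sumLog m) * lagWeights a x)
    (bound := fun x => ‖MvPolynomial.eval (logPoints x) (F * sumLog m) * lagWeights (α - δ) x‖
      + ‖MvPolynomial.eval (logPoints x) (F * sumLog m) * lagWeights (α + δ) x‖)
    (Metric.ball_mem_nhds α hδ0) ?_ (integrable_eval_logPoints hα F) ?_ ?_ ?_ ?_).2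
  · exact Eventually.of_forall fun a =>
      ((measurable_eval_logPoints F).mul (measurable_lagWeights a)).aestronglyMeasurable
  · exact ((measurable_eval_logPoints _).mul (measurable_lagWeights α)).aestronglyMeasurable
  · filter_upwards [ae_pos_orthant m] with x hx a ha
    rw [Metric.mem_ball, Real.dist_eq, abs_lt] at ha
    rw [norm_mul, norm_mul, norm_mul, ← mul_add]
    refine mul_le_mul_of_nonneg_left ?_ (norm_nonneg _)
    rw [lagWeights_eq_exp a hx, lagWeights_eq_exp _ hx, lagWeights_eq_exp _ hx,
      Real.norm_of_nonneg (by positivity), Real.norm_of_nonneg (by positivity),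
      Real.norm_of_nonneg (by positivity), ← add_mul]
    refine mul_le_mul_of_nonneg_right ?_ (Real.exp_pos _).le
    -- The weight is monotone in the parameter, in a direction given by the sign of `∑ log x_i`; in
    -- either case one endpoint dominates.
    rcases le_total 0 (∑ i, Real.log (x i)) with hs | hs
    · have : Real.exp (a * ∑ i, Real.log (x i)) ≤ Real.exp ((α + δ) * ∑ i, Real.log (x i)) :=
        Real.exp_le_exp.2 (mul_le_mul_of_nonneg_right (by linarith) hs)
      have h3 := Real.exp_pos ((α - δ) * ∑ i, Real.log (x i))
      linarith
    · have : Real.exp (a * ∑ i, Real.log (x i)) ≤ Real.exp ((α - δ) * ∑ i, Real.log (x i)) :=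
        Real.exp_le_exp.2 (mul_le_mul_of_nonpos_right (by linarith) hs)
      have h3 := Real.exp_pos ((α + δ) * ∑ i, Real.log (x i))
      linarith
  · exact (integrable_eval_logPoints h1 _).norm.add (integrable_eval_logPoints h2 _).norm
  · filter_upwards [ae_pos_orthant m] with x hx a _
    have h3 : HasDerivAt (fun a : ℝ => Real.exp (a * ∑ i, Real.log (x i)))
        (Real.exp (a * ∑ i, Real.log (x i)) * (1 * ∑ i, Real.log (x i))) a :=
      ((hasDerivAt_id' a).mul_const _).exp
    have h4 := (h3.mul_const (Real.exp (-∑ i, x i))).const_mul (MvPolynomial.eval (logPoints x) F)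
    simp only [lagWeights_eq_exp _ hx]
    refine h4.congr_deriv ?_
    rw [map_mul, eval_sumLog]
    ring

/-- The Vandermonde determinant of the `x i`. -/
def vdm (m : ℕ) : MvPolynomial (Fin m × Bool) ℝ :=
  (Matrix.vandermonde fun i => MvPolynomial.X (i, false)).det

theorem density_eq (α : ℝ) (x : Fin m → ℝ) :
    density m α x = MvPolynomial.eval (logPoints x) (vdm m ^ 2) * lagWeights α x := by
  rw [density, lagWeights]
  congr 1
  rw [vdm, Matrix.det_vandermonde]
  simp only [map_pow, map_prod, map_sub, MvPolynomial.eval_X, logPoints, logPoint,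
    ← Finset.prod_pow, Bool.false_eq_true, if_false]
  exact Finset.prod_congr rfl fun i _ => Finset.prod_congr rfl fun j _ => by ring

theorem measurable_density (m : ℕ) (α : ℝ) : Measurable (density m α) := by
  have : density m α = fun x => MvPolynomial.eval (logPoints x) (vdm m ^ 2) * lagWeights α x :=
    funext fun x => density_eq α x
  rw [this]
  exact (measurable_eval_logPoints _).mul (measurable_lagWeights α)

theorem ae_density_nonneg (m : ℕ) (α : ℝ) : ∀ᵐ x ∂(orthant m), 0 ≤ density m α x := by
  filter_upwards [ae_pos_orthant m] with x hx
  rw [density_eq, lagWeights_eq_exp _ hx, map_pow]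
  positivity

theorem halfLineIntegral_sq_pos {α : ℝ} (hα : -1 < α) (q : Polynomial ℝ) (hq : q ≠ 0) :
    0 < halfLineIntegral hα (Polynomial.aeval (MvPolynomial.X false) q *
      Polynomial.aeval (MvPolynomial.X false) q) := by
  set f := Polynomial.aeval (MvPolynomial.X false : MvPolynomial Bool ℝ) q with hf
  have hev : ∀ x, MvPolynomial.eval (logPoint x) f = q.eval x := by
    intro x
    rw [hf, ← MvPolynomial.coe_aeval_eq_eval]
    change MvPolynomial.aeval (logPoint x) (Polynomial.aeval (MvPolynomial.X false) q) = _
    rw [← Polynomial.aeval_algHom_apply, MvPolynomial.aeval_X]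
    simp [logPoint, Polynomial.aeval_def, Polynomial.eval₂_eq_eval_map]
  have hnn : 0 ≤ᵐ[halfLine] fun x => MvPolynomial.eval (logPoint x) (f * f) * lagWeight α x := by
    filter_upwards [ae_pos_halfLine] with x hx
    rw [map_mul]
    exact mul_nonneg (mul_self_nonneg _) (by unfold lagWeight; positivity)
  have h0 : 0 ≤ halfLineIntegral hα (f * f) := integral_nonneg_of_ae hnn
  refine h0.lt_of_ne fun h => ?_
  have h1 : (fun x => MvPolynomial.eval (logPoint x) (f * f) * lagWeight α x) =ᵐ[halfLine] 0 :=
    (integral_eq_zero_iff_of_nonneg_ae hnn (integrable_eval_logPoint hα (f * f))).1 h.symm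
  have h2 : ∀ᵐ x ∂halfLine, x ∈ (q.roots.toFinset : Set ℝ) := by
    filter_upwards [h1, ae_pos_halfLine] with x hx hpos
    have hw : lagWeight α x ≠ 0 := by unfold lagWeight; positivity
    rw [map_mul, hev] at hx
    have hx' : q.eval x * q.eval x = 0 := by simpa [hw] using hx
    simpa [hq] using hx'
  have h3 : halfLine (q.roots.toFinset : Set ℝ)ᶜ = 0 := h2
  have h4 : halfLine (q.roots.toFinset : Set ℝ) = 0 := by
    unfold halfLine
    exact Measure.absolutelyContinuous_of_le Measure.restrict_le_self
      (Finset.measure_zero _ volume)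
  have h5 : halfLine univ = 0 := by
    rw [← Set.union_compl_self (q.roots.toFinset : Set ℝ)]
    exact measure_union_null h4 h3
  simp [halfLine] at h5

theorem isOrthogonalFamily_laguerre {α : ℝ} (hα : -1 < α) :
    IsOrthogonalFamily (halfLineIntegral hα) (MvPolynomial.X false)
      (orthoPoly (halfLineIntegral hα) (MvPolynomial.X false)) :=
  isOrthogonalFamily_orthoPoly _ _ fun q hq =>
    (halfLineIntegral_sq_pos hα q hq.ne_zero).ne'.isUnit

/-- The integrand is nonnegative, and the integral is nonzero because it equals `m!` times a product
of squared norms. -/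
theorem orthantIntegral_vdm_sq_pos (m : ℕ) {α : ℝ} (hα : -1 < α) :
    0 < orthantIntegral m hα (vdm m ^ 2) := by
  have hnn : 0 ≤ orthantIntegral m hα (vdm m ^ 2) := by
    change 0 ≤ ∫ x, MvPolynomial.eval (logPoints x) (vdm m ^ 2) * lagWeights α x ∂(orthant m)
    refine integral_nonneg_of_ae ?_
    filter_upwards [ae_density_nonneg m α] with x hx
    rwa [density_eq] at hx
  have h := vandermonde_sq (isOrthogonalFamily_laguerre hα) (ι := fun i : Fin m => coordEmb i)
    (Λ := (orthantIntegral m hα).toAddMonoidHom) (isProductFunctional_orthantIntegral m hα)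
  have hv : (Matrix.vandermonde fun i : Fin m => coordEmb i (MvPolynomial.X false)).det = vdm m := by
    simp [vdm, coordEmb]
  rw [hv] at h
  have hne : orthantIntegral m hα (vdm m ^ 2) ≠ 0 := by
    refine (ne_of_eq_of_ne h ?_)
    refine mul_ne_zero (by positivity) (Finset.prod_ne_zero_iff.2 fun j _ => ?_)
    exact ((isOrthogonalFamily_laguerre hα).isUnit j).ne_zero
  exact hnn.lt_of_ne hne.symm

theorem weightMeasure_eq (m : ℕ) (α : ℝ) :
    weightMeasure m α = (orthant m).withDensity fun x => ENNReal.ofReal (density m α x) := by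
  rw [weightMeasure, orthant_eq_restrict]

theorem weightMeasure_univ (m : ℕ) {α : ℝ} (hα : -1 < α) :
    weightMeasure m α univ = ENNReal.ofReal (orthantIntegral m hα (vdm m ^ 2)) := by
  rw [weightMeasure_eq, withDensity_apply _ MeasurableSet.univ, Measure.restrict_univ,
    ← ofReal_integral_eq_lintegral_ofReal ?_ (ae_density_nonneg m α)]
  · congr 1
    exact integral_congr_ae (Eventually.of_forall fun x => density_eq α x)
  · exact (integrable_eval_logPoints hα _).congr
      (Eventually.of_forall fun x => (density_eq α x).symm)

theorem isProbabilityMeasure_ensemble (m : ℕ) {α : ℝ} (hα : -1 < α) :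
    IsProbabilityMeasure (ensemble m α) := by
  constructor
  rw [ensemble, Measure.smul_apply, smul_eq_mul, weightMeasure_univ m hα]
  exact ENNReal.inv_mul_cancel (by simpa using orthantIntegral_vdm_sq_pos m hα) ENNReal.ofReal_ne_top

theorem integrable_eval_ensemble {α : ℝ} (hα : -1 < α) (F : MvPolynomial (Fin m × Bool) ℝ) :
    Integrable (fun x => MvPolynomial.eval (logPoints x) F) (ensemble m α) := by
  rw [ensemble, weightMeasure_univ m hα, weightMeasure_eq]
  refine Integrable.smul_measure ?_
    (ENNReal.inv_ne_top.2 (by simpa using orthantIntegral_vdm_sq_pos m hα))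
  rw [integrable_withDensity_iff_integrable_smul' (measurable_density m α).ennreal_ofReal
    (Eventually.of_forall fun x => ENNReal.ofReal_lt_top)]
  refine (integrable_eval_logPoints hα (vdm m ^ 2 * F)).congr ?_
  filter_upwards [ae_density_nonneg m α] with x hx
  rw [ENNReal.toReal_ofReal hx, density_eq, smul_eq_mul, map_mul]
  ring

theorem integral_eval_ensemble {α : ℝ} (hα : -1 < α) (F : MvPolynomial (Fin m × Bool) ℝ) :
    ∫ x, MvPolynomial.eval (logPoints x) F ∂(ensemble m α)
      = orthantIntegral m hα (vdm m ^ 2 * F) / orthantIntegral m hα (vdm m ^ 2) := by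
  rw [ensemble, weightMeasure_univ m hα, weightMeasure_eq, integral_smul_measure,
    integral_withDensity_eq_integral_toReal_smul (measurable_density m α).ennreal_ofReal
    (Eventually.of_forall fun x => ENNReal.ofReal_lt_top), ENNReal.toReal_inv,
    ENNReal.toReal_ofReal (orthantIntegral_vdm_sq_pos m hα).le, smul_eq_mul, inv_mul_eq_div]
  congr 1
  refine integral_congr_ae ?_
  filter_upwards [ae_density_nonneg m α] with x hx
  rw [ENNReal.toReal_ofReal hx, density_eq, smul_eq_mul, map_mul]
  ring

theorem memLp_eval_ensemble {α : ℝ} (hα : -1 < α) (F : MvPolynomial (Fin m × Bool) ℝ)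
    {p : ENNReal} (hp : p ≠ ⊤) :
    MemLp (fun x => MvPolynomial.eval (logPoints x) F) p (ensemble m α) := by
  have := isProbabilityMeasure_ensemble m hα
  obtain ⟨n, hn⟩ := ENNReal.exists_nat_gt hp
  -- For an even exponent, `|F|^p` is again a polynomial in `x_i` and `log x_i`, hence integrable;
  -- smaller exponents follow because the measure is finite.
  have h1 : MemLp (fun x => MvPolynomial.eval (logPoints x) F) ((2 * (n + 1) : ℕ) : ENNReal)
      (ensemble m α) := by
    rw [← integrable_norm_rpow_iff (measurable_eval_logPoints F).aestronglyMeasurable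
      (by simp) (ENNReal.natCast_ne_top _)]
    refine (integrable_eval_ensemble hα (F ^ (2 * (n + 1)))).congr (Eventually.of_forall fun x => ?_)
    simp only [ENNReal.toReal_natCast, Real.rpow_natCast, map_pow]
    rw [pow_mul, pow_mul, Real.norm_eq_abs, sq_abs]
  refine h1.mono_exponent (hn.le.trans ?_)
  exact_mod_cast (by omega : n ≤ 2 * (n + 1))

/-- The derivative is the covariance with `∑ log x_i`; the subtracted product comes from
differentiating the normalising constant. -/
theorem hasDerivAt_integral_ensemble {α : ℝ} (hα : -1 < α) (F : MvPolynomial (Fin m × Bool) ℝ) :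
    HasDerivAt (fun a => ∫ x, MvPolynomial.eval (logPoints x) F ∂(ensemble m a))
      (∫ x, MvPolynomial.eval (logPoints x) (F * sumLog m) ∂(ensemble m α)
        - (∫ x, MvPolynomial.eval (logPoints x) F ∂(ensemble m α)) *
          ∫ x, MvPolynomial.eval (logPoints x) (sumLog m) ∂(ensemble m α)) α := by
  have h1 := hasDerivAt_orthantIntegral hα (vdm m ^ 2 * F)
  have h2 := hasDerivAt_orthantIntegral hα (vdm m ^ 2)
  have hZ := orthantIntegral_vdm_sq_pos m hα
  have h3 := h1.div h2 hZ.ne'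
  have h4 : (fun a => ∫ x, MvPolynomial.eval (logPoints x) F ∂(ensemble m a)) =ᶠ[𝓝 α]
      (fun a => ∫ x, MvPolynomial.eval (logPoints x) (vdm m ^ 2 * F) * lagWeights a x ∂(orthant m)) /
      (fun a => ∫ x, MvPolynomial.eval (logPoints x) (vdm m ^ 2) * lagWeights a x ∂(orthant m)) := by
    filter_upwards [lt_mem_nhds hα] with a ha
    exact integral_eval_ensemble ha F
  refine (h3.congr_of_eventuallyEq h4).congr_deriv ?_
  rw [integral_eval_ensemble hα, integral_eval_ensemble hα, integral_eval_ensemble hα]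
  change (_ * orthantIntegral m hα (vdm m ^ 2) - orthantIntegral m hα (vdm m ^ 2 * F) * _)
    / orthantIntegral m hα (vdm m ^ 2) ^ 2 = _
  rw [← mul_assoc]
  field_simp

end Ensemble

/-- The `R`-linear derivations of `A`. -/
abbrev SelfDerivation (R A : Type*) [CommRing R] [CommRing A] [Algebra R A] : Type _ :=
  Derivation R A A

/-! ### The ensemble formally tilted by `exp(X T)` -/

section Tilted

open PowerSeries

/-- The symmetrisation in `opCov_sub_opCov` cancels a factor `2` in the ring of scalars. -/
instance : CharZero ℝ⟦X⟧ := (PowerSeries.constantCoeff (R := ℝ)).charZero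

section General

variable {S S' : Type*} [CommRing S] [Algebra ℝ S] [CommRing S'] [Algebra ℝ S']

theorem mapCoeff_map_mul (L : S →ₗ[ℝ] S') (r : ℝ⟦X⟧) (g : S⟦X⟧) :
    mapCoeff L.toAddMonoidHom (PowerSeries.map (algebraMap ℝ S) r * g)
      = PowerSeries.map (algebraMap ℝ S') r * mapCoeff L.toAddMonoidHom g := by
  ext n
  simp only [coeff_mapCoeff, PowerSeries.coeff_mul, PowerSeries.coeff_map, map_sum,
    LinearMap.toAddMonoidHom_coe]
  refine Finset.sum_congr rfl fun q _ => ?_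
  rw [← Algebra.smul_def, map_smul, Algebra.smul_def]

theorem algebraMap_powerSeries (r : ℝ⟦X⟧) :
    algebraMap ℝ⟦X⟧ S⟦X⟧ r = PowerSeries.map (algebraMap ℝ S) r := rfl

/-- The formal exponential series `exp (a X)`. -/
def expSeries (a : S) : S⟦X⟧ := PowerSeries.mk fun n => ((n.factorial : ℝ)⁻¹) • a ^ n

theorem coeff_expSeries (a : S) (n : ℕ) :
    PowerSeries.coeff n (expSeries a) = ((n.factorial : ℝ)⁻¹) • a ^ n := by
  simp [expSeries]

theorem expSeries_zero : expSeries (0 : S) = 1 := by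
  ext n
  rw [coeff_expSeries, PowerSeries.coeff_one]
  split_ifs with h
  · simp [h]
  · simp [h]

theorem expSeries_add (a b : S) : expSeries (a + b) = expSeries a * expSeries b := by
  ext n
  rw [PowerSeries.coeff_mul]
  simp only [coeff_expSeries]
  rw [(Commute.all a b).add_pow', Finset.smul_sum]
  refine Finset.sum_congr rfl fun q hq => ?_
  rw [smul_mul_smul_comm, ← Nat.cast_smul_eq_nsmul ℝ, smul_smul]
  congr 1
  have h := Finset.HasAntidiagonal.mem_antidiagonal.1 hq
  have h1 : q.1 ≤ n := by omega
  rw [← Nat.choose_mul_factorial_mul_factorial h1, show n - q.1 = q.2 by omega]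
  have h2 : (n.choose q.1 : ℝ) ≠ 0 := by exact_mod_cast (Nat.choose_pos h1).ne'
  push_cast
  field_simp

theorem expSeries_sum {κ : Type*} (s : Finset κ) (a : κ → S) :
    expSeries (∑ i ∈ s, a i) = ∏ i ∈ s, expSeries (a i) := by
  classical
  induction s using Finset.induction_on with
  | empty => simp [expSeries_zero]
  | insert i s hi ih => rw [Finset.sum_insert hi, Finset.prod_insert hi, expSeries_add, ih]

theorem map_expSeries (φ : S →ₐ[ℝ] S') (a : S) :
    PowerSeries.map (φ : S →+* S') (expSeries a) = expSeries (φ a) := by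
  ext n
  simp [coeff_expSeries]

/-- The coefficientwise extension of a derivation. -/
def mapCoeffDerivation (D : Derivation ℝ S S) : SelfDerivation ℝ⟦X⟧ S⟦X⟧ :=
  Derivation.mk'
    { toFun := mapCoeff (D : S →ₗ[ℝ] S).toAddMonoidHom
      map_add' := map_add _
      map_smul' := fun r g => by
        rw [Algebra.smul_def, algebraMap_powerSeries, mapCoeff_map_mul, RingHom.id_apply,
          Algebra.smul_def, algebraMap_powerSeries] }
    (by
      intro f g
      ext n
      change PowerSeries.coeff n (mapCoeff (D : S →ₗ[ℝ] S).toAddMonoidHom (f * g))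
        = PowerSeries.coeff n (f * mapCoeff (D : S →ₗ[ℝ] S).toAddMonoidHom g
          + g * mapCoeff (D : S →ₗ[ℝ] S).toAddMonoidHom f)
      rw [coeff_mapCoeff, map_add (PowerSeries.coeff n), mul_comm g, PowerSeries.coeff_mul, PowerSeries.coeff_mul, PowerSeries.coeff_mul,
        map_sum, ← Finset.sum_add_distrib]
      refine Finset.sum_congr rfl fun q _ => ?_
      rw [coeff_mapCoeff, coeff_mapCoeff]
      change D _ = _ * D _ + D _ * _
      rw [Derivation.leibniz, smul_eq_mul, smul_eq_mul]
      ring)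

theorem coeff_mapCoeffDerivation (D : Derivation ℝ S S) (f : S⟦X⟧) (n : ℕ) :
    PowerSeries.coeff n (mapCoeffDerivation D f) = D (PowerSeries.coeff n f) :=
  coeff_mapCoeff (D : S →ₗ[ℝ] S).toAddMonoidHom f n

theorem mapCoeffDerivation_C (D : Derivation ℝ S S) (a : S) :
    mapCoeffDerivation D (PowerSeries.C a) = PowerSeries.C (D a) := by
  ext n
  rw [coeff_mapCoeffDerivation, PowerSeries.coeff_C, PowerSeries.coeff_C]
  split_ifs <;> simp

theorem mapCoeffDerivation_expSeries (D : Derivation ℝ S S) (a : S) :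
    mapCoeffDerivation D (expSeries a) = X * PowerSeries.C (D a) * expSeries a := by
  ext n
  rw [coeff_mapCoeffDerivation, coeff_expSeries, D.map_smul, mul_assoc]
  cases n with
  | zero => simp
  | succ n =>
    rw [PowerSeries.coeff_succ_X_mul, PowerSeries.coeff_C_mul, coeff_expSeries,
      Derivation.leibniz_pow, Nat.factorial_succ, add_tsub_cancel_right, smul_eq_mul,
      ← Nat.cast_smul_eq_nsmul ℝ, smul_smul, mul_smul_comm, mul_comm (D a)]
    congr 1
    have : ((n : ℝ) + 1) ≠ 0 := by positivity
    push_cast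
    field_simp

end General

/-- The polynomial `x ^ k * log x`. -/
def tPoly (k : ℕ) : MvPolynomial Bool ℝ := MvPolynomial.X false ^ k * MvPolynomial.X true

/-- The polynomial `x ^ k`. -/
def rPoly (k : ℕ) : MvPolynomial Bool ℝ := MvPolynomial.X false ^ k

/-- The polynomial whose values are the linear statistic of `f`. -/
def statPoly (m : ℕ) (f : MvPolynomial Bool ℝ) : MvPolynomial (Fin m × Bool) ℝ :=
  ∑ i, coordEmb i f

variable {α : ℝ}

/-- The functional `f ↦ ∫ f(x) exp(X x log x) x^α e^{-x} dx`, with values in power series. -/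
def tilted (hα : -1 < α) : (MvPolynomial Bool ℝ)⟦X⟧ →ₗ[ℝ⟦X⟧] ℝ⟦X⟧ where
  toFun f := mapCoeff (halfLineIntegral hα).toAddMonoidHom (expSeries (tPoly 1) * f)
  map_add' f g := by rw [mul_add, map_add]
  map_smul' r f := by
    rw [mul_smul_comm, Algebra.smul_def, algebraMap_powerSeries, mapCoeff_map_mul,
      RingHom.id_apply, Algebra.algebraMap_self, PowerSeries.map_id, id_eq, smul_eq_mul]

theorem tilted_apply (hα : -1 < α) (f : (MvPolynomial Bool ℝ)⟦X⟧) :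
    tilted hα f = mapCoeff (halfLineIntegral hα).toAddMonoidHom (expSeries (tPoly 1) * f) := rfl

/-- The coordinate `x`, as a constant power series. -/
def xSeries : (MvPolynomial Bool ℝ)⟦X⟧ := PowerSeries.C (MvPolynomial.X false)

theorem constantCoeff_aeval_xSeries (q : Polynomial ℝ⟦X⟧) :
    PowerSeries.constantCoeff (Polynomial.aeval xSeries q)
      = Polynomial.aeval (MvPolynomial.X false : MvPolynomial Bool ℝ)
        (q.map PowerSeries.constantCoeff) := by
  rw [Polynomial.aeval_def, Polynomial.hom_eval₂, Polynomial.aeval_def, Polynomial.eval₂_map]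
  congr 1

theorem constantCoeff_tilted (hα : -1 < α) (f : (MvPolynomial Bool ℝ)⟦X⟧) :
    PowerSeries.constantCoeff (tilted hα f)
      = halfLineIntegral hα (PowerSeries.constantCoeff f) := by
  rw [← PowerSeries.coeff_zero_eq_constantCoeff_apply, tilted_apply, coeff_mapCoeff,
    PowerSeries.coeff_zero_eq_constantCoeff_apply, map_mul,
    ← PowerSeries.coeff_zero_eq_constantCoeff_apply (expSeries (tPoly 1)), coeff_expSeries]
  simp

/-- The orthogonal polynomials of the tilted weight. -/
def tiltedPoly (hα : -1 < α) : ℕ → Polynomial ℝ⟦X⟧ := orthoPoly (tilted hα) xSeries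

/-- A power series over a field is a unit as soon as its constant term is nonzero, and at `X = 0`
the squared norm is that of a nonzero polynomial for the untilted Laguerre weight. -/
theorem isOrthogonalFamily_tilted (hα : -1 < α) :
    IsOrthogonalFamily (tilted hα) xSeries (tiltedPoly hα) := by
  refine isOrthogonalFamily_orthoPoly _ _ fun q hq => ?_
  rw [PowerSeries.isUnit_iff_constantCoeff, constantCoeff_tilted, map_mul,
    constantCoeff_aeval_xSeries]
  exact (halfLineIntegral_sq_pos hα _ (hq.map _).ne_zero).ne'.isUnit

/-- The embedding of power series in one variable `x` as power series in the coordinate `x i`. -/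
def coordEmbSeries {m : ℕ} (i : Fin m) :
    (MvPolynomial Bool ℝ)⟦X⟧ →ₐ[ℝ⟦X⟧] (MvPolynomial (Fin m × Bool) ℝ)⟦X⟧ where
  toRingHom := PowerSeries.map (coordEmb i : MvPolynomial Bool ℝ →+* _)
  commutes' r := by
    ext n : 1
    simp [algebraMap_powerSeries]

theorem coordEmbSeries_C {m : ℕ} (i : Fin m) (f : MvPolynomial Bool ℝ) :
    coordEmbSeries i (PowerSeries.C f) = PowerSeries.C (coordEmb i f) :=
  PowerSeries.map_C _ _

/-- The `m`-point functional of the tilted weight. -/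
def tiltedProd (m : ℕ) (hα : -1 < α) : (MvPolynomial (Fin m × Bool) ℝ)⟦X⟧ →+ ℝ⟦X⟧ :=
  (mapCoeff (orthantIntegral m hα).toAddMonoidHom).comp
    (AddMonoidHom.mulLeft (∏ i : Fin m, PowerSeries.map (coordEmb i : MvPolynomial Bool ℝ →+* _)
      (expSeries (tPoly 1))))

theorem isProductFunctional_tilted (m : ℕ) (hα : -1 < α) :
    IsProductFunctional (fun i : Fin m => (coordEmbSeries i : _ →+* _))
      (tilted hα).toAddMonoidHom (tiltedProd m hα) :=
  (isProductFunctional_orthantIntegral m hα).powerSeries.twist (expSeries (tPoly 1))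

theorem coeff_tiltedProd_C (m : ℕ) (hα : -1 < α) (F : MvPolynomial (Fin m × Bool) ℝ) (n : ℕ) :
    PowerSeries.coeff n (tiltedProd m hα (PowerSeries.C F))
      = orthantIntegral m hα (F * statPoly m (tPoly 1) ^ n) / n.factorial := by
  have h0 : tiltedProd m hα (PowerSeries.C F) = mapCoeff (orthantIntegral m hα).toAddMonoidHom
      ((∏ i : Fin m, PowerSeries.map (coordEmb i : MvPolynomial Bool ℝ →+* _)
      (expSeries (tPoly 1))) * PowerSeries.C F) := rfl
  rw [h0, coeff_mapCoeff]
  have h : ∏ i : Fin m, PowerSeries.map (coordEmb i : MvPolynomial Bool ℝ →+* _)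
      (expSeries (tPoly 1)) = expSeries (statPoly m (tPoly 1)) := by
    rw [statPoly, expSeries_sum]
    exact Finset.prod_congr rfl fun i _ => map_expSeries _ _
  rw [h, mul_comm, PowerSeries.coeff_C_mul, coeff_expSeries, mul_smul_comm]
  rw [LinearMap.toAddMonoidHom_coe, map_smul, smul_eq_mul, div_eq_inv_mul]

/-- The generating series `E[F exp(X T)]`. -/
def momentSeries (m : ℕ) (α : ℝ) (F : MvPolynomial (Fin m × Bool) ℝ) : ℝ⟦X⟧ :=
  egf fun n => ∫ x, MvPolynomial.eval (logPoints x) (F * statPoly m (tPoly 1) ^ n) ∂(ensemble m α)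

theorem momentSeries_eq (m : ℕ) (hα : -1 < α) (F : MvPolynomial (Fin m × Bool) ℝ) :
    momentSeries m α F = PowerSeries.C (orthantIntegral m hα (vdm m ^ 2))⁻¹ *
      tiltedProd m hα (PowerSeries.C (vdm m ^ 2 * F)) := by
  ext n
  rw [PowerSeries.coeff_C_mul, coeff_tiltedProd_C, momentSeries, egf, PowerSeries.coeff_mk,
    integral_eval_ensemble hα, mul_assoc]
  ring

theorem vandermonde_coordEmbSeries (m : ℕ) :
    (Matrix.vandermonde fun i : Fin m => coordEmbSeries i xSeries).det
      = PowerSeries.C (vdm m) := by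
  rw [vdm, RingHom.map_det]
  congr 1
  ext i j : 2
  simp [xSeries, coordEmbSeries_C, Matrix.vandermonde_apply, coordEmb]

/-- `⟨f⟩`, the mean of the linear statistic of `f` under the law tilted by `exp(X T)`. -/
def tMean (hα : -1 < α) (m : ℕ) (f : MvPolynomial Bool ℝ) : ℝ⟦X⟧ :=
  opMean (tilted hα) (fun j => Polynomial.aeval xSeries (tiltedPoly hα j)) m (PowerSeries.C f)

/-- The covariance of the linear statistics of `f`, `g` under the law tilted by `exp(X T)`. -/
def tCov (hα : -1 < α) (m : ℕ) (f g : MvPolynomial Bool ℝ) : ℝ⟦X⟧ :=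
  opCov (tilted hα) (fun j => Polynomial.aeval xSeries (tiltedPoly hα j)) m (PowerSeries.C f)
    (PowerSeries.C g)

/-- The squared norm of the `n`-th orthogonal polynomial of the tilted weight. -/
def tNorm (hα : -1 < α) (n : ℕ) : ℝ⟦X⟧ :=
  tilted hα (Polynomial.aeval xSeries (tiltedPoly hα n) * Polynomial.aeval xSeries (tiltedPoly hα n))

theorem momentSeries_statPoly (m : ℕ) (hα : -1 < α) (f : MvPolynomial Bool ℝ) :
    momentSeries m α (statPoly m f) = tMean hα m f * momentSeries m α 1 := by
  have h := vandermonde_sq_mul_sum (isOrthogonalFamily_tilted hα)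
    (ι := fun i : Fin m => coordEmbSeries i) (isProductFunctional_tilted m hα) (PowerSeries.C f)
  rw [vandermonde_coordEmbSeries] at h
  simp only [coordEmbSeries_C] at h
  rw [← map_sum, ← map_pow, ← map_mul] at h
  rw [momentSeries_eq m hα, momentSeries_eq m hα, mul_one, statPoly, h, tMean]
  ring

theorem momentSeries_statPoly_mul (m : ℕ) (hα : -1 < α) (f g : MvPolynomial Bool ℝ) :
    momentSeries m α (statPoly m f * statPoly m g)
      = (tMean hα m f * tMean hα m g + tCov hα m f g) * momentSeries m α 1 := by
  have h := vandermonde_sq_mul_sum_mul_sum (isOrthogonalFamily_tilted hα)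
    (ι := fun i : Fin m => coordEmbSeries i) (isProductFunctional_tilted m hα) (PowerSeries.C f)
    (PowerSeries.C g)
  rw [vandermonde_coordEmbSeries] at h
  simp only [coordEmbSeries_C] at h
  rw [← map_sum, ← map_sum, ← map_pow, ← map_mul, ← map_mul] at h
  rw [momentSeries_eq m hα, momentSeries_eq m hα, mul_one, statPoly, statPoly, h, tMean, tMean, tCov]
  ring

theorem ecoeff_zero_momentSeries_one (m : ℕ) (hα : -1 < α) :
    ecoeff 0 (momentSeries m α 1) = 1 := by
  have := isProbabilityMeasure_ensemble m hα
  rw [momentSeries, ecoeff_egf]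
  simp

theorem ecoeff_zero (U : ℝ⟦X⟧) : ecoeff 0 U = PowerSeries.constantCoeff U := by
  simp [ecoeff]

theorem momentSeries_one_ne_zero (m : ℕ) (hα : -1 < α) : momentSeries m α 1 ≠ 0 := by
  intro h
  have h1 := ecoeff_zero_momentSeries_one m hα
  rw [h, ecoeff_zero] at h1
  simp at h1

theorem isUnit_tNorm (hα : -1 < α) (n : ℕ) : IsUnit (tNorm hα n) :=
  (isOrthogonalFamily_tilted hα).isUnit n

theorem constantCoeff_tNorm_ne_zero (hα : -1 < α) (n : ℕ) :
    PowerSeries.constantCoeff (tNorm hα n) ≠ 0 :=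
  ((isUnit_tNorm hα n).map PowerSeries.constantCoeff).ne_zero

/-- The partition function is `m! ∏ h_j`; dividing by its value at `X = 0` removes `m!` and the
normalising constant. -/
theorem momentSeries_one_eq (m : ℕ) (hα : -1 < α) :
    momentSeries m α 1 * PowerSeries.C (∏ j ∈ Finset.range m,
      PowerSeries.constantCoeff (tNorm hα j)) = ∏ j ∈ Finset.range m, tNorm hα j := by
  have h := vandermonde_sq (isOrthogonalFamily_tilted hα)
    (ι := fun i : Fin m => coordEmbSeries i) (isProductFunctional_tilted m hα)
  rw [vandermonde_coordEmbSeries, ← map_pow] at h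
  have h1 := momentSeries_eq m hα 1
  rw [mul_one, h] at h1
  change _ = _ * (_ * ∏ j ∈ Finset.range m, tNorm hα j) at h1
  rw [show ((m.factorial : ℕ) : ℝ⟦X⟧) = PowerSeries.C (m.factorial : ℝ) by simp, ← mul_assoc,
    ← map_mul] at h1
  have h2 := congrArg PowerSeries.constantCoeff h1
  rw [← ecoeff_zero, ecoeff_zero_momentSeries_one m hα, map_mul, PowerSeries.constantCoeff_C,
    map_prod] at h2
  rw [h1, mul_right_comm, ← map_mul, ← h2, map_one, one_mul]

theorem momentSeries_one_succ (n : ℕ) (hα : -1 < α) :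
    momentSeries (n + 1) α 1
      = PowerSeries.C (PowerSeries.constantCoeff (tNorm hα n))⁻¹ * tNorm hα n *
        momentSeries n α 1 := by
  have h1 := momentSeries_one_eq n hα
  have h2 := momentSeries_one_eq (n + 1) hα
  rw [Finset.prod_range_succ, Finset.prod_range_succ, ← h1, map_mul] at h2
  have h3 : (PowerSeries.C (∏ j ∈ Finset.range n,
      PowerSeries.constantCoeff (tNorm hα j)) : ℝ⟦X⟧) ≠ 0 := by
    rw [Ne, map_eq_zero_iff _ PowerSeries.C_injective, Finset.prod_eq_zero_iff]
    push Not
    exact fun j _ => constantCoeff_tNorm_ne_zero hα j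
  have h4 : (PowerSeries.C (PowerSeries.constantCoeff (tNorm hα n))⁻¹ : ℝ⟦X⟧) *
      PowerSeries.C (PowerSeries.constantCoeff (tNorm hα n)) = 1 := by
    rw [← map_mul, inv_mul_cancel₀ (constantCoeff_tNorm_ne_zero hα n), map_one]
  apply mul_right_cancel₀ h3
  linear_combination PowerSeries.C (PowerSeries.constantCoeff (tNorm hα n))⁻¹ * h2
    - momentSeries (n + 1) α 1 * PowerSeries.C (∏ j ∈ Finset.range n,
      PowerSeries.constantCoeff (tNorm hα j)) * h4

theorem derivative_momentSeries (m : ℕ) (α : ℝ) (F : MvPolynomial (Fin m × Bool) ℝ) :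
    PowerSeries.derivative ℝ (momentSeries m α F)
      = momentSeries m α (F * statPoly m (tPoly 1)) := by
  ext n
  have h : (n.factorial : ℝ) ≠ 0 := by positivity
  apply mul_left_cancel₀ h
  change ecoeff n _ = ecoeff n _
  rw [← ecoeff_succ, momentSeries, momentSeries, ecoeff_egf, ecoeff_egf, pow_succ', mul_assoc]

theorem derivative_momentSeries_one (m : ℕ) (hα : -1 < α) :
    PowerSeries.derivative ℝ (momentSeries m α 1) = tMean hα m (tPoly 1) * momentSeries m α 1 := by
  rw [derivative_momentSeries, one_mul, momentSeries_statPoly m hα]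

/-- Differentiating the quotient `E[f exp(XT)] / E[exp(XT)]` in the tilting variable gives the
covariance with `T`. -/
theorem derivative_tMean (m : ℕ) (hα : -1 < α) (f : MvPolynomial Bool ℝ) :
    PowerSeries.derivative ℝ (tMean hα m f) = tCov hα m f (tPoly 1) := by
  have h := congrArg (PowerSeries.derivative ℝ) (momentSeries_statPoly m hα f)
  rw [derivative_momentSeries, momentSeries_statPoly_mul m hα, Derivation.leibniz,
    derivative_momentSeries_one m hα, smul_eq_mul, smul_eq_mul] at h
  apply mul_right_cancel₀ (momentSeries_one_ne_zero m hα)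
  linear_combination -h

theorem tMean_succ_sub (n : ℕ) (hα : -1 < α) (f : MvPolynomial Bool ℝ) :
    tMean hα (n + 1) f - tMean hα n f = Ring.inverse (tNorm hα n) *
      tilted hα (Polynomial.aeval xSeries (tiltedPoly hα n) ^ 2 * PowerSeries.C f) := by
  rw [pow_two]
  exact opMean_succ_sub _ _ _ _

theorem tMean_add (hα : -1 < α) (m : ℕ) (f g : MvPolynomial Bool ℝ) :
    tMean hα m (f + g) = tMean hα m f + tMean hα m g := by
  rw [tMean, map_add, opMean_add]; rfl

theorem C_smul_eq (c : ℝ) (f : MvPolynomial Bool ℝ) :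
    (PowerSeries.C (c • f) : (MvPolynomial Bool ℝ)⟦X⟧)
      = (PowerSeries.C c : ℝ⟦X⟧) • PowerSeries.C f := by
  rw [Algebra.smul_def c f, Algebra.smul_def (PowerSeries.C c : ℝ⟦X⟧), algebraMap_powerSeries,
    PowerSeries.map_C, ← map_mul]

theorem tMean_smul (hα : -1 < α) (m : ℕ) (c : ℝ) (f : MvPolynomial Bool ℝ) :
    tMean hα m (c • f) = PowerSeries.C c * tMean hα m f := by
  rw [tMean, C_smul_eq, opMean_smul]; rfl

theorem tCov_add_right (hα : -1 < α) (m : ℕ) (f g g' : MvPolynomial Bool ℝ) :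
    tCov hα m f (g + g') = tCov hα m f g + tCov hα m f g' := by
  rw [tCov, map_add, opCov_add_right]; rfl

/-- The loop equation for the derivation `x d/dx`. -/
theorem tMean_eulerDerivation (hα : -1 < α) (m : ℕ) (f : MvPolynomial Bool ℝ) :
    tMean hα m (eulerDerivation f) + X * tCov hα m f (eulerDerivation (tPoly 1))
      = tCov hα m f (MvPolynomial.X false) := by
  set D := mapCoeffDerivation eulerDerivation with hD
  have hp := isOrthogonalFamily_tilted hα
  have hDx : D xSeries = xSeries := by
    rw [hD, xSeries, mapCoeffDerivation_C]
    simp [eulerDerivation, MvPolynomial.mkDerivation_X]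
  -- `y = x - (α + 1) - X x (x log x)'` is minus `x` times the logarithmic derivative of `x` times
  -- the tilted weight. Its constant part has zero covariance with every statistic.
  set y : (MvPolynomial Bool ℝ)⟦X⟧ := xSeries + (PowerSeries.C (-(α + 1)) : ℝ⟦X⟧) • 1
    + (-X : ℝ⟦X⟧) • PowerSeries.C (eulerDerivation (tPoly 1)) with hy
  have hX : (X : ℝ⟦X⟧) • (PowerSeries.C (eulerDerivation (tPoly 1)) : (MvPolynomial Bool ℝ)⟦X⟧)
      = X * PowerSeries.C (eulerDerivation (tPoly 1)) := by
    rw [Algebra.smul_def, algebraMap_powerSeries, PowerSeries.map_X]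
  have hLD : ∀ g : (MvPolynomial Bool ℝ)⟦X⟧,
      mapCoeff (halfLineIntegral hα).toAddMonoidHom (D g)
      = mapCoeff (halfLineIntegral hα).toAddMonoidHom
        (PowerSeries.C (MvPolynomial.X false - MvPolynomial.C (α + 1)) * g) := by
    intro g
    ext n
    rw [coeff_mapCoeff, coeff_mapCoeff, hD, coeff_mapCoeffDerivation, PowerSeries.coeff_C_mul]
    exact halfLineIntegral_eulerDerivation hα _
  have key : ∀ g, tilted hα (D g) = tilted hα (y * g) := by
    intro g
    have h1 : expSeries (tPoly 1) * D g = D (expSeries (tPoly 1) * g)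
        - X * PowerSeries.C (eulerDerivation (tPoly 1)) * expSeries (tPoly 1) * g := by
      rw [Derivation.leibniz, hD, mapCoeffDerivation_expSeries, smul_eq_mul, smul_eq_mul]
      ring
    rw [tilted_apply, tilted_apply, h1, map_sub, hLD, ← map_sub]
    congr 1
    rw [hy, neg_smul, hX, Algebra.smul_def, algebraMap_powerSeries, PowerSeries.map_C, map_sub,
      map_neg, map_neg, xSeries]
    change (_ - PowerSeries.C (algebraMap ℝ (MvPolynomial Bool ℝ) (α + 1))) * _ - _ = _
    ring
  have h := hp.opMean_derivation m D hDx key (PowerSeries.C f)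
  rw [hD, mapCoeffDerivation_C, hy, opCov_add_right, opCov_add_right, opCov_smul_right,
    opCov_smul_right, hp.opCov_one_right, mul_zero, add_zero] at h
  rw [tMean, h, tCov, tCov, xSeries]
  ring

/-- The covariance with the statistic of `x` is a pairing of consecutive orthogonal polynomials. -/
theorem tCov_x (hα : -1 < α) (n : ℕ) (f : MvPolynomial Bool ℝ) :
    tCov hα (n + 1) f (MvPolynomial.X false) = Ring.inverse (tNorm hα n) *
      tilted hα (Polynomial.aeval xSeries (tiltedPoly hα (n + 1)) *
        Polynomial.aeval xSeries (tiltedPoly hα n) * PowerSeries.C f) :=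
  (isOrthogonalFamily_tilted hα).opCov_x n (PowerSeries.C f)

theorem tCov_sub_tCov (hα : -1 < α) (n k : ℕ) :
    tCov hα (n + 1) (tPoly k) (tPoly 1) - tCov hα (n + 1) (tPoly (k + 1)) (tPoly 0)
      = ∑ r ∈ Finset.range k, (Ring.inverse (tNorm hα n) ^ 2 *
        (tilted hα (Polynomial.aeval xSeries (tiltedPoly hα (n + 1)) ^ 2 * PowerSeries.C (tPoly r)) *
          tilted hα (Polynomial.aeval xSeries (tiltedPoly hα n) ^ 2 *
            PowerSeries.C (tPoly (k - r - 1))))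
        - tCov hα (n + 1) (tPoly r) (MvPolynomial.X false) *
          tCov hα (n + 1) (tPoly (k - r - 1)) (MvPolynomial.X false)) := by
  have h := (isOrthogonalFamily_tilted hα).opCov_sub_opCov n k (PowerSeries.C (MvPolynomial.X true))
  have ht : ∀ j, xSeries ^ j * PowerSeries.C (MvPolynomial.X true) = PowerSeries.C (tPoly j) := by
    intro j
    rw [xSeries, tPoly, map_mul, map_pow]
  have ht1 : xSeries * PowerSeries.C (MvPolynomial.X true) = PowerSeries.C (tPoly 1) := by
    rw [← ht, pow_one]
  have ht0 : (PowerSeries.C (MvPolynomial.X true) : (MvPolynomial Bool ℝ)⟦X⟧)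
      = PowerSeries.C (tPoly 0) := by
    rw [← ht, pow_zero, one_mul]
  simp only [ht, ht1] at h
  rw [ht0] at h
  refine h.trans ?_
  rw [Finset.mul_sum]
  refine Finset.sum_congr rfl fun r _ => ?_
  rw [tCov_x, tCov_x]
  change Ring.inverse (tNorm hα n) ^ 2 * _ = _
  ring

/-- At `X = 0` the loop equation for `f = x` reads `⟨x⟩ = Cov(x, x)`, and this covariance is `L(x
p_n p_{n+1}) / h_n = h_{n+1} / h_n`. It supplies the factor `κ(R)`. -/
theorem constantCoeff_tMean_x (hα : -1 < α) (n : ℕ) :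
    PowerSeries.constantCoeff (tMean hα (n + 1) (MvPolynomial.X false))
      = PowerSeries.constantCoeff (tNorm hα (n + 1)) *
        (PowerSeries.constantCoeff (tNorm hα n))⁻¹ := by
  have h := tMean_eulerDerivation hα (n + 1) (MvPolynomial.X false)
  rw [show eulerDerivation (MvPolynomial.X false) = MvPolynomial.X false by
    simp [eulerDerivation, MvPolynomial.mkDerivation_X], tCov_x] at h
  have h1 := (isOrthogonalFamily_tilted hα).apply_mul_succ n
  rw [show Polynomial.aeval xSeries (tiltedPoly hα (n + 1)) *
    Polynomial.aeval xSeries (tiltedPoly hα n) * PowerSeries.C (MvPolynomial.X false)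
    = xSeries * Polynomial.aeval xSeries (tiltedPoly hα n) *
      Polynomial.aeval xSeries (tiltedPoly hα (n + 1)) by rw [xSeries]; ring, h1] at h
  change _ = _ * tNorm hα (n + 1) at h
  have h2 := congrArg PowerSeries.constantCoeff h
  rw [map_add, map_mul, PowerSeries.constantCoeff_X, zero_mul, add_zero, map_mul] at h2
  have h3 : PowerSeries.constantCoeff (Ring.inverse (tNorm hα n))
      = (PowerSeries.constantCoeff (tNorm hα n))⁻¹ := by
    apply eq_inv_of_mul_eq_one_left
    rw [← map_mul, Ring.inverse_mul_cancel _ (isUnit_tNorm hα n), map_one]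
  rw [h2, h3, mul_comm]

end Tilted

/-! ### Identification of the cumulants, of `H`, `h`, `D`, and of the derivative in `α` -/

section Cumulants

open Filter Topology

theorem ecoeff_add (n : ℕ) (U V : PowerSeries ℝ) : ecoeff n (U + V) = ecoeff n U + ecoeff n V := by
  simp [ecoeff, mul_add]

theorem ecoeff_sub (n : ℕ) (U V : PowerSeries ℝ) : ecoeff n (U - V) = ecoeff n U - ecoeff n V := by
  simp [ecoeff, mul_sub]

theorem ecoeff_neg (n : ℕ) (U : PowerSeries ℝ) : ecoeff n (-U) = -ecoeff n U := by
  simp [ecoeff]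

theorem ecoeff_C_mul (n : ℕ) (c : ℝ) (U : PowerSeries ℝ) :
    ecoeff n (PowerSeries.C c * U) = c * ecoeff n U := by
  rw [ecoeff, PowerSeries.coeff_C_mul, ecoeff]
  ring

theorem ecoeff_X_mul (n : ℕ) (U : PowerSeries ℝ) :
    ecoeff n (PowerSeries.X * U) = n * ecoeff (n - 1) U := by
  cases n with
  | zero => simp [ecoeff]
  | succ n =>
    rw [ecoeff, PowerSeries.coeff_succ_X_mul, ecoeff, Nat.factorial_succ, add_tsub_cancel_right]
    push_cast
    ring

theorem ecoeff_sum {κ : Type*} (n : ℕ) (s : Finset κ) (U : κ → PowerSeries ℝ) :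
    ecoeff n (∑ i ∈ s, U i) = ∑ i ∈ s, ecoeff n (U i) := by
  simp [ecoeff, map_sum, Finset.mul_sum]

variable {m : ℕ} {α : ℝ}

/-- On the positive half-line `f` is the polynomial `g` in `x` and `log x`. -/
def Represents (f : ℝ → ℝ) (g : MvPolynomial Bool ℝ) : Prop :=
  ∀ x, 0 < x → f x = MvPolynomial.eval (logPoint x) g

theorem represents_tFun (k : ℕ) : Represents (tFun k) (tPoly k) := by
  intro x _
  simp [tFun, tPoly, logPoint]

theorem represents_rFun (k : ℕ) : Represents (rFun k) (rPoly k) := by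
  intro x _
  simp [rFun, rPoly, logPoint]

theorem Represents.euler {f : ℝ → ℝ} {g : MvPolynomial Bool ℝ} (h : Represents f g) :
    Represents (fun x => x * deriv f x) (eulerDerivation g) := by
  intro x hx
  -- The representation holds only for positive arguments, but these form a neighbourhood of `x`,
  -- which is all that `deriv` sees.
  have h1 : f =ᶠ[𝓝 x] fun y => MvPolynomial.eval (logPoint y) g := by
    filter_upwards [lt_mem_nhds hx] with y hy
    exact h y hy
  simp only
  rw [((hasDerivAt_eval_logPoint g hx).congr_of_eventuallyEq h1).deriv, mul_div_cancel₀ _ hx.ne']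

theorem eulerDerivation_tPoly (k : ℕ) : eulerDerivation (tPoly k) = (k : ℝ) • tPoly k + rPoly k := by
  have h1 : eulerDerivation (MvPolynomial.X false) = MvPolynomial.X false := by
    simp [eulerDerivation, MvPolynomial.mkDerivation_X]
  have h2 : eulerDerivation (MvPolynomial.X true) = 1 := by
    simp [eulerDerivation, MvPolynomial.mkDerivation_X]
  rw [tPoly, rPoly, Derivation.leibniz, Derivation.leibniz_pow, h1, h2, Nat.cast_smul_eq_nsmul]
  simp only [smul_eq_mul, nsmul_eq_mul, mul_one]
  cases k with
  | zero => simp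
  | succ k => rw [add_tsub_cancel_right]; ring

theorem linStat_eq_eval {f : ℝ → ℝ} {g : MvPolynomial Bool ℝ} (h : Represents f g)
    {x : Fin m → ℝ} (hx : ∀ i, 0 < x i) :
    linStat m f x = MvPolynomial.eval (logPoints x) (statPoly m g) := by
  simp only [linStat, statPoly, map_sum, eval_coordEmb]
  exact Finset.sum_congr rfl fun i _ => h _ (hx i)

theorem ae_pos_ensemble (m : ℕ) (α : ℝ) : ∀ᵐ x ∂(ensemble m α), ∀ i, 0 < x i := by
  have h : ensemble m α ≪ orthant m := by
    rw [ensemble]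
    refine Measure.smul_absolutelyContinuous.trans ?_
    rw [weightMeasure_eq]
    exact withDensity_absolutelyContinuous _ _
  exact h.ae_le (ae_pos_orthant m)

theorem memLp_linStat (hα : -1 < α) {f : ℝ → ℝ} {g : MvPolynomial Bool ℝ} (h : Represents f g)
    {p : ENNReal} (hp : p ≠ ⊤) : MemLp (linStat m f) p (ensemble m α) := by
  refine (memLp_congr_ae ?_).2 (memLp_eval_ensemble hα (statPoly m g) hp)
  filter_upwards [ae_pos_ensemble m α] with x hx
  exact linStat_eq_eval h hx

theorem prod_linStat_eq_pow {κ : Type*} {f : κ → ℝ → ℝ} {B : Finset κ}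
    (h : ∀ j ∈ B, Represents (f j) (tPoly 1)) {x : Fin m → ℝ} (hx : ∀ i, 0 < x i) :
    ∏ j ∈ B, linStat m (f j) x
      = MvPolynomial.eval (logPoints x) (statPoly m (tPoly 1) ^ B.card) := by
  rw [map_pow, ← Finset.prod_const]
  exact Finset.prod_congr rfl fun j hj => linStat_eq_eval (h j hj) hx

variable {κ : Type*} [DecidableEq κ]

/-- The joint cumulant of `X, T, …, T` as a coefficient of the tilted mean of `X`. -/
theorem cumulant_insert_eq (hα : -1 < α) {f : κ → ℝ → ℝ} {g : MvPolynomial Bool ℝ} {a : κ}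
    {s : Finset κ} (ha : a ∉ s) (hg : Represents (f a) g)
    (hs : ∀ j ∈ s, Represents (f j) (tPoly 1)) :
    cumulant m α f (insert a s) = ecoeff s.card (tMean hα m g) := by
  refine setCumulant_insert_eq_ecoeff
    (fun P => ∫ x, ∏ j ∈ P, linStat m (f j) x ∂(ensemble m α)) ha
    (ecoeff_zero_momentSeries_one m hα) (fun B hB => ?_) (fun B hB => ?_)
    (momentSeries_statPoly m hα g)
  · rw [momentSeries, ecoeff_egf, one_mul]
    refine integral_congr_ae ?_
    filter_upwards [ae_pos_ensemble m α] with x hx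
    exact prod_linStat_eq_pow (fun j hj => hs j (hB hj)) hx
  · rw [momentSeries, ecoeff_egf]
    refine integral_congr_ae ?_
    filter_upwards [ae_pos_ensemble m α] with x hx
    rw [Finset.prod_insert fun h => ha (hB h), map_mul, linStat_eq_eval hg hx,
      prod_linStat_eq_pow (fun j hj => hs j (hB hj)) hx]

/-- The joint cumulant of `X, Y, T, …, T` as a coefficient of the tilted covariance of `X, Y`. -/
theorem cumulant_insert_insert_eq (hα : -1 < α) {f : κ → ℝ → ℝ} {g g' : MvPolynomial Bool ℝ}
    {a b : κ} {s : Finset κ} (hab : a ≠ b) (ha : a ∉ s) (hb : b ∉ s) (hg : Represents (f a) g)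
    (hg' : Represents (f b) g') (hs : ∀ j ∈ s, Represents (f j) (tPoly 1)) :
    cumulant m α f (insert a (insert b s)) = ecoeff s.card (tCov hα m g g') := by
  refine setCumulant_insert_insert_eq_ecoeff
    (fun P => ∫ x, ∏ j ∈ P, linStat m (f j) x ∂(ensemble m α)) hab ha hb
    (ecoeff_zero_momentSeries_one m hα) (EX := momentSeries m α (statPoly m g))
    (EY := momentSeries m α (statPoly m g'))
    (EXY := momentSeries m α (statPoly m g * statPoly m g')) (U := tMean hα m g)
    (fun B hB => ?_) (fun B hB => ?_) (fun B hB => ?_) (fun B hB => ?_)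
    (momentSeries_statPoly m hα g) ?_
  · rw [momentSeries, ecoeff_egf, one_mul]
    refine integral_congr_ae ?_
    filter_upwards [ae_pos_ensemble m α] with x hx
    exact prod_linStat_eq_pow (fun j hj => hs j (hB hj)) hx
  · rw [momentSeries, ecoeff_egf]
    refine integral_congr_ae ?_
    filter_upwards [ae_pos_ensemble m α] with x hx
    rw [Finset.prod_insert fun h => ha (hB h), map_mul, linStat_eq_eval hg hx,
      prod_linStat_eq_pow (fun j hj => hs j (hB hj)) hx]
  · rw [momentSeries, ecoeff_egf]
    refine integral_congr_ae ?_
    filter_upwards [ae_pos_ensemble m α] with x hx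
    rw [Finset.prod_insert fun h => hb (hB h), map_mul, linStat_eq_eval hg' hx,
      prod_linStat_eq_pow (fun j hj => hs j (hB hj)) hx]
  · rw [momentSeries, ecoeff_egf]
    refine integral_congr_ae ?_
    filter_upwards [ae_pos_ensemble m α] with x hx
    rw [Finset.prod_insert (by simpa [hab] using fun h => ha (hB h)),
      Finset.prod_insert fun h => hb (hB h), map_mul, map_mul, linStat_eq_eval hg hx,
      linStat_eq_eval hg' hx, prod_linStat_eq_pow (fun j hj => hs j (hB hj)) hx]
    ring
  · rw [momentSeries_statPoly_mul m hα, momentSeries_statPoly m hα]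
    ring

theorem univ_eq_insert_zero (n : ℕ) :
    (Finset.univ : Finset (Fin (n + 1))) = insert 0 (Finset.univ.erase 0) :=
  (Finset.insert_erase (Finset.mem_univ _)).symm

theorem card_univ_erase_zero (n : ℕ) :
    ((Finset.univ : Finset (Fin (n + 1))).erase 0).card = n := by
  rw [Finset.card_erase_of_mem (Finset.mem_univ _), Finset.card_univ, Fintype.card_fin]
  rfl

theorem withT_zero (f : ℝ → ℝ) (n : ℕ) : withT f (n + 1) 0 = f := by
  simp [withT]

theorem withT_of_ne_zero (f : ℝ → ℝ) (n : ℕ) {j : Fin (n + 1)} (hj : j ≠ 0) :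
    withT f (n + 1) j = tFun 1 := by
  have : (j : ℕ) ≠ 0 := fun h => hj (Fin.ext h)
  simp [withT, this]

theorem represents_withT_of_ne_zero (f : ℝ → ℝ) (n : ℕ) {j : Fin (n + 1)} (hj : j ≠ 0) :
    Represents (withT f (n + 1) j) (tPoly 1) := by
  rw [withT_of_ne_zero f n hj]
  exact represents_tFun 1

theorem kappa_withT (hα : -1 < α) {f : ℝ → ℝ} {g : MvPolynomial Bool ℝ} (h : Represents f g)
    (n : ℕ) : kappa m α (withT f (n + 1)) = ecoeff n (tMean hα m g) := by
  rw [kappa, univ_eq_insert_zero, cumulant_insert_eq hα (g := g) (Finset.notMem_erase _ _)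
    (by rwa [withT_zero]), card_univ_erase_zero]
  intro j hj
  exact represents_withT_of_ne_zero f n (Finset.ne_of_mem_erase hj)

/-- The partition sum of the differences of the cumulants for two numbers of points. -/
theorem partitionSum_cumulant_sub (hα : -1 < α) {f : ℝ → ℝ} {g : MvPolynomial Bool ℝ}
    (h : Represents f g) (n a b : ℕ) {G : PowerSeries ℝ}
    (hG : momentSeries a α 1 = G * momentSeries b α 1) :
    partitionSum (fun p => cumulant a α (withT f (n + 1)) p - cumulant b α (withT f (n + 1)) p)
        Finset.univ
      = ecoeff n ((tMean hα a g - tMean hα b g) * G) := by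
  have hG0 : ecoeff 0 G = 1 := by
    have h1 := congrArg PowerSeries.constantCoeff hG
    rw [map_mul, ← ecoeff_zero, ← ecoeff_zero, ← ecoeff_zero, ecoeff_zero_momentSeries_one a hα,
      ecoeff_zero_momentSeries_one b hα, mul_one] at h1
    exact h1.symm
  -- The logarithmic derivative of the ratio `G` is the difference of the tilted means of `T`, as
  -- the exponential formula requires.
  have hG' : PowerSeries.derivative ℝ G
      = (tMean hα a (tPoly 1) - tMean hα b (tPoly 1)) * G := by
    have h1 := congrArg (PowerSeries.derivative ℝ) hG
    rw [Derivation.leibniz, derivative_momentSeries_one a hα, derivative_momentSeries_one b hα,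
      smul_eq_mul, smul_eq_mul, hG] at h1
    apply mul_right_cancel₀ (momentSeries_one_ne_zero b hα)
    linear_combination -h1
  rw [univ_eq_insert_zero, partitionSum_insert_eq_ecoeff _ hG0 hG' (Finset.notMem_erase _ _)
    (V := tMean hα a g - tMean hα b g), card_univ_erase_zero]
  · intro c A hc hA
    have hr : ∀ j ∈ insert c A, Represents (withT f (n + 1) j) (tPoly 1) := fun j hj =>
      represents_withT_of_ne_zero f n (Finset.ne_of_mem_erase (hA hj))
    rw [cumulant_insert_eq hα hc (hr c (Finset.mem_insert_self c A))
        (fun j hj => hr j (Finset.mem_insert_of_mem hj)),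
      cumulant_insert_eq hα hc (hr c (Finset.mem_insert_self c A))
        (fun j hj => hr j (Finset.mem_insert_of_mem hj)), ecoeff_sub]
  · intro A hA
    have h0 : (0 : Fin (n + 1)) ∉ A := fun h => Finset.notMem_erase _ _ (hA h)
    have hr : ∀ j ∈ A, Represents (withT f (n + 1) j) (tPoly 1) := fun j hj =>
      represents_withT_of_ne_zero f n (Finset.ne_of_mem_erase (hA hj))
    rw [cumulant_insert_eq hα h0 (g := g) (by rwa [withT_zero]) hr,
      cumulant_insert_eq hα h0 (g := g) (by rwa [withT_zero]) hr, ecoeff_sub]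

/-- The exponential formula gives `(⟨g⟩⁺ - ⟨g⟩) h_m(X) / h_m(0)`, and the factor `h_m(X)` cancels
the norm in the increment of the mean. -/
theorem bigH_withT (hα : -1 < α) {f : ℝ → ℝ} {g : MvPolynomial Bool ℝ} (h : Represents f g)
    (n : ℕ) :
    bigH m α (withT f (n + 1)) = ecoeff n
      (PowerSeries.C (PowerSeries.constantCoeff (tNorm hα m))⁻¹ *
        tilted hα (Polynomial.aeval xSeries (tiltedPoly hα m) ^ 2 * PowerSeries.C g)) := by
  have h1 := partitionSum_cumulant_sub hα h n (m + 1) m (momentSeries_one_succ m hα)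
  refine Eq.trans h1 ?_
  rw [tMean_succ_sub]
  congr 1
  linear_combination (PowerSeries.C (PowerSeries.constantCoeff (tNorm hα m))⁻¹ *
    tilted hα (Polynomial.aeval xSeries (tiltedPoly hα m) ^ 2 * PowerSeries.C g)) *
    Ring.inverse_mul_cancel _ (isUnit_tNorm hα m)

/-- Here the ratio of moment series is inverted, so the factor `h_m(0) / h_m(X)` adds a second
inverse norm to the one in the increment. -/
theorem smallH_withT (hα : -1 < α) {f : ℝ → ℝ} {g : MvPolynomial Bool ℝ} (h : Represents f g)
    (n : ℕ) :
    smallH (m + 1) α (withT f (n + 1)) = ecoeff n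
      (PowerSeries.C (PowerSeries.constantCoeff (tNorm hα m)) *
        (Ring.inverse (tNorm hα m) ^ 2 *
        tilted hα (Polynomial.aeval xSeries (tiltedPoly hα m) ^ 2 * PowerSeries.C g))) := by
  have hc : (PowerSeries.C (PowerSeries.constantCoeff (tNorm hα m)) : PowerSeries ℝ) *
      PowerSeries.C (PowerSeries.constantCoeff (tNorm hα m))⁻¹ = 1 := by
    rw [← map_mul, mul_inv_cancel₀ (constantCoeff_tNorm_ne_zero hα m), map_one]
  have hG : momentSeries m α 1 = PowerSeries.C (PowerSeries.constantCoeff (tNorm hα m)) *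
      Ring.inverse (tNorm hα m) * momentSeries (m + 1) α 1 := by
    rw [momentSeries_one_succ m hα]
    linear_combination (-momentSeries m α 1 * Ring.inverse (tNorm hα m) * tNorm hα m) * hc
      - momentSeries m α 1 * Ring.inverse_mul_cancel _ (isUnit_tNorm hα m)
  have h1 := partitionSum_cumulant_sub hα h n m (m + 1) hG
  refine Eq.trans (congrArg Neg.neg h1) ?_
  have h2 := tMean_succ_sub m hα g
  rw [← ecoeff_neg]
  congr 1
  linear_combination (PowerSeries.C (PowerSeries.constantCoeff (tNorm hα m)) *
      Ring.inverse (tNorm hα m)) * h2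

/-- Differentiating the first entry gives `⟨x g'⟩`; each of the other `n` entries gives the
coefficient of order `n - 1` of `Cov(g, x (x log x)')`, so together they form `X Cov`. The sum is
one side of the loop equation. -/
theorem bigD_withT (hα : -1 < α) {f : ℝ → ℝ} {g : MvPolynomial Bool ℝ} (h : Represents f g)
    (n : ℕ) :
    bigD m α (withT f (n + 1)) = ecoeff n (tCov hα m g (MvPolynomial.X false)) := by
  have h0 : kappa m α (Function.update (withT f (n + 1)) 0
      fun x => x * deriv (withT f (n + 1) 0) x) = ecoeff n (tMean hα m (eulerDerivation g)) := by
    rw [kappa, univ_eq_insert_zero, cumulant_insert_eq hα (g := eulerDerivation g)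
      (Finset.notMem_erase _ _), card_univ_erase_zero]
    · rw [Function.update_self, withT_zero]
      exact h.euler
    · intro j hj
      rw [Function.update_of_ne (Finset.ne_of_mem_erase hj)]
      exact represents_withT_of_ne_zero f n (Finset.ne_of_mem_erase hj)
  have hj : ∀ i : Fin n, kappa m α (Function.update (withT f (n + 1)) i.succ
      fun x => x * deriv (withT f (n + 1) i.succ) x)
      = ecoeff (n - 1) (tCov hα m g (eulerDerivation (tPoly 1))) := by
    intro i
    have hi : i.succ ≠ 0 := Fin.succ_ne_zero i
    have hu : (Finset.univ : Finset (Fin (n + 1)))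
        = insert 0 (insert i.succ ((Finset.univ.erase 0).erase i.succ)) := by
      rw [Finset.insert_erase (Finset.mem_erase.2 ⟨hi, Finset.mem_univ _⟩),
        ← univ_eq_insert_zero]
    have hc : (((Finset.univ : Finset (Fin (n + 1))).erase 0).erase i.succ).card = n - 1 := by
      rw [Finset.card_erase_of_mem (Finset.mem_erase.2 ⟨hi, Finset.mem_univ _⟩),
        card_univ_erase_zero]
    rw [kappa, hu, cumulant_insert_insert_eq hα (g := g) (g' := eulerDerivation (tPoly 1)) hi.symm
      (by simp) (Finset.notMem_erase _ _), hc]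
    · rw [Function.update_of_ne hi.symm, withT_zero]
      exact h
    · rw [Function.update_self]
      exact (represents_withT_of_ne_zero f n hi).euler
    · intro j hj
      rw [Finset.mem_erase, Finset.mem_erase] at hj
      rw [Function.update_of_ne hj.1]
      exact represents_withT_of_ne_zero f n hj.2.1
  rw [bigD, Fin.sum_univ_succ, h0, Finset.sum_congr rfl fun i _ => hj i, Finset.sum_const,
    Finset.card_univ, Fintype.card_fin, nsmul_eq_mul, ← ecoeff_X_mul, ← ecoeff_add,
    tMean_eulerDerivation]

/-- Differentiation of a quotient of exponential generating series with respect to a parameter. -/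
theorem hasDerivAt_of_egf_mul {u v w : ℕ → ℝ → ℝ} {U U' V V' W' : PowerSeries ℝ}
    (hw : ∀ n, HasDerivAt (w n) (ecoeff n W') α) (hv : ∀ n, HasDerivAt (v n) (ecoeff n V') α)
    (hU : ∀ n, u n α = ecoeff n U) (hV : ∀ n, v n α = ecoeff n V)
    (hv0 : ∀ᶠ a in 𝓝 α, v 0 a = 1)
    (hmul : ∀ n, ∀ᶠ a in 𝓝 α,
      w n a = ∑ j ∈ Finset.range (n + 1), (n.choose j : ℝ) * (u j a * v (n - j) a))
    (hd : W' = U' * V + U * V') (n : ℕ) : HasDerivAt (u n) (ecoeff n U') α := by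
  have hV0 : ecoeff 0 V = 1 := by rw [← hV]; exact hv0.self_of_nhds
  have hV'0 : ecoeff 0 V' = 0 :=
    (hv 0).unique ((hasDerivAt_const α (1 : ℝ)).congr_of_eventuallyEq hv0)
  induction n using Nat.strong_induction_on with
  | _ n ih =>
    -- The top coefficient `u n` is isolated from the convolution, where it is multiplied by `v 0 =
    -- 1`; the rest is known by induction.
    have h1 : HasDerivAt
        (fun a => w n a - ∑ j ∈ Finset.range n, (n.choose j : ℝ) * (u j a * v (n - j) a))
        (ecoeff n W' - ∑ j ∈ Finset.range n, (n.choose j : ℝ) *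
          (ecoeff j U' * v (n - j) α + u j α * ecoeff (n - j) V')) α := by
      refine (hw n).sub (HasDerivAt.fun_sum fun j hj => ?_)
      exact ((ih j (Finset.mem_range.1 hj)).mul (hv (n - j))).const_mul _
    have h2 : u n =ᶠ[𝓝 α]
        fun a => w n a - ∑ j ∈ Finset.range n, (n.choose j : ℝ) * (u j a * v (n - j) a) := by
      filter_upwards [hmul n, hv0] with a ha hva
      rw [ha, Finset.sum_range_succ, Nat.choose_self, Nat.sub_self, hva]
      push_cast
      ring
    refine (h1.congr_of_eventuallyEq h2).congr_deriv ?_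
    rw [hd, ecoeff_add, ecoeff_mul, ecoeff_mul, Finset.sum_range_succ, Finset.sum_range_succ,
      Nat.choose_self, Nat.sub_self, hV0, hV'0]
    simp only [hU, hV, mul_add, Finset.sum_add_distrib]
    push_cast
    ring

theorem sumLog_eq_statPoly (m : ℕ) : sumLog m = statPoly m (tPoly 0) := by
  simp [sumLog, statPoly, tPoly, coordEmb]

theorem hasDerivAt_ecoeff_momentSeries (hα : -1 < α) (F : MvPolynomial (Fin m × Bool) ℝ) (n : ℕ) :
    HasDerivAt (fun a => ecoeff n (momentSeries m a F))
      (ecoeff n (momentSeries m α (F * statPoly m (tPoly 0)) - momentSeries m α F *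
        PowerSeries.C (∫ x, MvPolynomial.eval (logPoints x) (sumLog m) ∂(ensemble m α)))) α := by
  have h := hasDerivAt_integral_ensemble hα (F * statPoly m (tPoly 1) ^ n)
  rw [ecoeff_sub, mul_comm (momentSeries m α F), ecoeff_C_mul]
  simp only [momentSeries, ecoeff_egf]
  refine h.congr_deriv ?_
  rw [mul_right_comm, sumLog_eq_statPoly]
  ring

/-- In the quotient defining the tilted mean, the terms `c` from the normalisation of the ensemble
cancel, and the insertion of `T_0 = ∑ log x_i` leaves the tilted covariance with `T_0`. -/
theorem hasDerivAt_kappa_withT (hα : -1 < α) {f : ℝ → ℝ} {g : MvPolynomial Bool ℝ}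
    (h : Represents f g) (n : ℕ) :
    HasDerivAt (fun a => kappa m a (withT f (n + 1))) (ecoeff n (tCov hα m g (tPoly 0))) α := by
  set c := PowerSeries.C (∫ x, MvPolynomial.eval (logPoints x) (sumLog m) ∂(ensemble m α)) with hc
  refine hasDerivAt_of_egf_mul (u := fun n a => kappa m a (withT f (n + 1)))
    (v := fun n a => ecoeff n (momentSeries m a 1))
    (w := fun n a => ecoeff n (momentSeries m a (statPoly m g)))
    (U := tMean hα m g) (V := momentSeries m α 1)
    (hasDerivAt_ecoeff_momentSeries hα (statPoly m g)) (hasDerivAt_ecoeff_momentSeries hα 1)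
    (kappa_withT hα h) (fun _ => rfl) ?_ (fun n => ?_) ?_ n
  · filter_upwards [lt_mem_nhds hα] with a ha
    exact ecoeff_zero_momentSeries_one m ha
  · filter_upwards [lt_mem_nhds hα] with a ha
    rw [momentSeries_statPoly m ha, ecoeff_mul]
    simp only [kappa_withT ha h]
  · rw [one_mul, momentSeries_statPoly_mul m hα, momentSeries_statPoly m hα,
      momentSeries_statPoly m hα]
    ring

/-- The cumulant structure: the difference of the two cumulants is the decoupled term. -/
theorem ecoeff_tCov_sub (hα : -1 < α) (n N k : ℕ) :
    ecoeff N (tCov hα (n + 1) (tPoly k) (tPoly 1)) - ecoeff N (tCov hα (n + 1) (tPoly (k + 1)) (tPoly 0))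
      = decoupled (n + 1) α (N + 2) k := by
  set d := PowerSeries.constantCoeff (tNorm hα n) with hd
  set e := PowerSeries.constantCoeff (tNorm hα (n + 1)) with he
  have hd0 : d ≠ 0 := constantCoeff_tNorm_ne_zero hα n
  have he0 : e ≠ 0 := constantCoeff_tNorm_ne_zero hα (n + 1)
  have hR : kappa (n + 1) α (withT (rFun 1) 1) = e * d⁻¹ := by
    have h1 : Represents (rFun 1) (MvPolynomial.X false) := by
      have := represents_rFun 1
      rwa [rPoly, pow_one] at this
    rw [kappa_withT hα h1 0, ecoeff_zero, constantCoeff_tMean_x]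
  set Hs : ℕ → PowerSeries ℝ := fun r => PowerSeries.C e⁻¹ *
    tilted hα (Polynomial.aeval xSeries (tiltedPoly hα (n + 1)) ^ 2 * PowerSeries.C (tPoly r))
    with hHs
  set hs : ℕ → PowerSeries ℝ := fun r => PowerSeries.C d * (Ring.inverse (tNorm hα n) ^ 2 *
    tilted hα (Polynomial.aeval xSeries (tiltedPoly hα n) ^ 2 * PowerSeries.C (tPoly r))) with hhs
  set Ds : ℕ → PowerSeries ℝ := fun r => tCov hα (n + 1) (tPoly r) (MvPolynomial.X false) with hDs
  -- With `s = j + 1` and `l = N + 2` the factorial weight is the binomial coefficient `N.choose j`,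
  -- so the sum over `s` is a product of exponential series.
  have hterm : ∀ j ∈ Finset.range (N + 1),
      ((N + 2 - 2).factorial : ℝ) / ((j + 1 - 1).factorial * (N + 2 - (j + 1) - 1).factorial) *
        (kappa (n + 1) α (withT (rFun 1) 1) * prodH (n + 1) α (N + 2) (j + 1) k
          - prodD (n + 1) α (N + 2) (j + 1) k)
      = ∑ r ∈ Finset.range k, (N.choose j : ℝ) * (e * d⁻¹ * (ecoeff j (Hs r) *
          ecoeff (N - j) (hs (k - r - 1))) - ecoeff j (Ds r) * ecoeff (N - j) (Ds (k - r - 1))) := by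
    intro j hj
    have hj' : j ≤ N := by simpa [Nat.lt_succ_iff] using hj
    rw [hR, show N + 2 - 2 = N by omega, show j + 1 - 1 = j by omega,
      show N + 2 - (j + 1) - 1 = N - j by omega, ← Nat.cast_choose ℝ hj', ← Finset.mul_sum,
      Finset.sum_sub_distrib, ← Finset.mul_sum, prodH, prodD]
    congr 2
    · congr 1
      refine Finset.sum_congr rfl fun r _ => ?_
      rw [show N + 2 - (j + 1) = (N - j) + 1 by omega, bigH_withT hα (represents_tFun r),
        smallH_withT hα (represents_tFun _)]
    · refine Finset.sum_congr rfl fun r _ => ?_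
      rw [show N + 2 - (j + 1) = (N - j) + 1 by omega, bigD_withT hα (represents_tFun r),
        bigD_withT hα (represents_tFun _)]
  have hdec : decoupled (n + 1) α (N + 2) k
      = ∑ r ∈ Finset.range k, (e * d⁻¹ * ecoeff N (Hs r * hs (k - r - 1))
        - ecoeff N (Ds r * Ds (k - r - 1))) := by
    rw [decoupled, show N + 2 - 1 = N + 1 by omega, ← Finset.Ico_add_one_right_eq_Icc,
      Finset.sum_Ico_eq_sum_range, show N + 1 + 1 - 1 = N + 1 by omega]
    simp only [add_comm 1]
    rw [Finset.sum_congr rfl hterm, Finset.sum_comm]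
    refine Finset.sum_congr rfl fun r _ => ?_
    rw [ecoeff_mul, ecoeff_mul, Finset.mul_sum, ← Finset.sum_sub_distrib]
    exact Finset.sum_congr rfl fun j _ => by ring
  rw [hdec, ← ecoeff_sub, tCov_sub_tCov, ecoeff_sum]
  refine Finset.sum_congr rfl fun r _ => ?_
  rw [ecoeff_sub, ← ecoeff_C_mul]
  congr 2
  -- The constants `e⁻¹` and `d` carried by `H` and `h` are exactly compensated by `κ(R) = e / d`.
  have hC : (PowerSeries.C (e * d⁻¹) : PowerSeries ℝ) * (PowerSeries.C e⁻¹ * PowerSeries.C d)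
      = 1 := by
    rw [← map_mul, ← map_mul, ← map_one PowerSeries.C]
    congr 1
    field_simp
  simp only [hHs, hhs]
  linear_combination (-(Ring.inverse (tNorm hα n) ^ 2 *
    (tilted hα (Polynomial.aeval xSeries (tiltedPoly hα (n + 1)) ^ 2 * PowerSeries.C (tPoly r)) *
      tilted hα (Polynomial.aeval xSeries (tiltedPoly hα n) ^ 2 *
        PowerSeries.C (tPoly (k - r - 1)))))) * hC

/-- `D_s(T_r, T, …, T)` in terms of cumulants. -/
theorem ecoeff_tCov_x_eq_sum (hα : -1 < α) (r n : ℕ) :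
    ecoeff n (tCov hα m (tPoly r) (MvPolynomial.X false))
      = ∑ i ∈ Finset.range (n + 1), (n.factorial : ℝ) / ((n - i).factorial : ℝ) *
        (((r + (n - i) : ℕ) : ℝ) * ecoeff (n - i) (tMean hα m (tPoly r))
          + ecoeff (n - i) (tMean hα m (rPoly r))) := by
  set D := tCov hα m (tPoly r) (MvPolynomial.X false) with hD
  have hx : MvPolynomial.X false = rPoly 1 := by rw [rPoly, pow_one]
  -- Since `x (x log x)' = x log x + x`, the covariance in the loop equation splits into the
  -- derivative of `⟨T_r⟩` and `D` itself, which makes the equation a recurrence for the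
  -- coefficients of `D`.
  have hrec : D = PowerSeries.C (r : ℝ) * tMean hα m (tPoly r) + tMean hα m (rPoly r)
      + PowerSeries.X * PowerSeries.derivative ℝ (tMean hα m (tPoly r)) + PowerSeries.X * D := by
    have h := tMean_eulerDerivation hα m (tPoly r)
    rw [eulerDerivation_tPoly, eulerDerivation_tPoly, tMean_add, tMean_smul, Nat.cast_one, one_smul,
      tCov_add_right, ← derivative_tMean, ← hx] at h
    rw [← hD] at h
    linear_combination -h
  have hstep : ∀ n, ecoeff n D = ((r + n : ℕ) : ℝ) * ecoeff n (tMean hα m (tPoly r))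
      + ecoeff n (tMean hα m (rPoly r)) + n * ecoeff (n - 1) D := by
    intro n
    conv_lhs => rw [hrec]
    rw [ecoeff_add, ecoeff_add, ecoeff_add, ecoeff_C_mul, ecoeff_X_mul, ecoeff_X_mul]
    cases n with
    | zero => simp
    | succ n =>
      rw [add_tsub_cancel_right, ← ecoeff_succ]
      push_cast
      ring
  induction n with
  | zero =>
    rw [hstep 0]
    simp
  | succ n ih =>
    rw [Finset.sum_range_succ', hstep (n + 1), add_tsub_cancel_right, ih, Finset.mul_sum, add_comm]
    congr 1
    · refine Finset.sum_congr rfl fun i _ => ?_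
      rw [show n + 1 - (i + 1) = n - i by omega, Nat.factorial_succ]
      push_cast
      ring
    · have : ((n + 1).factorial : ℝ) ≠ 0 := by positivity
      rw [Nat.sub_zero, div_self this, one_mul]

end Cumulants

end WishartLaguerre

end

/-! ### The theorem -/

theorem theorem1 (m : ℕ) (hm : 1 ≤ m) (α : ℝ) (hα : 0 ≤ α) :
    -- the ensemble is a probability law and all joint moments of the statistics exist
    (IsProbabilityMeasure (ensemble m α) ∧
      ∀ (k : ℕ) (p : ENNReal), p ≠ ⊤ →
        MemLp (linStat m (tFun k)) p (ensemble m α) ∧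
        MemLp (linStat m (rFun k)) p (ensemble m α)) ∧
    -- the decoupling structure
    (∀ l k : ℕ, 2 ≤ l →
      DifferentiableAt ℝ (fun a => kappa m a (withT (tFun (k + 1)) (l - 1))) α ∧
      kappa m α (withT (tFun k) l)
          - deriv (fun a => kappa m a (withT (tFun (k + 1)) (l - 1))) α
        = decoupled m α l k) ∧
    -- the factors `D_s(T_r, T, …, T)` in terms of cumulants of order at most `s`
    (∀ s r : ℕ, 1 ≤ s →
      bigD m α (withT (tFun r) s)
        = ∑ i ∈ Finset.range s, ((s - 1).factorial : ℝ) / ((s - 1 - i).factorial : ℝ) *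
            (((r + (s - 1 - i) : ℕ) : ℝ) * kappa m α (withT (tFun r) (s - i))
              + kappa m α (withT (rFun r) (s - i)))) := by
  -- The open range `α > -1` is the natural one, and it makes the derivative two-sided even at `α =
  -- 0`.
  have hα' : -1 < α := by linarith
  obtain ⟨n, rfl⟩ : ∃ n, m = n + 1 := ⟨m - 1, by omega⟩
  refine ⟨⟨isProbabilityMeasure_ensemble _ hα', fun k p hp =>
    ⟨memLp_linStat hα' (represents_tFun k) hp, memLp_linStat hα' (represents_rFun k) hp⟩⟩, ?_, ?_⟩
  · intro l k hl
    obtain ⟨N, rfl⟩ : ∃ N, l = N + 2 := ⟨l - 2, by omega⟩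
    have h := hasDerivAt_kappa_withT (m := n + 1) hα' (represents_tFun (k + 1)) N
    refine ⟨h.differentiableAt, ?_⟩
    -- The cumulant of order `N + 2` is the coefficient of order `N + 1` of `⟨T_k⟩`, hence that of
    -- order `N` of its derivative `Cov(T_k, T)`.
    rw [← ecoeff_tCov_sub hα' n N k, ← derivative_tMean, ← ecoeff_succ,
      ← kappa_withT hα' (represents_tFun k)]
    congr 1
    exact h.deriv
  · intro s r hs
    obtain ⟨N, rfl⟩ : ∃ N, s = N + 1 := ⟨s - 1, by omega⟩
    rw [bigD_withT hα' (represents_tFun r), ecoeff_tCov_x_eq_sum, add_tsub_cancel_right]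
    refine Finset.sum_congr rfl fun i hi => ?_
    have hi' : i ≤ N := by simpa [Nat.lt_succ_iff] using hi
    rw [show N + 1 - i = (N - i) + 1 by omega, kappa_withT hα' (represents_tFun r),
      kappa_withT hα' (represents_rFun r)]
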